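/- Let $\varepsilon\in\{1,-1\}$ and let $E_5=\mathbb R^5$ carry the flat metric $\eta=\mathrm{diag}(1,1,1,-1,\varepsilon)$. Let $U\subseteq\mathbb R^4$ be a connected open set (a coordinate patch of a space-time), let $X:U\to E_5$ be a smooth immersion whose induced metric $g=X^*\eta$ is Lorentzian, with smooth unit normal $\xi$, $\eta(\xi,\xi)=\varepsilon$, and let $\Omega(V,W)=\eta(\tilde\nabla_V W,\xi)$ be its second fundamental form and $H=\varepsilon\,(\mathrm{tr}_g\Omega)\,\xi$ its mean curvature vector. Let $\{w,v,q,u\}$ be a smooth $g$-orthonormal tetrad with $u$ timelike in which $\Omega$ is diagonal, $$\Omega_{\alpha\beta}=\sigma w_\alpha w_\beta+\lambda v_\alpha v_\beta+\nu q_\alpha q_\beta-\mu u_\alpha u_\beta ,$$ with functions $\mu,\lambda,\nu,\sigma$ on $U$. Suppose that the immersion is ideal with $k=1$, $n_1=3$ and spacelike plane section $L=\mathrm{span}\{w,v,q\}$, i.e. $$\eta(H,H)=c(3)\,\bigl(R-\tau(L)\bigr),\qquad c(3)=\frac{2(4+1-3)}{4+1-1-3}=4,$$ at every point of $U$, where $\tau(L)$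 and $R$ are the sums of the sectional curvatures $K(e_\alpha\wedge e_\beta)$ over the pairs $\alpha<\beta$ of the orthonormal basis of $L$ and of the whole tangent space, respectively (so that $\sigma=\mu-\lambda-\nu$). 1. If on $U$ either $\mu=-\lambda,\ \nu=\lambda$, or $\mu=-\nu,\ \lambda=-3\nu$, or $\mu=-\lambda,\ \nu=-3\lambda$, then $\mu=\lambda=\nu=0$ on $U$ and $(U,g)$ is flat. 2. If $\mu=3\lambda$ and $\nu=\lambda$ on $U$, then either $\lambda=0$ on $U$ and $(U,g)$ is flat, or there are $k\in\{1,0,-1\}$ and a constant $c\neq0$ such that every point of $U$ has a neighbourhood with smooth coordinates $(r,\phi,\psi,t)$ (with $r>0$, $r<\pi$ if $k=1$, and $0<\phi<\pi$), in which $u=\partial_t$ and $g$ is the Robertson–Walker metric $$ds^2=a(t)^2\{dr^2+\Sigma(r,k)^2(d\phi^2+\sin^2\phi\,d\psi^2)\}-dt^2,\qquad \Sigma(r,k)=\sin r,\ r,\ \sinh r\ \text{ for }k=1,0,-1,$$ where the scale factor $a>0$ is smooth and satisfies $$(\partial_t a)^2=\varepsilon c^2a^6-k,\qquad \lambda=c\,a^2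 .$$ Moreover, for real numbers $\kappa,\rho,p$ and a tangent vector $V$ at a point of the neighbourhood, $V$ is unit timelike and the Einstein equations $R_{\alpha\beta}-\tfrac12 S g_{\alpha\beta}=\kappa\{(\rho+p)V_\alpha V_\beta+p\,g_{\alpha\beta}\}$ of a perfect fluid hold there ($R_{\alpha\beta}$ the Ricci tensor, $S$ its trace) if and only if $V=\pm u$ and $$\kappa\rho=3\varepsilon c^2a^4,\qquad \kappa p=-7\varepsilon c^2a^4 ;$$ for $\varepsilon=+1$ these are $\kappa\rho=3c^2a^4$ and $\kappa p=-7c^2a^4$. -/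

import Mathlib

open scoped ContDiff

noncomputable section

namespace IdealEmbedding

/-- Points (and tangent vectors) of a four-dimensional coordinate patch. -/
abbrev Coord : Type := Fin 4 → ℝ

/-- Points (and vectors) of the five-dimensional ambient space. -/
abbrev Ambient : Type := Fin 5 → ℝ

/-- The pseudo-Euclidean scalar product on the ambient space: signature `(4,1)` for `ε = 1`
and signature `(3,2)` for `ε = -1`. -/
def eta (ε : ℝ) (A B : Ambient) : ℝ :=
  A 0 * B 0 + A 1 * B 1 + A 2 * B 2 - A 3 * B 3 + ε * (A 4 * B 4)

/-! ### Intrinsic geometry of a metric on a coordinate patch -/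

/-- A field of symmetric bilinear forms, given by its coordinate components. -/
abbrev MetricField : Type := Coord → Matrix (Fin 4) (Fin 4) ℝ

/-- The partial derivative in the `i`-th coordinate direction. -/
def pderiv (i : Fin 4) (f : Coord → ℝ) (x : Coord) : ℝ :=
  fderiv ℝ f x (Pi.single i 1)

/-- `g_x(V, W)`. -/
def MetricField.inner (g : MetricField) (x : Coord) (V W : Coord) : ℝ :=
  ∑ i, ∑ j, g x i j * V i * W j

/-- The Christoffel symbol `Γ^l_{ij}` of the Levi-Civita connection. -/
def christoffel (g : MetricField) (l i j : Fin 4) (x : Coord) : ℝ :=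
  (1 / 2) * ∑ m, (g x)⁻¹ l m *
    (pderiv i (fun y => g y j m) x + pderiv j (fun y => g y i m) x
      - pderiv m (fun y => g y i j) x)

/-- The component `R^l_{kij}` of the Riemann tensor, with
`R(∂_i, ∂_j) ∂_k = ∇_i ∇_j ∂_k - ∇_j ∇_i ∂_k = ∑ l, R^l_{kij} ∂_l`. -/
def riemann (g : MetricField) (l k i j : Fin 4) (x : Coord) : ℝ :=
  pderiv i (christoffel g l j k) x - pderiv j (christoffel g l i k) x
    + ∑ m, (christoffel g l i m x * christoffel g m j k x
      - christoffel g l j m x * christoffel g m i k x)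

/-- The metric is flat at `x`: its Riemann tensor vanishes there. -/
def IsFlatAt (g : MetricField) (x : Coord) : Prop :=
  ∀ l k i j, riemann g l k i j x = 0

/-- The vector `R(V, W) Z`. -/
def curvatureOp (g : MetricField) (x : Coord) (V W Z : Coord) : Coord :=
  fun l => ∑ k, ∑ i, ∑ j, riemann g l k i j x * V i * W j * Z k

/-- The sectional curvature of the plane spanned by two orthonormal (non-null) vectors. -/
def sectional (g : MetricField) (x : Coord) (V W : Coord) : ℝ :=
  g.inner x V V * g.inner x W W * g.inner x (curvatureOp g x V W W) V

/-- The scalar curvature `∑_{α<β} K(e_α ∧ e_β)` of the plane section spanned by the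
orthonormal vectors `e`. If `e` is a basis of the whole tangent space, this is the scalar
curvature of the manifold in the normalization without double counting. -/
def sectionScalar (g : MetricField) (x : Coord) {r : ℕ} (e : Fin r → Coord) : ℝ :=
  ∑ α, ∑ β, if α < β then sectional g x (e α) (e β) else 0

/-- The Ricci tensor. -/
def ricci (g : MetricField) (k j : Fin 4) (x : Coord) : ℝ :=
  ∑ i, riemann g i k i j x

/-- The trace of the Ricci tensor. -/
def ricciScalar (g : MetricField) (x : Coord) : ℝ :=
  ∑ k, ∑ j, (g x)⁻¹ k j * ricci g k j x

/-- The Einstein tensor. -/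
def einstein (g : MetricField) (i j : Fin 4) (x : Coord) : ℝ :=
  ricci g i j x - (1 / 2) * ricciScalar g x * g x i j

/-- At `x` the Einstein equations `G_{ij} = κ T_{ij}` hold for a perfect fluid
`T_{ij} = (ρ + p) V_i V_j + p g_{ij}` with energy density `ρ`, pressure `p` and
unit timelike four-velocity `V`. -/
def IsPerfectFluidAt (g : MetricField) (κ ρ p : ℝ) (V : Coord) (x : Coord) : Prop :=
  g.inner x V V = -1 ∧
    ∀ i j, einstein g i j x =
      κ * ((ρ + p) * (∑ m, g x i m * V m) * (∑ m, g x j m * V m) + p * g x i j)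

/-! ### Geometry of an immersed hypersurface -/

/-- The induced metric `g_{ij} = η(∂_i X, ∂_j X)`. -/
def inducedMetric (ε : ℝ) (X : Coord → Ambient) : MetricField := fun x =>
  Matrix.of fun i j => eta ε (fderiv ℝ X x (Pi.single i 1)) (fderiv ℝ X x (Pi.single j 1))

/-- The component of the second fundamental form along the unit normal `ξ`:
`Ω(V, W) = η(D_V (dX(W)), ξ)`, where `D` is the flat connection of the ambient space. -/
def secondFF (ε : ℝ) (X ξ : Coord → Ambient) (x : Coord) (V W : Coord) : ℝ :=
  eta ε (fderiv ℝ (fun y => fderiv ℝ X y W) x V) (ξ x)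

/-- The mean curvature vector `H = ε (g^{ij} Ω_{ij}) ξ`. -/
def meanCurvature (ε : ℝ) (X ξ : Coord → Ambient) (x : Coord) : Ambient :=
  (ε * ∑ i, ∑ j, (inducedMetric ε X x)⁻¹ i j *
    secondFF ε X ξ x (Pi.single i 1) (Pi.single j 1)) • ξ x

/-- The constant `c(n₁, …, n_k) = 2 (m + k - ∑ n_j) / (m + k - 1 - ∑ n_j)`. -/
def chenConst (m : ℕ) (n : List ℕ) : ℝ :=
  2 * ((m : ℝ) + n.length - n.sum) / ((m : ℝ) + n.length - 1 - n.sum)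

/-- `X : U → E₅` is an isometric immersion of a space-time (a coordinate patch `U` with the
induced Lorentzian metric) with unit normal `ξ`, ideal for `k = 1`, `n₁ = 3`, with adapted
orthonormal tetrad `w, v, q` (spacelike), `u` (timelike).

* The second fundamental form is diagonal in the tetrad; its principal curvatures along
  `w, v, q, u` are `σ, lam, ν, μ`.
* There is equality `‖H‖² = c(3) (R - τ(L))` in the inequality between the squared mean
  curvature and the curvature invariant, attained on the spacelike `3`-plane section
  `L = span {w, v, q}`. -/
structure IsIdealTetrad (ε : ℝ) (U : Set Coord) (X ξ : Coord → Ambient)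
    (w v q u : Coord → Coord) (μ lam ν σ : Coord → ℝ) : Prop where
  smooth_X : ContDiffOn ℝ ∞ X U
  smooth_ξ : ContDiffOn ℝ ∞ ξ U
  smooth_w : ContDiffOn ℝ ∞ w U
  smooth_v : ContDiffOn ℝ ∞ v U
  smooth_q : ContDiffOn ℝ ∞ q U
  smooth_u : ContDiffOn ℝ ∞ u U
  normal : ∀ x ∈ U, ∀ V, eta ε (fderiv ℝ X x V) (ξ x) = 0
  unit_normal : ∀ x ∈ U, eta ε (ξ x) (ξ x) = ε
  orthonormal : ∀ x ∈ U, ∀ α β : Fin 4,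
    (inducedMetric ε X).inner x (![w x, v x, q x, u x] α) (![w x, v x, q x, u x] β)
      = if α = β then (![1, 1, 1, -1] : Fin 4 → ℝ) α else 0
  diagonal : ∀ x ∈ U, ∀ V W, secondFF ε X ξ x V W =
    σ x * (inducedMetric ε X).inner x (w x) V * (inducedMetric ε X).inner x (w x) W
    + lam x * (inducedMetric ε X).inner x (v x) V * (inducedMetric ε X).inner x (v x) W
    + ν x * (inducedMetric ε X).inner x (q x) V * (inducedMetric ε X).inner x (q x) W
    - μ x * (inducedMetric ε X).inner x (u x) V * (inducedMetric ε X).inner x (u x) W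
  chen_equality : ∀ x ∈ U,
    eta ε (meanCurvature ε X ξ x) (meanCurvature ε X ξ x) =
      chenConst 4 [3] *
        (sectionScalar (inducedMetric ε X) x ![w x, v x, q x, u x]
          - sectionScalar (inducedMetric ε X) x ![w x, v x, q x])

/-! ### Robertson-Walker metrics -/

/-- `Σ(r, k) = sin r, r, sinh r` for `k = 1, 0, -1`. -/
def rwSigma (k : ℤ) (r : ℝ) : ℝ :=
  if k = 1 then Real.sin r else if k = 0 then r else Real.sinh r

/-- The Robertson-Walker metric
`a(t)² (dr² + Σ(r,k)² (dφ² + sin² φ dψ²)) - dt²` in the coordinates `z = (r, φ, ψ, t)`. -/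
def rwInner (k : ℤ) (a : ℝ → ℝ) (z V W : Coord) : ℝ :=
  a (z 3) ^ 2 * (V 0 * W 0 + rwSigma k (z 0) ^ 2 *
    (V 1 * W 1 + Real.sin (z 1) ^ 2 * (V 2 * W 2))) - V 3 * W 3

/-- `Φ = (r, φ, ψ, t)` is a smooth change of coordinates that brings the metric `g` on its
domain to Robertson-Walker form with scale factor `a` and spatial curvature `k`. -/
structure IsRobertsonWalkerChart (g : MetricField) (k : ℤ) (a : ℝ → ℝ)
    (Φ : OpenPartialHomeomorph Coord Coord) : Prop where
  smooth : ContDiffOn ℝ ∞ Φ Φ.source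
  smooth_symm : ContDiffOn ℝ ∞ Φ.symm Φ.target
  smooth_a : ∀ z ∈ Φ.target, ContDiffAt ℝ ∞ a (z 3)
  a_pos : ∀ z ∈ Φ.target, 0 < a (z 3)
  r_range : ∀ z ∈ Φ.target, 0 < z 0 ∧ (k = 1 → z 0 < Real.pi)
  φ_range : ∀ z ∈ Φ.target, 0 < z 1 ∧ z 1 < Real.pi
  isometry : ∀ y ∈ Φ.source, ∀ V W,
    g.inner y V W = rwInner k a (Φ y) (fderiv ℝ Φ y V) (fderiv ℝ Φ y W)

end IdealEmbedding

end

open IdealEmbedding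

/-!
Equality in Chen's inequality forces `σ + λ + ν = μ`. What remains are the Gauss and Codazzi
equations, written with the connection coefficients of the principal tetrad.

In the three cases of the first part the principal curvatures are `-3l, l, l, -l` up to a
permutation of the spacelike directions. Codazzi leaves only the connection matrices
`ratioConnection`, and Gauss then forces `l = 0`.

In the second part the principal curvatures are `λ, λ, λ, 3λ`. Codazzi shows that `dλ` and the
connection form of `u` are multiples of `dt = -g(u, ·)`: with the Hubble rate `θ`,
`dλ = 2 θ λ dt`, so `λ` vanishes everywhere or nowhere on a connected `U`, and Gauss gives
`dθ = (3 ε λ² - θ²) dt`. Hence `(ε λ² - θ²) λ` is constant. With `λ = c a²` this is the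
Friedmann equation `(a θ)² = ε c² a⁶ - k`, and `c` can be chosen with `k ∈ {1, 0, -1}`.

The vector `c a³ dX(u) + a θ ξ` of `E₅` is constant, and its orthogonal hyperplanes cut the
hypersurface in the time slices. Each slice is homothetic, by a rescaling of `ξ`, to the space of
constant curvature `k`, modelled as the quadric `y₀² + y₁² + y₂² + k T² = 2 T` with the metric
`dy² + k dT²`. Unlike the unit sphere and its hyperbolic counterpart it makes sense for `k = 0` as
well, where it is a paraboloid, and polar coordinates on it give `(r, φ, ψ)` for the three signs at
once.
-/

noncomputable section

namespace IdealEmbedding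

/-! ### Orthonormal frames and the ambient scalar product -/

section OrthonormalFrame

variable {K V ι : Type*} [Field K] [AddCommGroup V] [Module K V] [FiniteDimensional K V]
  [Fintype ι] [DecidableEq ι]
  {B : LinearMap.BilinForm K V} {s : ι → K} {F : ι → V}

lemma eq_sum_smul_of_orthonormal (hs : ∀ a, s a * s a = 1)
    (hF : ∀ a b, B (F a) (F b) = if a = b then s a else 0)
    (hcard : Fintype.card ι = Module.finrank K V) (v : V) :
    v = ∑ a, (s a * B v (F a)) • F a := by
  have hs0 (a : ι) : s a ≠ 0 := fun h0 => by simpa [h0] using hs a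
  have hli : LinearIndependent K F := LinearMap.BilinForm.linearIndependent_of_iIsOrtho
    (B := B) (fun a b hab => by simp [Function.onFun, hF, hab]) fun a => by simp [hF, hs0]
  have hspan : v ∈ Submodule.span K (Set.range F) := by
    rw [hli.span_eq_top_of_card_eq_finrank' hcard]
    exact Submodule.mem_top
  obtain ⟨c, rfl⟩ := (Submodule.mem_span_range_iff_exists_fun K).1 hspan
  refine Finset.sum_congr rfl fun a _ => ?_
  have hc : B (∑ b, c b • F b) (F a) = c a * s a := by simp [hF]
  rw [hc, mul_comm (c a), ← mul_assoc, hs, one_mul]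

end OrthonormalFrame

section Eta

/-- The scalar product `eta ε` as a continuous bilinear form. -/
def etaL (ε : ℝ) : Ambient →L[ℝ] Ambient →L[ℝ] ℝ :=
  let π (i : Fin 5) : Ambient →L[ℝ] ℝ := ContinuousLinearMap.proj i
  (π 0).smulRight (π 0) + (π 1).smulRight (π 1) + (π 2).smulRight (π 2)
    - (π 3).smulRight (π 3) + ε • (π 4).smulRight (π 4)

lemma etaL_apply (ε : ℝ) (A B : Ambient) : etaL ε A B = eta ε A B := by
  simp [etaL, eta]

lemma eta_comm (ε : ℝ) (A B : Ambient) : eta ε A B = eta ε B A := by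
  simp only [eta]; ring

lemma eta_add_left (ε : ℝ) (A B C : Ambient) : eta ε (A + B) C = eta ε A C + eta ε B C := by
  simp [← etaL_apply]

lemma eta_sub_left (ε : ℝ) (A B C : Ambient) : eta ε (A - B) C = eta ε A C - eta ε B C := by
  simp [← etaL_apply]

lemma eta_neg_left (ε : ℝ) (A C : Ambient) : eta ε (-A) C = -eta ε A C := by
  simp [← etaL_apply]

lemma eta_smul_left (ε r : ℝ) (A C : Ambient) : eta ε (r • A) C = r * eta ε A C := by
  simp [← etaL_apply]

lemma eta_sum_left {ι : Type*} (ε : ℝ) (s : Finset ι) (A : ι → Ambient) (C : Ambient) :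
    eta ε (∑ i ∈ s, A i) C = ∑ i ∈ s, eta ε (A i) C := by
  simp [← etaL_apply]

lemma eta_add_right (ε : ℝ) (A B C : Ambient) : eta ε C (A + B) = eta ε C A + eta ε C B := by
  simp [← etaL_apply]

lemma eta_sub_right (ε : ℝ) (A B C : Ambient) : eta ε C (A - B) = eta ε C A - eta ε C B := by
  simp [← etaL_apply]

lemma eta_neg_right (ε : ℝ) (A C : Ambient) : eta ε C (-A) = -eta ε C A := by
  simp [← etaL_apply]

lemma eta_smul_right (ε r : ℝ) (A C : Ambient) : eta ε C (r • A) = r * eta ε C A := by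
  simp [← etaL_apply]

lemma eta_sum_right {ι : Type*} (ε : ℝ) (s : Finset ι) (A : ι → Ambient) (C : Ambient) :
    eta ε C (∑ i ∈ s, A i) = ∑ i ∈ s, eta ε C (A i) := by
  simp [← etaL_apply]

variable {E : Type*} [NormedAddCommGroup E] [NormedSpace ℝ E] {f g : E → Ambient}

lemma fderiv_eta {x : E} (hf : DifferentiableAt ℝ f x) (hg : DifferentiableAt ℝ g x)
    (ε : ℝ) (V : E) :
    fderiv ℝ (fun y => eta ε (f y) (g y)) x V =
      eta ε (fderiv ℝ f x V) (g x) + eta ε (f x) (fderiv ℝ g x V) := by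
  simp only [← etaL_apply]
  rw [(etaL ε).fderiv_of_bilinear hf hg]
  exact add_comm _ _

lemma fderiv_eta_const {x : E} (hf : DifferentiableAt ℝ f x) (ε : ℝ) (C : Ambient) (V : E) :
    fderiv ℝ (fun y => eta ε (f y) C) x V = eta ε (fderiv ℝ f x V) C := by
  rw [fderiv_eta hf (differentiableAt_const C), fderiv_fun_const, ← etaL_apply ε (f x)]
  simp

lemma contDiffOn_eta {s : Set E} {n : WithTop ℕ∞} (hf : ContDiffOn ℝ n f s)
    (hg : ContDiffOn ℝ n g s) (ε : ℝ) : ContDiffOn ℝ n (fun y => eta ε (f y) (g y)) s := by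
  simp only [← etaL_apply]
  exact (contDiffOn_const.clm_apply hf).clm_apply hg

end Eta

/-! ### Calculus on open sets -/

section Calculus

variable {E F : Type*} [NormedAddCommGroup E] [NormedSpace ℝ E]
  [NormedAddCommGroup F] [NormedSpace ℝ F]

lemma contDiffAt_of_smoothOn {f : E → F} {U : Set E} (hU : IsOpen U) (hf : ContDiffOn ℝ ∞ f U)
    {x : E} (hx : x ∈ U) (n : ℕ) : ContDiffAt ℝ n f x :=
  (hf.contDiffAt (hU.mem_nhds hx)).of_le (mod_cast le_top)

lemma differentiableAt_of_smoothOn {f : E → F} {U : Set E} (hU : IsOpen U)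
    (hf : ContDiffOn ℝ ∞ f U) {x : E} (hx : x ∈ U) : DifferentiableAt ℝ f x :=
  (hf.contDiffAt (hU.mem_nhds hx)).differentiableAt (by simp)

lemma smoothOn_fderiv {f : E → F} {U : Set E} (hU : IsOpen U)
    (hf : ContDiffOn ℝ ∞ f U) : ContDiffOn ℝ ∞ (fderiv ℝ f) U :=
  hf.fderiv_of_isOpen hU (by simp)

lemma smoothOn_fderiv_apply {f : E → F} {p : E → E} {U : Set E} (hU : IsOpen U)
    (hf : ContDiffOn ℝ ∞ f U) (hp : ContDiffOn ℝ ∞ p U) :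
    ContDiffOn ℝ ∞ (fun y => fderiv ℝ f y (p y)) U :=
  (smoothOn_fderiv hU hf).clm_apply hp

lemma fderiv_eq_of_eqOn {f g : E → F} {U : Set E} (hU : IsOpen U)
    (hfg : ∀ y ∈ U, f y = g y) {x : E} (hx : x ∈ U) : fderiv ℝ f x = fderiv ℝ g x :=
  Filter.EventuallyEq.fderiv_eq (by filter_upwards [hU.mem_nhds hx] with y hy using hfg y hy)

lemma fderiv_const_mul_field (c : ℝ) (f : E → ℝ) (x : E) :
    fderiv ℝ (fun y => c * f y) x = c • fderiv ℝ f x :=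
  congrFun (fderiv_const_smul_field c) x

lemma fderiv_eta_add_eq_zero {f g : E → Ambient} {U : Set E} {ε c : ℝ} (hU : IsOpen U)
    (hf : ContDiffOn ℝ ∞ f U) (hg : ContDiffOn ℝ ∞ g U) (hc : ∀ y ∈ U, eta ε (f y) (g y) = c)
    {x : E} (hx : x ∈ U) (V : E) :
    eta ε (fderiv ℝ f x V) (g x) + eta ε (f x) (fderiv ℝ g x V) = 0 := by
  rw [← fderiv_eta (differentiableAt_of_smoothOn hU hf hx) (differentiableAt_of_smoothOn hU hg hx),
    fderiv_eq_of_eqOn hU hc hx]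
  simp

lemma fderiv_commutator {f : E → F} {p r : E → E} {x : E} (hf : ContDiffAt ℝ 2 f x)
    (hp : DifferentiableAt ℝ p x) (hr : DifferentiableAt ℝ r x) :
    fderiv ℝ (fun y => fderiv ℝ f y (r y)) x (p x)
      - fderiv ℝ (fun y => fderiv ℝ f y (p y)) x (r x)
      = fderiv ℝ f x (VectorField.lieBracket ℝ p r x) := by
  have hd : DifferentiableAt ℝ (fderiv ℝ f) x :=
    (hf.fderiv_right (m := 1) (by norm_num)).differentiableAt (by simp)
  have hs : IsSymmSndFDerivAt ℝ f x := hf.isSymmSndFDerivAt (by simp)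
  rw [fderiv_clm_apply hd hr, fderiv_clm_apply hd hp]
  simp only [add_apply, ContinuousLinearMap.comp_apply,
    ContinuousLinearMap.flip_apply, map_sub, VectorField.lieBracket_eq]
  rw [hs (p x) (r x)]
  abel

lemma fderiv_fderiv_comm {f : E → F} {x : E} (hf : ContDiffAt ℝ 2 f x) (V W : E) :
    fderiv ℝ (fun y => fderiv ℝ f y W) x V = fderiv ℝ (fun y => fderiv ℝ f y V) x W := by
  have := fderiv_commutator hf (differentiableAt_const V) (differentiableAt_const W)
  simpa [VectorField.lieBracket_eq, sub_eq_zero] using this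

end Calculus

/-! ### Principal frames of a hypersurface -/

/-- The signs of a Lorentzian orthonormal tetrad. -/
def tetradSign : Fin 4 → ℝ := ![1, 1, 1, -1]

lemma tetradSign_mul_self (a : Fin 4) : tetradSign a * tetradSign a = 1 := by
  fin_cases a <;> simp [tetradSign]

lemma tetradSign_ne_zero (a : Fin 4) : tetradSign a ≠ 0 := fun h0 => by
  simpa [h0] using tetradSign_mul_self a

lemma tetradSign_of_ne_three {a : Fin 4} (ha : a ≠ 3) : tetradSign a = 1 := by
  fin_cases a <;> simp_all [tetradSign]

lemma tetradSign_three : tetradSign 3 = -1 := rfl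

/-- A smooth orthonormal tetrad `e` of principal directions of the hypersurface `X`, with
unit normal `ξ` and principal curvatures `κ`; the timelike vector is `e 3`. -/
structure PrincipalFrame (ε : ℝ) (U : Set Coord) (X ξ : Coord → Ambient)
    (e : Fin 4 → Coord → Coord) (κ : Fin 4 → Coord → ℝ) : Prop where
  sq_sign : ε * ε = 1
  isOpen : IsOpen U
  smooth_X : ContDiffOn ℝ ∞ X U
  smooth_ξ : ContDiffOn ℝ ∞ ξ U
  smooth_e : ∀ a, ContDiffOn ℝ ∞ (e a) U
  normal : ∀ x ∈ U, ∀ V, eta ε (fderiv ℝ X x V) (ξ x) = 0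
  unit_normal : ∀ x ∈ U, eta ε (ξ x) (ξ x) = ε
  orthonormal : ∀ x ∈ U, ∀ a b, eta ε (fderiv ℝ X x (e a x)) (fderiv ℝ X x (e b x)) =
    if a = b then tetradSign a else 0
  principal : ∀ x ∈ U, ∀ a V, secondFF ε X ξ x (e a x) V =
    κ a x * eta ε (fderiv ℝ X x (e a x)) (fderiv ℝ X x V)

/-- The image `dX(e_a)` of a tetrad vector in the ambient space. -/
def pushFrame (X : Coord → Ambient) (e : Fin 4 → Coord → Coord) (a : Fin 4) (x : Coord) :
    Ambient := fderiv ℝ X x (e a x)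

/-- The connection coefficient `η(D_{e_a} (dX(e_b)), dX(e_c))`. -/
def connCoeff (ε : ℝ) (X : Coord → Ambient) (e : Fin 4 → Coord → Coord) (a b c : Fin 4)
    (x : Coord) : ℝ :=
  eta ε (fderiv ℝ (pushFrame X e b) x (e a x)) (pushFrame X e c x)

namespace PrincipalFrame

variable {ε : ℝ} {U : Set Coord} {X ξ : Coord → Ambient} {e : Fin 4 → Coord → Coord}
  {κ : Fin 4 → Coord → ℝ} (h : PrincipalFrame ε U X ξ e κ)
include h

lemma sign_ne_zero : ε ≠ 0 := fun h0 => by simpa [h0] using h.sq_sign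

lemma mono {V : Set Coord} (hV : IsOpen V) (hVU : V ⊆ U) : PrincipalFrame ε V X ξ e κ where
  sq_sign := h.sq_sign
  isOpen := hV
  smooth_X := h.smooth_X.mono hVU
  smooth_ξ := h.smooth_ξ.mono hVU
  smooth_e a := (h.smooth_e a).mono hVU
  normal x hx := h.normal x (hVU hx)
  unit_normal x hx := h.unit_normal x (hVU hx)
  orthonormal x hx := h.orthonormal x (hVU hx)
  principal x hx := h.principal x (hVU hx)

lemma perm (π : Equiv.Perm (Fin 4)) (hπ : ∀ a, tetradSign (π a) = tetradSign a) :
    PrincipalFrame ε U X ξ (e ∘ π) (κ ∘ π) where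
  sq_sign := h.sq_sign
  isOpen := h.isOpen
  smooth_X := h.smooth_X
  smooth_ξ := h.smooth_ξ
  smooth_e a := h.smooth_e (π a)
  normal := h.normal
  unit_normal := h.unit_normal
  orthonormal x hx a b := by
    simp only [Function.comp_apply, h.orthonormal x hx, EmbeddingLike.apply_eq_iff_eq, hπ]
  principal x hx a := h.principal x hx (π a)

lemma smooth_pushFrame (a : Fin 4) : ContDiffOn ℝ ∞ (pushFrame X e a) U :=
  smoothOn_fderiv_apply h.isOpen h.smooth_X (h.smooth_e a)

lemma smooth_connCoeff (a b c : Fin 4) : ContDiffOn ℝ ∞ (connCoeff ε X e a b c) U :=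
  contDiffOn_eta (smoothOn_fderiv_apply h.isOpen (h.smooth_pushFrame b) (h.smooth_e a))
    (h.smooth_pushFrame c) ε

variable {x : Coord} (hx : x ∈ U)
include hx

lemma eta_pushFrame (a b : Fin 4) :
    eta ε (pushFrame X e a x) (pushFrame X e b x) = if a = b then tetradSign a else 0 :=
  h.orthonormal x hx a b

lemma eta_pushFrame_normal (a : Fin 4) : eta ε (pushFrame X e a x) (ξ x) = 0 :=
  h.normal x hx _

lemma eta_normal_left (V : Coord) : eta ε (ξ x) (fderiv ℝ X x V) = 0 := by
  rw [eta_comm, h.normal x hx]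

lemma ambient_eq_sum (A : Ambient) :
    A = ∑ a, (tetradSign a * eta ε A (pushFrame X e a x)) • pushFrame X e a x
      + (ε * eta ε A (ξ x)) • ξ x := by
  have hs : ∀ a : Fin 5, (![1, 1, 1, -1, ε] : Fin 5 → ℝ) a * ![1, 1, 1, -1, ε] a = 1 := by
    intro a
    fin_cases a <;> simp [h.sq_sign]
  set F : Fin 5 → Ambient :=
    ![pushFrame X e 0 x, pushFrame X e 1 x, pushFrame X e 2 x, pushFrame X e 3 x, ξ x] with hFdef
  have hF : ∀ a b, (etaL ε).toBilinForm (F a) (F b) =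
      if a = b then (![1, 1, 1, -1, ε] : Fin 5 → ℝ) a else 0 := by
    have h1 := h.eta_pushFrame hx
    have h2 := h.eta_pushFrame_normal hx
    have h3 (a) : eta ε (ξ x) (pushFrame X e a x) = 0 := h.eta_normal_left hx _
    intro a b
    fin_cases a <;> fin_cases b <;>
      simp [hFdef, etaL_apply, h1, h2, h3, h.unit_normal x hx, tetradSign]
  have key := eq_sum_smul_of_orthonormal hs hF (by simp) A
  simp only [ContinuousLinearMap.toBilinForm_apply, etaL_apply, hFdef] at key
  rw [Fin.sum_univ_five] at key
  simpa [Fin.sum_univ_four, tetradSign] using key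

lemma eta_eq_sum (A B : Ambient) :
    eta ε A B = ∑ a, tetradSign a * eta ε A (pushFrame X e a x) * eta ε B (pushFrame X e a x)
      + ε * eta ε A (ξ x) * eta ε B (ξ x) := by
  conv_lhs => rw [h.ambient_eq_sum hx A]
  simp only [eta_add_left, eta_sum_left, eta_smul_left, eta_comm ε B]

lemma ambient_ext {A B : Ambient}
    (h1 : ∀ a, eta ε A (pushFrame X e a x) = eta ε B (pushFrame X e a x))
    (h2 : eta ε A (ξ x) = eta ε B (ξ x)) : A = B := by
  rw [h.ambient_eq_sum hx A, h.ambient_eq_sum hx B, h2]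
  simp only [h1]

lemma tangent_eq_sum (V : Coord) :
    V = ∑ a, (tetradSign a * eta ε (fderiv ℝ X x V) (pushFrame X e a x)) • e a x := by
  have hF : ∀ a b, ((etaL ε).bilinearComp (fderiv ℝ X x) (fderiv ℝ X x)).toBilinForm
      (e a x) (e b x) = if a = b then tetradSign a else 0 := by
    simpa [etaL_apply] using h.orthonormal x hx
  simpa [etaL_apply, pushFrame] using eq_sum_smul_of_orthonormal tetradSign_mul_self hF (by simp) V

lemma map_eq_sum {F : Type*} [AddCommGroup F] [Module ℝ F] (L : Coord →ₗ[ℝ] F) (V : Coord) :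
    L V = ∑ a, (tetradSign a * eta ε (fderiv ℝ X x V) (pushFrame X e a x)) • L (e a x) := by
  conv_lhs => rw [h.tangent_eq_sum hx V]
  simp only [map_sum, map_smul]

lemma weingarten (V W : Coord) :
    eta ε (fderiv ℝ ξ x V) (fderiv ℝ X x W) = -secondFF ε X ξ x V W := by
  have := fderiv_eta_add_eq_zero h.isOpen
    (smoothOn_fderiv_apply h.isOpen h.smooth_X (contDiffOn_const (c := W))) h.smooth_ξ
    (fun y hy => h.normal y hy W) hx V
  rw [secondFF, eta_comm]
  linarith

lemma eta_fderiv_normal_normal (V : Coord) : eta ε (fderiv ℝ ξ x V) (ξ x) = 0 := by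
  have := fderiv_eta_add_eq_zero h.isOpen h.smooth_ξ h.smooth_ξ h.unit_normal hx V
  rw [eta_comm ε (ξ x)] at this
  linarith

lemma fderiv_normal_frame (a : Fin 4) :
    fderiv ℝ ξ x (e a x) = -(κ a x • pushFrame X e a x) := by
  refine h.ambient_ext hx (fun b => ?_) ?_
  · rw [pushFrame, h.weingarten hx, h.principal x hx, eta_neg_left, eta_smul_left]
    rfl
  · rw [h.eta_fderiv_normal_normal hx, eta_neg_left, eta_smul_left, h.eta_pushFrame_normal hx]
    simp

lemma eta_fderiv_pushFrame_normal (a b : Fin 4) :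
    eta ε (fderiv ℝ (pushFrame X e b) x (e a x)) (ξ x) =
      if a = b then κ a x * tetradSign a else 0 := by
  have := fderiv_eta_add_eq_zero h.isOpen (h.smooth_pushFrame b) h.smooth_ξ
    (fun y hy => h.eta_pushFrame_normal hy b) hx (e a x)
  rw [h.fderiv_normal_frame hx, eta_neg_right, eta_smul_right, eta_comm,
    eta_comm ε (pushFrame X e b x), h.eta_pushFrame hx] at this
  rw [eta_comm]
  split_ifs at this ⊢ <;> linarith

lemma connCoeff_antisymm (a b c : Fin 4) :
    connCoeff ε X e a b c x = -connCoeff ε X e a c b x := by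
  have := fderiv_eta_add_eq_zero h.isOpen (h.smooth_pushFrame b) (h.smooth_pushFrame c)
    (fun y hy => h.eta_pushFrame hy b c) hx (e a x)
  rw [eta_comm ε (pushFrame X e b x)] at this
  simp only [connCoeff]
  linarith

lemma connCoeff_self (a b : Fin 4) : connCoeff ε X e a b b x = 0 := by
  have := h.connCoeff_antisymm hx a b b
  linarith

lemma eta_lieBracket (a b c : Fin 4) :
    eta ε (fderiv ℝ X x (VectorField.lieBracket ℝ (e a) (e b) x)) (pushFrame X e c x) =
      connCoeff ε X e a b c x - connCoeff ε X e b a c x := by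
  rw [← fderiv_commutator (contDiffAt_of_smoothOn h.isOpen h.smooth_X hx 2)
    (differentiableAt_of_smoothOn h.isOpen (h.smooth_e a) hx)
    (differentiableAt_of_smoothOn h.isOpen (h.smooth_e b) hx), eta_sub_left]
  rfl

lemma fderiv_commutator_frame {F : Type*} [NormedAddCommGroup F] [NormedSpace ℝ F]
    {f : Coord → F} (hf : ContDiffAt ℝ 2 f x) (a b : Fin 4) :
    fderiv ℝ (fun y => fderiv ℝ f y (e b y)) x (e a x)
      - fderiv ℝ (fun y => fderiv ℝ f y (e a y)) x (e b x)
      = ∑ c, (tetradSign c * (connCoeff ε X e a b c x - connCoeff ε X e b a c x)) •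
        fderiv ℝ f x (e c x) := by
  rw [fderiv_commutator hf (differentiableAt_of_smoothOn h.isOpen (h.smooth_e a) hx)
    (differentiableAt_of_smoothOn h.isOpen (h.smooth_e b) hx)]
  simpa only [ContinuousLinearMap.coe_coe, h.eta_lieBracket hx] using
    h.map_eq_sum hx (fderiv ℝ f x : Coord →ₗ[ℝ] F) (VectorField.lieBracket ℝ (e a) (e b) x)

omit hx in
lemma smooth_curvature (a : Fin 4) : ContDiffOn ℝ ∞ (κ a) U := by
  have hκ : ∀ x ∈ U, κ a x =
      -(tetradSign a * eta ε (fderiv ℝ ξ x (e a x)) (pushFrame X e a x)) := fun x hx => by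
    rw [h.fderiv_normal_frame hx, eta_neg_left, eta_smul_left, h.eta_pushFrame hx, if_pos rfl]
    linear_combination (-κ a x) * tetradSign_mul_self a
  exact (contDiffOn_const.mul (contDiffOn_eta
    (smoothOn_fderiv_apply h.isOpen h.smooth_ξ (h.smooth_e a)) (h.smooth_pushFrame a) ε)).neg.congr
    hκ

/-! ### The Codazzi and Gauss equations in a principal frame -/

lemma fderiv_fderiv_normal_frame (a b : Fin 4) :
    fderiv ℝ (fun y => fderiv ℝ ξ y (e b y)) x (e a x) =
      -(κ b x • fderiv ℝ (pushFrame X e b) x (e a x)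
        + fderiv ℝ (κ b) x (e a x) • pushFrame X e b x) := by
  rw [fderiv_eq_of_eqOn h.isOpen (fun y hy => h.fderiv_normal_frame hy b) hx, fderiv_fun_neg,
    fderiv_fun_smul (differentiableAt_of_smoothOn h.isOpen (h.smooth_curvature b) hx)
      (differentiableAt_of_smoothOn h.isOpen (h.smooth_pushFrame b) hx)]
  simp

lemma codazzi (a b c : Fin 4) :
    (κ c x - κ b x) * connCoeff ε X e a b c x - (κ c x - κ a x) * connCoeff ε X e b a c x =
      (if b = c then fderiv ℝ (κ b) x (e a x) * tetradSign b else 0)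
        - (if a = c then fderiv ℝ (κ a) x (e b x) * tetradSign a else 0) := by
  have hcomm := h.fderiv_commutator_frame hx (contDiffAt_of_smoothOn h.isOpen h.smooth_ξ hx 2) a b
  rw [h.fderiv_fderiv_normal_frame hx, h.fderiv_fderiv_normal_frame hx] at hcomm
  have key := congrArg (fun A => eta ε A (pushFrame X e c x)) hcomm
  simp only [eta_sum_left, eta_sub_left, eta_neg_left, eta_smul_left, eta_add_left,
    h.fderiv_normal_frame hx, h.eta_pushFrame hx, mul_ite, mul_zero, mul_neg,
    Finset.sum_neg_distrib, Finset.sum_ite_eq', Finset.mem_univ, if_true] at key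
  simp only [connCoeff] at key ⊢
  split_ifs at key ⊢ <;>
    linear_combination key - (κ c x) * (eta ε (fderiv ℝ (pushFrame X e b) x (e a x))
      (pushFrame X e c x) - eta ε (fderiv ℝ (pushFrame X e a) x (e b x))
      (pushFrame X e c x)) * tetradSign_mul_self c

lemma codazzi_self {a b : Fin 4} (hab : a ≠ b) :
    (κ b x - κ a x) * connCoeff ε X e b a b x = -(fderiv ℝ (κ b) x (e a x) * tetradSign b) := by
  have := h.codazzi hx a b b
  rw [if_pos rfl, if_neg hab] at this
  linarith

lemma codazzi_distinct {a b c : Fin 4} (hac : a ≠ c) (hbc : b ≠ c) :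
    (κ c x - κ b x) * connCoeff ε X e a b c x = (κ c x - κ a x) * connCoeff ε X e b a c x := by
  have := h.codazzi hx a b c
  rw [if_neg hac, if_neg hbc] at this
  linarith

lemma fderiv_connCoeff (a b c d : Fin 4) :
    fderiv ℝ (connCoeff ε X e b c d) x (e a x) =
      eta ε (fderiv ℝ (fun y => fderiv ℝ (pushFrame X e c) y (e b y)) x (e a x))
        (pushFrame X e d x)
      + (∑ f, tetradSign f * connCoeff ε X e b c f x * connCoeff ε X e a d f x
        + ε * (if b = c then κ b x * tetradSign b else 0) *
          (if a = d then κ a x * tetradSign a else 0)) := by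
  have key := fderiv_eta (differentiableAt_of_smoothOn h.isOpen
    (smoothOn_fderiv_apply h.isOpen (h.smooth_pushFrame c) (h.smooth_e b)) hx)
    (differentiableAt_of_smoothOn h.isOpen (h.smooth_pushFrame d) hx) ε (e a x)
  rw [h.eta_eq_sum hx (fderiv ℝ (pushFrame X e c) x (e b x)),
    h.eta_fderiv_pushFrame_normal hx, h.eta_fderiv_pushFrame_normal hx] at key
  exact key

lemma gauss (a b c d : Fin 4) :
    fderiv ℝ (connCoeff ε X e b c d) x (e a x) - fderiv ℝ (connCoeff ε X e a c d) x (e b x) =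
      ∑ f, tetradSign f * (connCoeff ε X e b c f x * connCoeff ε X e a d f x
        - connCoeff ε X e a c f x * connCoeff ε X e b d f x
        + (connCoeff ε X e a b f x - connCoeff ε X e b a f x) * connCoeff ε X e f c d x)
      + ε * ((if b = c then κ b x * tetradSign b else 0) *
          (if a = d then κ a x * tetradSign a else 0)
        - (if a = c then κ a x * tetradSign a else 0) *
          (if b = d then κ b x * tetradSign b else 0)) := by
  have hcomm := congrArg (fun A => eta ε A (pushFrame X e d x)) (h.fderiv_commutator_frame hx
    (contDiffAt_of_smoothOn h.isOpen (h.smooth_pushFrame c) hx 2) a b)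
  simp only [eta_sub_left, eta_sum_left, eta_smul_left] at hcomm
  have hΓ (f) : eta ε (fderiv ℝ (pushFrame X e c) x (e f x)) (pushFrame X e d x) =
    connCoeff ε X e f c d x := rfl
  rw [h.fderiv_connCoeff hx, h.fderiv_connCoeff hx]
  simp only [hΓ, Fin.sum_univ_four] at hcomm ⊢
  linear_combination hcomm

end PrincipalFrame

/-! ### The intrinsic Gauss equation -/

lemma linear_eq_sum {F : Type*} [AddCommGroup F] [Module ℝ F] (L : Coord →ₗ[ℝ] F) (V : Coord) :
    L V = ∑ i, V i • L (Pi.single i 1) := by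
  conv_lhs => rw [pi_eq_sum_univ' V]
  simp only [map_sum, map_smul]

lemma fderiv_eq_sum {F : Type*} [NormedAddCommGroup F] [NormedSpace ℝ F] (f : Coord → F)
    (x V : Coord) : fderiv ℝ f x V = ∑ i, V i • fderiv ℝ f x (Pi.single i 1) :=
  linear_eq_sum (fderiv ℝ f x : Coord →ₗ[ℝ] F) V

lemma bilin_eq_sum (B : LinearMap.BilinForm ℝ Coord) (V W : Coord) :
    B V W = ∑ i, ∑ j, V i * W j * B (Pi.single i 1) (Pi.single j 1) := by
  rw [linear_eq_sum B V, LinearMap.sum_apply]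
  refine Finset.sum_congr rfl fun i _ => ?_
  rw [LinearMap.smul_apply, linear_eq_sum (B _) W, Finset.smul_sum]
  exact Finset.sum_congr rfl fun j _ => by simp only [smul_eq_mul, mul_assoc]

/-- The induced metric at `x` as a bilinear form. -/
def inducedForm (ε : ℝ) (X : Coord → Ambient) (x : Coord) : LinearMap.BilinForm ℝ Coord :=
  ((etaL ε).bilinearComp (fderiv ℝ X x) (fderiv ℝ X x)).toBilinForm

lemma inducedForm_apply (ε : ℝ) (X : Coord → Ambient) (x V W : Coord) :
    inducedForm ε X x V W = eta ε (fderiv ℝ X x V) (fderiv ℝ X x W) :=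
  etaL_apply _ _ _

lemma inducedMetric_apply (ε : ℝ) (X : Coord → Ambient) (x : Coord) (i j : Fin 4) :
    inducedMetric ε X x i j =
      eta ε (fderiv ℝ X x (Pi.single i 1)) (fderiv ℝ X x (Pi.single j 1)) := rfl

lemma inducedMetric_inner (ε : ℝ) (X : Coord → Ambient) (x V W : Coord) :
    (inducedMetric ε X).inner x V W = eta ε (fderiv ℝ X x V) (fderiv ℝ X x W) := by
  rw [← inducedForm_apply, bilin_eq_sum, MetricField.inner]
  simp only [inducedForm_apply, inducedMetric_apply]
  exact Finset.sum_congr rfl fun i _ => Finset.sum_congr rfl fun j _ => by ring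

lemma inducedMetric_lower (ε : ℝ) (X : Coord → Ambient) (x V : Coord) (i : Fin 4) :
    ∑ m, inducedMetric ε X x i m * V m =
      eta ε (fderiv ℝ X x (Pi.single i 1)) (fderiv ℝ X x V) := by
  rw [fderiv_eq_sum X x V, eta_sum_right]
  simp only [eta_smul_right, inducedMetric_apply, mul_comm]

namespace PrincipalFrame

variable {ε : ℝ} {U : Set Coord} {X ξ : Coord → Ambient} {e : Fin 4 → Coord → Coord}
  {κ : Fin 4 → Coord → ℝ} (h : PrincipalFrame ε U X ξ e κ) {x : Coord} (hx : x ∈ U)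
include h

lemma smooth_secondDeriv (V W : Coord) :
    ContDiffOn ℝ ∞ (fun y => fderiv ℝ (fun z => fderiv ℝ X z W) y V) U :=
  smoothOn_fderiv_apply h.isOpen (smoothOn_fderiv_apply h.isOpen h.smooth_X contDiffOn_const)
    contDiffOn_const

lemma smooth_secondFF (V W : Coord) : ContDiffOn ℝ ∞ (fun x => secondFF ε X ξ x V W) U :=
  contDiffOn_eta (h.smooth_secondDeriv V W) h.smooth_ξ ε

include hx

lemma inv_inducedMetric (l m : Fin 4) :
    (inducedMetric ε X x)⁻¹ l m = ∑ a, tetradSign a * e a x l * e a x m := by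
  suffices (inducedMetric ε X x)⁻¹ =
      Matrix.of fun l m => ∑ a, tetradSign a * e a x l * e a x m by
    rw [this, Matrix.of_apply]
  refine Matrix.inv_eq_right_inv ?_
  ext i n
  have key := congrFun (h.tangent_eq_sum hx (Pi.single i 1)) n
  simp only [Finset.sum_apply, Pi.smul_apply, smul_eq_mul, pushFrame, ← inducedMetric_lower] at key
  rw [Matrix.mul_apply, Matrix.one_eq_pi_single, key]
  simp only [Matrix.of_apply, Finset.mul_sum, Finset.sum_mul]
  rw [Finset.sum_comm]
  exact Finset.sum_congr rfl fun _ _ => Finset.sum_congr rfl fun _ _ => by ring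

lemma sum_inv_mul_bilin (B : LinearMap.BilinForm ℝ Coord) :
    ∑ i, ∑ j, (inducedMetric ε X x)⁻¹ i j * B (Pi.single i 1) (Pi.single j 1) =
      ∑ a, tetradSign a * B (e a x) (e a x) := by
  simp only [h.inv_inducedMetric hx, fun a => bilin_eq_sum B (e a x), Fin.sum_univ_four]
  ring

lemma sum_inv_mul_eta (l : Fin 4) (A : Ambient) :
    ∑ m, (inducedMetric ε X x)⁻¹ l m * eta ε A (fderiv ℝ X x (Pi.single m 1)) =
      ∑ a, tetradSign a * eta ε A (pushFrame X e a x) * e a x l := by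
  simp only [h.inv_inducedMetric hx, pushFrame, fun a => fderiv_eq_sum X x (e a x), eta_sum_right,
    eta_smul_right]
  simp only [Fin.sum_univ_four]
  ring

lemma pderiv_inducedMetric (i j m : Fin 4) :
    pderiv i (fun y => inducedMetric ε X y j m) x =
      eta ε (fderiv ℝ (fun z => fderiv ℝ X z (Pi.single j 1)) x (Pi.single i 1))
        (fderiv ℝ X x (Pi.single m 1)) +
      eta ε (fderiv ℝ (fun z => fderiv ℝ X z (Pi.single m 1)) x (Pi.single i 1))
        (fderiv ℝ X x (Pi.single j 1)) := by
  have hd (i : Fin 4) : DifferentiableAt ℝ (fun z => fderiv ℝ X z (Pi.single i 1)) x :=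
    differentiableAt_of_smoothOn h.isOpen
      (smoothOn_fderiv_apply h.isOpen h.smooth_X contDiffOn_const) hx
  rw [eta_comm ε (fderiv ℝ (fun z => fderiv ℝ X z (Pi.single m 1)) x (Pi.single i 1))]
  exact fderiv_eta (hd j) (hd m) ε (Pi.single i 1)

lemma christoffel_eq (l i j : Fin 4) :
    christoffel (inducedMetric ε X) l i j x = ∑ a, tetradSign a *
      eta ε (fderiv ℝ (fun z => fderiv ℝ X z (Pi.single j 1)) x (Pi.single i 1))
        (pushFrame X e a x) * e a x l := by
  have hsymm := fderiv_fderiv_comm (contDiffAt_of_smoothOn h.isOpen h.smooth_X hx 2)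
  rw [← h.sum_inv_mul_eta hx, christoffel, Finset.mul_sum]
  refine Finset.sum_congr rfl fun m _ => ?_
  rw [h.pderiv_inducedMetric hx, h.pderiv_inducedMetric hx, h.pderiv_inducedMetric hx,
    hsymm (Pi.single m 1) (Pi.single i 1), hsymm (Pi.single m 1) (Pi.single j 1),
    hsymm (Pi.single j 1) (Pi.single i 1)]
  ring

omit hx in
lemma smooth_christoffel (l i j : Fin 4) :
    ContDiffOn ℝ ∞ (christoffel (inducedMetric ε X) l i j) U := by
  refine ContDiffOn.congr ?_ fun x hx => h.christoffel_eq hx l i j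
  refine ContDiffOn.sum fun a _ => ?_
  exact (contDiffOn_const.mul (contDiffOn_eta (h.smooth_secondDeriv _ _)
    (h.smooth_pushFrame a) ε)).mul (contDiffOn_pi.1 (h.smooth_e a) l)

lemma gauss_formula (i j : Fin 4) :
    fderiv ℝ (fun z => fderiv ℝ X z (Pi.single j 1)) x (Pi.single i 1) =
      fderiv ℝ X x (fun l => christoffel (inducedMetric ε X) l i j x) +
        (ε * secondFF ε X ξ x (Pi.single i 1) (Pi.single j 1)) • ξ x := by
  have hC : (fun l => christoffel (inducedMetric ε X) l i j x) =
      ∑ a, (tetradSign a * eta ε (fderiv ℝ (fun z => fderiv ℝ X z (Pi.single j 1)) x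
        (Pi.single i 1)) (pushFrame X e a x)) • e a x := by
    funext l
    rw [h.christoffel_eq hx]
    simp [Finset.sum_apply]
  rw [hC, map_sum]
  simp only [map_smul]
  exact h.ambient_eq_sum hx _

lemma eta_fderiv_fderiv_apply {C : Coord → Coord} (hC : DifferentiableAt ℝ C x) (i : Fin 4)
    (W : Coord) :
    eta ε (fderiv ℝ (fun y => fderiv ℝ X y (C y)) x (Pi.single i 1)) (fderiv ℝ X x W) =
      eta ε (fderiv ℝ X x (fderiv ℝ C x (Pi.single i 1) +
        ∑ m, C x m • fun l => christoffel (inducedMetric ε X) l i m x)) (fderiv ℝ X x W) := by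
  have hX := differentiableAt_of_smoothOn h.isOpen (smoothOn_fderiv h.isOpen h.smooth_X) hx
  have hconst (V : Coord) : fderiv ℝ (fderiv ℝ X) x (Pi.single i 1) V =
      fderiv ℝ (fun z => fderiv ℝ X z V) x (Pi.single i 1) := by
    simp [fderiv_clm_apply hX (differentiableAt_const V)]
  have hsum := linear_eq_sum (fderiv ℝ (fderiv ℝ X) x (Pi.single i 1) : Coord →ₗ[ℝ] Ambient) (C x)
  simp only [ContinuousLinearMap.coe_coe, hconst, h.gauss_formula hx] at hsum
  rw [fderiv_clm_apply hX hC]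
  simp only [add_apply, ContinuousLinearMap.comp_apply, ContinuousLinearMap.flip_apply]
  rw [hconst, hsum]
  simp only [map_add, map_sum, map_smul, eta_add_left, eta_sum_left, eta_smul_left,
    h.eta_normal_left hx, mul_zero, add_zero]

lemma eta_thirdDeriv (i j k : Fin 4) (W : Coord) :
    eta ε (fderiv ℝ (fun y => fderiv ℝ (fun z => fderiv ℝ X z (Pi.single k 1)) y (Pi.single j 1))
        x (Pi.single i 1)) (fderiv ℝ X x W) =
      eta ε (fderiv ℝ X x (fun l => pderiv i (christoffel (inducedMetric ε X) l j k) x +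
        ∑ m, christoffel (inducedMetric ε X) l i m x * christoffel (inducedMetric ε X) m j k x))
        (fderiv ℝ X x W)
      - ε * secondFF ε X ξ x (Pi.single j 1) (Pi.single k 1) *
        secondFF ε X ξ x (Pi.single i 1) W := by
  set C : Coord → Coord := fun y l => christoffel (inducedMetric ε X) l j k y with hCdef
  have hCl (l) := differentiableAt_of_smoothOn h.isOpen (h.smooth_christoffel l j k) hx
  have hC : DifferentiableAt ℝ C x := differentiableAt_pi.2 hCl
  have hX := differentiableAt_of_smoothOn h.isOpen (smoothOn_fderiv h.isOpen h.smooth_X) hx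
  have hS := (differentiableAt_of_smoothOn h.isOpen
    (h.smooth_secondFF (Pi.single j 1) (Pi.single k 1)) hx).const_mul ε
  have hξ := differentiableAt_of_smoothOn h.isOpen h.smooth_ξ hx
  have hΓ : (fun l => pderiv i (christoffel (inducedMetric ε X) l j k) x +
        ∑ m, christoffel (inducedMetric ε X) l i m x * christoffel (inducedMetric ε X) m j k x) =
      fderiv ℝ C x (Pi.single i 1) +
        ∑ m, C x m • (fun l => christoffel (inducedMetric ε X) l i m x) := by
    funext l
    rw [hCdef, fderiv_pi hCl]
    simp [pderiv, Finset.sum_apply, mul_comm]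
  rw [fderiv_eq_of_eqOn h.isOpen (fun y hy => h.gauss_formula hy j k) hx,
    fderiv_fun_add (hX.clm_apply hC) (hS.fun_smul hξ), add_apply, eta_add_left,
    h.eta_fderiv_fderiv_apply hx hC, hΓ, fderiv_fun_smul hS hξ]
  simp only [add_apply, smul_apply, ContinuousLinearMap.smulRight_apply, eta_add_left,
    eta_smul_left, h.weingarten hx, h.eta_normal_left hx]
  ring

lemma eta_riemann (k i j : Fin 4) (W : Coord) :
    eta ε (fderiv ℝ X x fun l => riemann (inducedMetric ε X) l k i j x) (fderiv ℝ X x W) =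
      ε * (secondFF ε X ξ x (Pi.single j 1) (Pi.single k 1) * secondFF ε X ξ x (Pi.single i 1) W
        - secondFF ε X ξ x (Pi.single i 1) (Pi.single k 1) *
          secondFF ε X ξ x (Pi.single j 1) W) := by
  have hR : (fun l => riemann (inducedMetric ε X) l k i j x) =
      (fun l => pderiv i (christoffel (inducedMetric ε X) l j k) x +
        ∑ m, christoffel (inducedMetric ε X) l i m x * christoffel (inducedMetric ε X) m j k x) -
      (fun l => pderiv j (christoffel (inducedMetric ε X) l i k) x +
        ∑ m, christoffel (inducedMetric ε X) l j m x *
          christoffel (inducedMetric ε X) m i k x) := by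
    funext l
    simp only [riemann, Pi.sub_apply, Finset.sum_sub_distrib]
    ring
  have hij := h.eta_thirdDeriv hx i j k W
  have hji := h.eta_thirdDeriv hx j i k W
  rw [fderiv_fderiv_comm (contDiffAt_of_smoothOn h.isOpen (smoothOn_fderiv_apply h.isOpen
    h.smooth_X contDiffOn_const) hx 2), hji] at hij
  rw [hR, map_sub, eta_sub_left]
  linarith

lemma secondFF_comm (V W : Coord) : secondFF ε X ξ x V W = secondFF ε X ξ x W V := by
  rw [secondFF, fderiv_fderiv_comm (contDiffAt_of_smoothOn h.isOpen h.smooth_X hx 2)]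
  rfl

lemma secondFF_eq_sum (V W : Coord) :
    secondFF ε X ξ x V W = ∑ a, tetradSign a * κ a x * eta ε (fderiv ℝ X x V) (pushFrame X e a x)
      * eta ε (fderiv ℝ X x W) (pushFrame X e a x) := by
  have hV := h.map_eq_sum hx (fderiv ℝ ξ x : Coord →ₗ[ℝ] Ambient) V
  simp only [ContinuousLinearMap.coe_coe, h.fderiv_normal_frame hx] at hV
  rw [← neg_eq_iff_eq_neg.2 (h.weingarten hx V W), hV, eta_sum_left, ← Finset.sum_neg_distrib]
  refine Finset.sum_congr rfl fun a _ => ?_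
  rw [eta_smul_left, eta_neg_left, eta_smul_left, eta_comm ε (pushFrame X e a x)]
  ring

end PrincipalFrame

/-- The second fundamental form as a bilinear form, expressed through the Weingarten map. -/
def secondForm (ε : ℝ) (X ξ : Coord → Ambient) (x : Coord) : LinearMap.BilinForm ℝ Coord :=
  -((etaL ε).bilinearComp (fderiv ℝ ξ x) (fderiv ℝ X x)).toBilinForm

lemma forall_single_iff_forall {B B' : LinearMap.BilinForm ℝ Coord} :
    (∀ i j, B (Pi.single i 1) (Pi.single j 1) = B' (Pi.single i 1) (Pi.single j 1)) ↔
      ∀ V W, B V W = B' V W :=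
  ⟨fun hB V W => by simp only [bilin_eq_sum _ V W, hB], fun hB _ _ => hB _ _⟩

lemma perfectFluid_eq_iff {V : Type*} [AddCommGroup V] [Module ℝ V] [FiniteDimensional ℝ V]
    {g : LinearMap.BilinForm ℝ V} {F : Fin 4 → V} {A B A' B' : ℝ} {v : V}
    (hdim : Module.finrank ℝ V = 4) (hg : ∀ Y Z, g Y Z = g Z Y)
    (hF : ∀ a b, g (F a) (F b) = if a = b then tetradSign a else 0)
    (hB : B ≠ 0) (hv : g v v = -1) :
    (∀ Y Z, A * g Y Z + B * (g Y (F 3) * g Z (F 3)) = A' * g Y Z + B' * (g Y v * g Z v)) ↔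
      A = A' ∧ B = B' ∧ (v = F 3 ∨ v = -F 3) := by
  constructor
  · intro hE
    have hvF := eq_sum_smul_of_orthonormal tetradSign_mul_self hF (by simp [hdim]) v
    have hvv : g v v = ∑ a, tetradSign a * g v (F a) * g v (F a) := by
      simpa only [map_sum, map_smul, smul_eq_mul] using congrArg (g v) hvF
    have f (a b) := hE (F a) (F b)
    simp only [hF, hg _ v] at f
    have f00 : A = A' + B' * (g v (F 0) * g v (F 0)) := by simpa [tetradSign] using f 0 0
    have f03 : B' = 0 ∨ g v (F 0) = 0 ∨ g v (F 3) = 0 := by simpa using f 0 3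
    have f13 : B' = 0 ∨ g v (F 1) = 0 ∨ g v (F 3) = 0 := by simpa using f 1 3
    have f23 : B' = 0 ∨ g v (F 2) = 0 ∨ g v (F 3) = 0 := by simpa using f 2 3
    have f33 : -A + B = -A' + B' * (g v (F 3) * g v (F 3)) := by
      simpa [tetradSign] using f 3 3
    simp only [hv, Fin.sum_univ_four, tetradSign, Matrix.cons_val, one_mul, neg_mul,
      neg_smul] at hvv hvF
    have hv3 : g v (F 3) ≠ 0 := fun h0 => by nlinarith
    have hB' : B' ≠ 0 := by
      rintro rfl
      exact hB (by linarith)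
    simp only [hB', hv3, or_false, false_or] at f03 f13 f23
    simp only [f03, f13, f23, mul_zero, zero_smul, zero_add, add_zero] at f00 hvv hvF
    have hsq : g v (F 3) * g v (F 3) = 1 := by linarith
    refine ⟨f00, by linear_combination f33 + f00 + B' * hsq, ?_⟩
    rcases mul_self_eq_one_iff.1 hsq with h1 | h1
    · right
      simpa [h1] using hvF
    · left
      simpa [h1] using hvF
  · rintro ⟨rfl, rfl, rfl | rfl⟩ Y Z
    · rfl
    · simp

namespace PrincipalFrame

variable {ε : ℝ} {U : Set Coord} {X ξ : Coord → Ambient} {e : Fin 4 → Coord → Coord}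
  {κ : Fin 4 → Coord → ℝ} (h : PrincipalFrame ε U X ξ e κ) {x : Coord} (hx : x ∈ U)
include h hx

/-! ### Curvature of the induced metric in a principal frame -/

lemma secondFF_eq_secondForm (V W : Coord) : secondFF ε X ξ x V W = secondForm ε X ξ x V W := by
  rw [← neg_eq_iff_eq_neg.2 (h.weingarten hx V W), ← etaL_apply]
  rfl

lemma secondFF_frame (a b : Fin 4) :
    secondFF ε X ξ x (e a x) (e b x) = if a = b then κ a x * tetradSign a else 0 := by
  rw [h.principal x hx, h.orthonormal x hx, mul_ite, mul_zero]

lemma secondFF_frame_right (V : Coord) (a : Fin 4) :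
    secondFF ε X ξ x V (e a x) = κ a x * eta ε (fderiv ℝ X x V) (pushFrame X e a x) := by
  rw [h.secondFF_comm hx, h.principal x hx, eta_comm]
  rfl

lemma eta_curvatureOp (V W Z Y : Coord) :
    eta ε (fderiv ℝ X x (curvatureOp (inducedMetric ε X) x V W Z)) (fderiv ℝ X x Y) =
      ε * (secondFF ε X ξ x W Z * secondFF ε X ξ x V Y
        - secondFF ε X ξ x V Z * secondFF ε X ξ x W Y) := by
  have hR : curvatureOp (inducedMetric ε X) x V W Z = ∑ k, ∑ i, ∑ j, (V i * W j * Z k) •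
      (fun l => riemann (inducedMetric ε X) l k i j x) := by
    funext l
    simp only [curvatureOp, Finset.sum_apply, Pi.smul_apply, smul_eq_mul]
    exact Finset.sum_congr rfl fun _ _ => Finset.sum_congr rfl fun _ _ =>
      Finset.sum_congr rfl fun _ _ => by ring
  have hleft (V W : Coord) : secondForm ε X ξ x V W =
      ∑ i, V i * secondForm ε X ξ x (Pi.single i 1) W := by
    simpa using linear_eq_sum ((secondForm ε X ξ x).flip W) V
  rw [hR]
  simp only [map_sum, map_smul, eta_sum_left, eta_smul_left, h.eta_riemann hx,
    h.secondFF_eq_secondForm hx]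
  rw [bilin_eq_sum _ W Z, bilin_eq_sum _ V Z, hleft V Y, hleft W Y]
  simp only [Fin.sum_univ_four]
  ring

lemma sectional_frame {a b : Fin 4} (hab : a ≠ b) :
    sectional (inducedMetric ε X) x (e a x) (e b x) = ε * (κ a x * κ b x) := by
  simp only [sectional, inducedMetric_inner, h.eta_curvatureOp hx, h.secondFF_frame hx,
    h.orthonormal x hx, if_pos, hab, if_false]
  linear_combination (ε * κ a x * κ b x * tetradSign a * tetradSign a) * tetradSign_mul_self b
    + ε * κ a x * κ b x * tetradSign_mul_self a

lemma riemann_eq (l k i j : Fin 4) :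
    riemann (inducedMetric ε X) l k i j x = ε * ∑ a, tetradSign a * κ a x *
      (secondFF ε X ξ x (Pi.single j 1) (Pi.single k 1) *
        eta ε (fderiv ℝ X x (Pi.single i 1)) (pushFrame X e a x)
      - secondFF ε X ξ x (Pi.single i 1) (Pi.single k 1) *
        eta ε (fderiv ℝ X x (Pi.single j 1)) (pushFrame X e a x)) * e a x l := by
  rw [congrFun (h.tangent_eq_sum hx fun l => riemann (inducedMetric ε X) l k i j x) l]
  simp only [pushFrame, h.eta_riemann hx, h.secondFF_frame_right hx, Finset.sum_apply,
    Pi.smul_apply, smul_eq_mul, Finset.mul_sum]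
  exact Finset.sum_congr rfl fun a _ => by ring

lemma isFlatAt (h0 : ∀ a, κ a x = 0) : IsFlatAt (inducedMetric ε X) x := fun l k i j => by
  simp [h.riemann_eq hx, h0]

lemma sum_inv_mul_diagonal (c : Fin 4 → ℝ) :
    ∑ i, ∑ j, (inducedMetric ε X x)⁻¹ i j *
      ∑ a, c a * eta ε (fderiv ℝ X x (Pi.single i 1)) (pushFrame X e a x) *
        eta ε (fderiv ℝ X x (Pi.single j 1)) (pushFrame X e a x) = ∑ a, tetradSign a * c a := by
  let θ (a : Fin 4) : Coord →ₗ[ℝ] ℝ := inducedForm ε X x (e a x)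
  have hθ (a V) : θ a V = eta ε (fderiv ℝ X x V) (pushFrame X e a x) := by
    rw [inducedForm_apply, eta_comm]
    rfl
  have key := h.sum_inv_mul_bilin hx (∑ a, c a • LinearMap.BilinForm.linMulLin (θ a) (θ a))
  simp only [LinearMap.sum_apply, LinearMap.smul_apply, LinearMap.BilinForm.linMulLin_apply, hθ,
    smul_eq_mul, ← mul_assoc] at key
  rw [key]
  refine Finset.sum_congr rfl fun a _ => ?_
  have hort (b) : eta ε (fderiv ℝ X x (e a x)) (pushFrame X e b x) = _ := h.eta_pushFrame hx a b
  simp only [hort, mul_ite, mul_zero, Finset.sum_ite_eq, Finset.mem_univ, if_true]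
  linear_combination (tetradSign a * c a) * tetradSign_mul_self a

lemma trace_secondFF :
    ∑ i, ∑ j, (inducedMetric ε X x)⁻¹ i j * secondFF ε X ξ x (Pi.single i 1) (Pi.single j 1) =
      ∑ a, κ a x := by
  simp only [h.secondFF_eq_sum hx, h.sum_inv_mul_diagonal hx]
  exact Finset.sum_congr rfl fun a _ => by rw [← mul_assoc, tetradSign_mul_self, one_mul]

lemma eta_meanCurvature :
    eta ε (meanCurvature ε X ξ x) (meanCurvature ε X ξ x) = ε * (∑ a, κ a x) ^ 2 := by
  simp only [meanCurvature, h.trace_secondFF hx, eta_smul_left, eta_smul_right,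
    h.unit_normal x hx]
  linear_combination (ε * (∑ a, κ a x) ^ 2) * h.sq_sign

lemma ricci_eq_sum (k j : Fin 4) :
    ricci (inducedMetric ε X) k j x =
      ∑ a, tetradSign a * (ε * ((∑ b, κ b x) * κ a x - κ a x ^ 2)) *
        eta ε (fderiv ℝ X x (Pi.single k 1)) (pushFrame X e a x) *
        eta ε (fderiv ℝ X x (Pi.single j 1)) (pushFrame X e a x) := by
  have hθ (a : Fin 4) :
      ∑ i, e a x i * eta ε (fderiv ℝ X x (Pi.single i 1)) (pushFrame X e a x) =
        tetradSign a := by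
    rw [← if_pos (rfl : a = a) (t := tetradSign a) (e := 0), ← h.eta_pushFrame hx a a, pushFrame,
      fderiv_eq_sum, eta_sum_left]
    simp only [eta_smul_left]
  have hΩ (a : Fin 4) : ∑ i, e a x i * secondFF ε X ξ x (Pi.single i 1) (Pi.single k 1) =
      κ a x * eta ε (fderiv ℝ X x (Pi.single k 1)) (pushFrame X e a x) := by
    rw [← h.secondFF_frame_right hx, h.secondFF_comm hx _ (e a x)]
    simp only [h.secondFF_eq_secondForm hx]
    simpa using (linear_eq_sum ((secondForm ε X ξ x).flip (Pi.single k 1)) (e a x)).symm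
  have hcontract : ricci (inducedMetric ε X) k j x = ε * ∑ a, tetradSign a * κ a x *
      (secondFF ε X ξ x (Pi.single j 1) (Pi.single k 1) *
        (∑ i, e a x i * eta ε (fderiv ℝ X x (Pi.single i 1)) (pushFrame X e a x))
      - (∑ i, e a x i * secondFF ε X ξ x (Pi.single i 1) (Pi.single k 1)) *
        eta ε (fderiv ℝ X x (Pi.single j 1)) (pushFrame X e a x)) := by
    simp only [ricci, h.riemann_eq hx, Fin.sum_univ_four]
    ring
  simp only [hcontract, hθ, hΩ]
  simp only [h.secondFF_eq_sum hx, Fin.sum_univ_four, tetradSign, Matrix.cons_val]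
  ring

lemma ricciScalar_eq :
    ricciScalar (inducedMetric ε X) x = ∑ a, ε * ((∑ b, κ b x) * κ a x - κ a x ^ 2) := by
  simp only [ricciScalar, h.ricci_eq_sum hx, h.sum_inv_mul_diagonal hx]
  exact Finset.sum_congr rfl fun a _ => by rw [← mul_assoc, tetradSign_mul_self, one_mul]

/-! ### Perfect fluids -/

section Einstein

variable {l : ℝ} (h0 : κ 0 x = l) (h1 : κ 1 x = l) (h2 : κ 2 x = l) (h3 : κ 3 x = 3 * l)
include h0 h1 h2 h3

lemma einstein_eq (i j : Fin 4) :
    einstein (inducedMetric ε X) i j x = -(ε * l ^ 2) *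
      (7 * eta ε (fderiv ℝ X x (Pi.single i 1)) (fderiv ℝ X x (Pi.single j 1)) +
      4 * eta ε (fderiv ℝ X x (Pi.single i 1)) (pushFrame X e 3 x) *
        eta ε (fderiv ℝ X x (Pi.single j 1)) (pushFrame X e 3 x)) := by
  rw [einstein, h.ricciScalar_eq hx, h.ricci_eq_sum hx, inducedMetric_apply,
    h.eta_eq_sum hx (fderiv ℝ X x (Pi.single i 1)) (fderiv ℝ X x (Pi.single j 1)), h.normal x hx]
  simp only [Fin.sum_univ_four, h0, h1, h2, h3, tetradSign, Matrix.cons_val]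
  ring

lemma isPerfectFluidAt_iff_forall (K ρ p : ℝ) (V : Coord) :
    IsPerfectFluidAt (inducedMetric ε X) K ρ p V x ↔ inducedForm ε X x V V = -1 ∧
      ∀ Y Z, -(7 * ε * l ^ 2) * inducedForm ε X x Y Z
          + -(4 * ε * l ^ 2) * (inducedForm ε X x Y (e 3 x) * inducedForm ε X x Z (e 3 x)) =
        K * p * inducedForm ε X x Y Z
          + K * (ρ + p) * (inducedForm ε X x Y V * inducedForm ε X x Z V) := by
  let B (α β : ℝ) (W : Coord) : LinearMap.BilinForm ℝ Coord := α • inducedForm ε X x + β •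
    LinearMap.BilinForm.linMulLin ((inducedForm ε X x).flip W) ((inducedForm ε X x).flip W)
  have hB (α β : ℝ) (W Y Z : Coord) : B α β W Y Z = α * inducedForm ε X x Y Z
      + β * (inducedForm ε X x Y W * inducedForm ε X x Z W) := by
    simp [B]
  simp only [← hB, ← forall_single_iff_forall]
  simp only [hB, inducedForm_apply, IsPerfectFluidAt, inducedMetric_inner, inducedMetric_lower,
    h.einstein_eq hx h0 h1 h2 h3]
  simp only [inducedMetric_apply, pushFrame]
  refine and_congr_right fun _ => forall₂_congr fun i j => ?_
  constructor <;> intro hij <;> linear_combination hij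

lemma isPerfectFluidAt_iff (hl : l ≠ 0) (K ρ p : ℝ) (V : Coord) :
    IsPerfectFluidAt (inducedMetric ε X) K ρ p V x ↔
      (K * ρ = 3 * ε * l ^ 2 ∧ K * p = -7 * ε * l ^ 2 ∧ (V = e 3 x ∨ V = -e 3 x)) := by
  have hF : ∀ a b, inducedForm ε X x (e a x) (e b x) = if a = b then tetradSign a else 0 := by
    simpa [inducedForm_apply] using h.orthonormal x hx
  have hcoeff : -(4 * ε * l ^ 2) ≠ 0 := by simp [h.sign_ne_zero, hl]
  have hconst : (-(7 * ε * l ^ 2) = K * p ∧ -(4 * ε * l ^ 2) = K * (ρ + p)) ↔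
      (K * ρ = 3 * ε * l ^ 2 ∧ K * p = -7 * ε * l ^ 2) := by
    constructor <;> rintro ⟨hA, hB⟩ <;> constructor <;> linarith
  rw [h.isPerfectFluidAt_iff_forall hx h0 h1 h2 h3, ← and_assoc (b := K * p = _), ← hconst,
    and_assoc]
  have hiff (hV : inducedForm ε X x V V = -1) := perfectFluid_eq_iff (F := fun a => e a x)
    (A := -(7 * ε * l ^ 2)) (A' := K * p) (B' := K * (ρ + p)) (by simp)
    (fun Y Z => by simp only [inducedForm_apply, eta_comm]) hF hcoeff hV
  refine ⟨fun ⟨hV, hE⟩ => (hiff hV).1 hE, fun hE => ?_⟩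
  have hV : inducedForm ε X x V V = -1 := by
    rcases hE.2.2 with rfl | rfl <;> simp [hF, tetradSign]
  exact ⟨hV, (hiff hV).2 hE⟩

end Einstein

end PrincipalFrame

/-! ### Principal curvatures in the ratio `-3 : 1 : 1 : -1` -/

/-- The most general connection matrices `Γ a b c = η(∇_{e_a} e_b, e_c)` allowed by the Codazzi
equations for principal curvatures `-3l, l, l, -l`, as a solution of sixteen linear relations with
the eight coefficients `Γ 1 0 1 = α`, `Γ 1 1 3 = β`, `Γ 3 0 1 = p`, `Γ 3 0 2 = r` and
`Γ a 1 2 = τ a` left free. -/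
def ratioConnection (α β p r : ℝ) (τ : Fin 4 → ℝ) : Fin 4 → Matrix (Fin 4) (Fin 4) ℝ :=
  ![!![0, 0, 0, 3 * β;
       0, 0, τ 0, -2 * p;
       0, -τ 0, 0, -2 * r;
       -3 * β, 2 * p, 2 * r, 0],
    !![0, α, 0, 2 * p;
       -α, 0, τ 1, β;
       0, -τ 1, 0, 0;
       -2 * p, -β, 0, 0],
    !![0, 0, α, 2 * r;
       0, 0, τ 2, 0;
       -α, -τ 2, 0, β;
       -2 * r, 0, -β, 0],
    !![0, p, r, 2 * α;
       -p, 0, τ 3, 0;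
       -r, -τ 3, 0, 0;
       -2 * α, 0, 0, 0]]

lemma eq_ratioConnection {Γ : Fin 4 → Fin 4 → Fin 4 → ℝ} {d k : Fin 4 → ℝ}
    (hk : k = ![-3, 1, 1, -1]) (hskew : ∀ a b c, Γ a b c = -Γ a c b)
    (hself : ∀ a b, a ≠ b → (k b - k a) * Γ b a b = -(k b * d a * tetradSign b))
    (hdistinct : ∀ a b c, a ≠ c → b ≠ c → (k c - k b) * Γ a b c = (k c - k a) * Γ b a c)
    (a b c : Fin 4) :
    Γ a b c = ratioConnection (Γ 1 0 1) (Γ 1 1 3) (Γ 3 0 1) (Γ 3 0 2) (Γ · 1 2) a b c := by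
  have s12 := hself 1 2 (by decide)
  have s21 := hself 2 1 (by decide)
  have s01 := hself 0 1 (by decide)
  have s02 := hself 0 2 (by decide)
  have s03 := hself 0 3 (by decide)
  have s10 := hself 1 0 (by decide)
  have s13 := hself 1 3 (by decide)
  have s20 := hself 2 0 (by decide)
  have s23 := hself 2 3 (by decide)
  have s30 := hself 3 0 (by decide)
  have s31 := hself 3 1 (by decide)
  have s32 := hself 3 2 (by decide)
  have t102 := hdistinct 1 0 2 (by decide) (by decide)
  have t201 := hdistinct 2 0 1 (by decide) (by decide)
  have t132 := hdistinct 1 3 2 (by decide) (by decide)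
  have t231 := hdistinct 2 3 1 (by decide) (by decide)
  have t031 := hdistinct 0 3 1 (by decide) (by decide)
  have t032 := hdistinct 0 3 2 (by decide) (by decide)
  have t013 := hdistinct 0 1 3 (by decide) (by decide)
  have t023 := hdistinct 0 2 3 (by decide) (by decide)
  have hdiag (a b : Fin 4) : Γ a b b = 0 := by linarith [hskew a b b]
  simp only [hk, tetradSign, Matrix.cons_val] at s12 s21 s01 s02 s03 s10 s13 s20 s23 s30 s31 s32
  simp only [hk, Matrix.cons_val] at t102 t201 t132 t231 t031 t032 t013 t023
  have hdiag (a b : Fin 4) : Γ a b b = 0 := by linarith [hskew a b b]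
  fin_cases a <;> fin_cases b <;> fin_cases c <;>
    simp only [ratioConnection, Fin.zero_eta, Fin.mk_one, Fin.reduceFinMk, Matrix.of_apply,
      Matrix.cons_val, hdiag, hskew _ 1 0, hskew _ 2 0, hskew _ 3 0, hskew _ 3 1, hskew _ 3 2,
      hskew _ 2 1] at * <;>
    linarith

namespace PrincipalFrame

variable {ε : ℝ} {U : Set Coord} {X ξ : Coord → Ambient} {e : Fin 4 → Coord → Coord}
  {κ : Fin 4 → Coord → ℝ}

lemma connCoeff_eq_ratioConnection (h : PrincipalFrame ε U X ξ e κ) {l : Coord → ℝ}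
    (hκ : ∀ x ∈ U, (κ · x) = l x • ![-3, 1, 1, -1]) (hl : ∀ x ∈ U, l x ≠ 0) {x : Coord} (hx : x ∈ U)
    (a b c : Fin 4) :
    connCoeff ε X e a b c x = ratioConnection (connCoeff ε X e 1 0 1 x) (connCoeff ε X e 1 1 3 x)
      (connCoeff ε X e 3 0 1 x) (connCoeff ε X e 3 0 2 x) (connCoeff ε X e · 1 2 x) a b c := by
  have hκ' (a) : ∀ y ∈ U, κ a y = ![-3, 1, 1, -1] a * l y := fun y hy => by
    simpa [mul_comm] using congrFun (hκ y hy) a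
  have hd (a) : fderiv ℝ (κ a) x = (![-3, 1, 1, -1] a : ℝ) • fderiv ℝ l x := by
    rw [fderiv_eq_of_eqOn h.isOpen (hκ' a) hx, fderiv_const_mul_field]
  refine eq_ratioConnection (Γ := fun a b c => connCoeff ε X e a b c x)
    (d := fun a => fderiv ℝ l x (e a x) / l x) rfl (h.connCoeff_antisymm hx)
    (fun a b hab => ?_) (fun a b c hac hbc => ?_) a b c
  · have := h.codazzi_self hx hab
    rw [hκ' a x hx, hκ' b x hx, hd] at this
    field_simp [hl x hx]
    simp only [smul_apply, smul_eq_mul] at this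
    linear_combination this
  · have := h.codazzi_distinct hx hac hbc
    rw [hκ' a x hx, hκ' b x hx, hκ' c x hx] at this
    refine mul_left_cancel₀ (hl x hx) ?_
    linear_combination this

section Ratio

variable (h : PrincipalFrame ε U X ξ e κ) {α β p r : Coord → ℝ} {τ : Fin 4 → Coord → ℝ}
  (hΓ : ∀ x ∈ U, ∀ a b c, connCoeff ε X e a b c x =
    ratioConnection (α x) (β x) (p x) (r x) (τ · x) a b c)
include h hΓ

lemma fderiv_connCoeff_ratioConnection {x : Coord} (hx : x ∈ U) (a b c : Fin 4) :
    fderiv ℝ (connCoeff ε X e a b c) x =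
      fderiv ℝ (fun y => ratioConnection (α y) (β y) (p y) (r y) (τ · y) a b c) x :=
  fderiv_eq_of_eqOn h.isOpen (fun y hy => hΓ y hy a b c) hx

lemma ratioConnection_space_time_eq_zero {x : Coord} (hx : x ∈ U) (h12 : κ 2 x = κ 1 x) :
    p x = 0 ∧ r x = 0 := by
  have g1001 := h.gauss hx 1 0 0 1
  have g2002 := h.gauss hx 2 0 0 2
  have g1002 := h.gauss hx 1 0 0 2
  simp only [h.fderiv_connCoeff_ratioConnection hΓ hx, hΓ x hx, ratioConnection,
    Fin.sum_univ_four, tetradSign, Matrix.of_apply, Matrix.cons_val, h12, fderiv_fun_const,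
    zero_apply, Pi.zero_apply, Fin.reduceEq, if_true, if_false] at g1001 g2002 g1002
  have hpr : p x * r x = 0 := by linarith
  have hsq : p x ^ 2 = r x ^ 2 := by linarith
  rcases mul_eq_zero.1 hpr with h0 | h0 <;> rw [h0, zero_pow two_ne_zero] at hsq
  · exact ⟨h0, pow_eq_zero_iff two_ne_zero |>.1 hsq.symm⟩
  · exact ⟨pow_eq_zero_iff two_ne_zero |>.1 hsq, h0⟩

end Ratio

section Static

variable (h : PrincipalFrame ε U X ξ e κ) {α β l : Coord → ℝ} {τ : Fin 4 → Coord → ℝ}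
  (hκ : ∀ x ∈ U, (κ · x) = l x • ![-3, 1, 1, -1])
  (hΓ : ∀ x ∈ U, ∀ a b c, connCoeff ε X e a b c x =
    ratioConnection (α x) (β x) 0 0 (τ · x) a b c)
include h hκ hΓ

lemma ratioConnection_structure {x : Coord} (hx : x ∈ U) :
    α x ^ 2 = β x ^ 2 ∧
      fderiv ℝ α x (e 0 x) = 3 * β x ^ 2 + 3 * ε * l x ^ 2 - α x ^ 2 ∧
      fderiv ℝ β x (e 0 x) = 2 * α x * β x := by
  have hκ' (a) : κ a x = l x * ![-3, 1, 1, -1] a := congrFun (hκ x hx) a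
  have g1001 := h.gauss hx 1 0 0 1
  have g2002 := h.gauss hx 2 0 0 2
  have g1331 := h.gauss hx 1 3 3 1
  have g1031 := h.gauss hx 1 0 3 1
  have g0330 := h.gauss hx 0 3 3 0
  simp only [h.fderiv_connCoeff_ratioConnection hΓ hx, hΓ x hx, ratioConnection,
    Fin.sum_univ_four, tetradSign, Matrix.of_apply, Matrix.cons_val, hκ', mul_zero,
    fderiv_const_mul_field, fderiv_fun_neg, fderiv_fun_const, zero_apply, neg_apply, smul_apply,
    smul_eq_mul, Pi.zero_apply, Fin.reduceEq, if_true, if_false] at g1001 g2002 g1331 g1031 g0330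
  refine ⟨by linarith, by linarith, by linarith⟩

lemma ratioConnection_mul_ratio_eq_zero {x : Coord} (hx : x ∈ U) : α x * l x = 0 := by
  have hdiff {f : Coord → ℝ} {a b c : Fin 4} (hf : ∀ y ∈ U, connCoeff ε X e a b c y = f y) :
      DifferentiableAt ℝ f x :=
    differentiableAt_of_smoothOn h.isOpen
      ((h.smooth_connCoeff a b c).congr fun y hy => (hf y hy).symm) hx
  have hα : DifferentiableAt ℝ α x := hdiff fun y hy => hΓ y hy 1 0 1
  have hβ : DifferentiableAt ℝ β x := hdiff fun y hy => hΓ y hy 1 1 3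
  obtain ⟨hsq, hα', hβ'⟩ := h.ratioConnection_structure hκ hΓ hx
  have hd := congrArg (· (e 0 x)) (fderiv_eq_of_eqOn h.isOpen
    (fun y hy => (h.ratioConnection_structure hκ hΓ hy).1) hx)
  simp only [fderiv_fun_pow 2 hα, fderiv_fun_pow 2 hβ, smul_apply, smul_eq_mul, hα', hβ',
    Nat.add_one_sub_one, pow_one, nsmul_eq_mul, Nat.cast_ofNat] at hd
  have : ε * (α x * l x ^ 2) = 0 := by linear_combination hd / 6 + (1 / 3) * α x * hsq
  simpa [h.sign_ne_zero] using this

lemma eq_empty_of_ratioConnection (hl : ∀ x ∈ U, l x ≠ 0) : U = ∅ := by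
  refine Set.eq_empty_of_forall_notMem fun x hx => hl x hx ?_
  have hα : ∀ y ∈ U, α y = 0 := fun y hy =>
    (mul_eq_zero.1 (h.ratioConnection_mul_ratio_eq_zero hκ hΓ hy)).resolve_right (hl y hy)
  obtain ⟨hsq, hα', -⟩ := h.ratioConnection_structure hκ hΓ hx
  rw [fderiv_eq_of_eqOn h.isOpen hα hx, fderiv_fun_const, Pi.zero_apply, zero_apply,
    hα x hx] at hα'
  rw [hα x hx] at hsq
  have : ε * l x ^ 2 = 0 := by linarith
  simpa [h.sign_ne_zero] using this

end Static

theorem eq_zero_of_curvature_ratio (h : PrincipalFrame ε U X ξ e κ) {l : Coord → ℝ}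
    (hκ : ∀ x ∈ U, (κ · x) = l x • ![-3, 1, 1, -1]) {x : Coord} (hx : x ∈ U) : l x = 0 := by
  have hκ1 : ∀ y ∈ U, κ 1 y = l y := fun y hy => by simpa using congrFun (hκ y hy) 1
  let V := U ∩ {y | κ 1 y ≠ 0}
  have hV : IsOpen V :=
    (h.smooth_curvature 1).continuousOn.isOpen_inter_preimage h.isOpen isOpen_compl_singleton
  have hVκ : ∀ y ∈ V, (κ · y) = l y • ![-3, 1, 1, -1] := fun y hy => hκ y hy.1
  have hVl : ∀ y ∈ V, l y ≠ 0 := fun y hy => hκ1 y hy.1 ▸ hy.2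
  have hVframe := h.mono hV Set.inter_subset_left
  have hΓ := fun y (hy : y ∈ V) => hVframe.connCoeff_eq_ratioConnection hVκ hVl hy
  have hp := fun y (hy : y ∈ V) => hVframe.ratioConnection_space_time_eq_zero hΓ hy
    (by simpa [hκ1 y hy.1] using congrFun (hVκ y hy) 2)
  have hVempty : V = ∅ := hVframe.eq_empty_of_ratioConnection hVκ
    (fun y hy a b c => (hp y hy).1 ▸ (hp y hy).2 ▸ hΓ y hy a b c) hVl
  by_contra hx0
  exact (hVempty ▸ ⟨hx, (hκ1 x hx).trans_ne hx0⟩ : x ∈ (∅ : Set Coord))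

end PrincipalFrame

/-! ### Ideal immersions -/

namespace IsIdealTetrad

variable {ε : ℝ} {U : Set Coord} {X ξ : Coord → Ambient} {w v q u : Coord → Coord}
  {μ lam ν σ : Coord → ℝ} (h : IsIdealTetrad ε U X ξ w v q u μ lam ν σ) (hε : ε = 1 ∨ ε = -1)
  (hU : IsOpen U)
include h

lemma eta_frame {x : Coord} (hx : x ∈ U) (a b : Fin 4) :
    eta ε (fderiv ℝ X x (![w, v, q, u] a x)) (fderiv ℝ X x (![w, v, q, u] b x)) =
      if a = b then tetradSign a else 0 := by
  have heval (a : Fin 4) : ![w, v, q, u] a x = ![w x, v x, q x, u x] a := by fin_cases a <;> rfl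
  rw [heval, heval, ← inducedMetric_inner, h.orthonormal x hx]
  rfl

include hε hU

lemma principalFrame : PrincipalFrame ε U X ξ ![w, v, q, u] ![σ, lam, ν, μ] where
  sq_sign := by rcases hε with rfl | rfl <;> norm_num
  isOpen := hU
  smooth_X := h.smooth_X
  smooth_ξ := h.smooth_ξ
  smooth_e a := by
    fin_cases a
    exacts [h.smooth_w, h.smooth_v, h.smooth_q, h.smooth_u]
  normal := h.normal
  unit_normal := h.unit_normal
  orthonormal _ hx := h.eta_frame hx
  principal x hx a V := by
    have hort (b) := h.eta_frame hx b a
    have h0 := hort 0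
    have h1 := hort 1
    have h2 := hort 2
    have h3 := hort 3
    simp only [Matrix.cons_val] at h0 h1 h2 h3
    rw [h.diagonal x hx]
    simp only [inducedMetric_inner, h0, h1, h2, h3]
    fin_cases a <;> simp [tetradSign]

lemma sigma_eq {x : Coord} (hx : x ∈ U) : σ x = μ x - lam x - ν x := by
  have hF := h.principalFrame hε hU
  have hK {a b : Fin 4} (hab : a ≠ b) := hF.sectional_frame hx hab
  have s01 := hK (a := 0) (b := 1) (by decide)
  have s02 := hK (a := 0) (b := 2) (by decide)
  have s03 := hK (a := 0) (b := 3) (by decide)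
  have s12 := hK (a := 1) (b := 2) (by decide)
  have s13 := hK (a := 1) (b := 3) (by decide)
  have s23 := hK (a := 2) (b := 3) (by decide)
  simp only [Matrix.cons_val] at s01 s02 s03 s12 s13 s23
  have hc := h.chen_equality x hx
  rw [hF.eta_meanCurvature hx] at hc
  have hchen : chenConst 4 [3] = 4 := by norm_num [chenConst]
  have hdiff : sectionScalar (inducedMetric ε X) x ![w x, v x, q x, u x]
      - sectionScalar (inducedMetric ε X) x ![w x, v x, q x] =
        ε * (μ x * (σ x + lam x + ν x)) := by
    simp [sectionScalar, Fin.sum_univ_four, Fin.sum_univ_three, s01, s02, s03, s12, s13, s23]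
    ring
  rw [hchen, hdiff] at hc
  simp only [Fin.sum_univ_four, Matrix.cons_val] at hc
  have hsq : ε * (σ x + lam x + ν x - μ x) ^ 2 = 0 := by linear_combination hc
  have hsum : σ x + lam x + ν x - μ x = 0 := by simpa [hF.sign_ne_zero] using hsq
  linarith

lemma eq_zero_of_ratio (hr : (∀ x ∈ U, μ x = -lam x ∧ ν x = lam x) ∨
      (∀ x ∈ U, μ x = -ν x ∧ lam x = -3 * ν x) ∨ (∀ x ∈ U, μ x = -lam x ∧ ν x = -3 * lam x))
    {x : Coord} (hx : x ∈ U) : μ x = 0 ∧ lam x = 0 ∧ ν x = 0 := by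
  have hF := h.principalFrame hε hU
  have hσ := fun y (hy : y ∈ U) => h.sigma_eq hε hU hy
  rcases hr with hr | hr | hr
  · have hlam := hF.eq_zero_of_curvature_ratio (l := lam) (fun y hy => by
      funext a
      fin_cases a <;> simp [hσ y hy, hr y hy]
      ring) hx
    simp [hr x hx, hlam]
  · have hperm := hF.perm (Equiv.swap 0 1) fun a => by
      fin_cases a <;> simp [tetradSign, Equiv.swap_apply_def]
    have hν := hperm.eq_zero_of_curvature_ratio (l := ν) (fun y hy => by
      funext a
      fin_cases a <;> simp [Equiv.swap_apply_def, hσ y hy, hr y hy] <;> ring) hx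
    simp [hr x hx, hν]
  · have hperm := hF.perm (Equiv.swap 0 2) fun a => by
      fin_cases a <;> simp [tetradSign, Equiv.swap_apply_def]
    have hlam := hperm.eq_zero_of_curvature_ratio (l := lam) (fun y hy => by
      funext a
      fin_cases a <;> simp [Equiv.swap_apply_def, hσ y hy, hr y hy] <;> ring) hx
    simp [hr x hx, hlam]

lemma isFlatAt {x : Coord} (hx : x ∈ U) (h0 : μ x = 0 ∧ lam x = 0 ∧ ν x = 0) :
    IsFlatAt (inducedMetric ε X) x :=
  (h.principalFrame hε hU).isFlatAt hx fun a => by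
    fin_cases a <;> simp [h0, h.sigma_eq hε hU hx]

end IsIdealTetrad

/-! ### Hypersurfaces with principal curvatures in the ratio `1 : 1 : 1 : 3` -/

/-- The `1`-form `-g(N, ·)` dual to the tangent vector field with ambient image `N`. For the unit
timelike vector `N = dX(∂_t)` of a Robertson–Walker metric it is `dt`. -/
def timeForm (ε : ℝ) (X N : Coord → Ambient) (x : Coord) : Coord →L[ℝ] ℝ :=
  -(etaL ε (N x) ∘L fderiv ℝ X x)

lemma timeForm_apply (ε : ℝ) (X N : Coord → Ambient) (x V : Coord) :
    timeForm ε X N x V = -eta ε (fderiv ℝ X x V) (N x) := by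
  rw [eta_comm]
  rfl

lemma smoothOn_timeForm {ε : ℝ} {X N : Coord → Ambient} {U : Set Coord} (hU : IsOpen U)
    (hX : ContDiffOn ℝ ∞ X U) (hN : ContDiffOn ℝ ∞ N U) :
    ContDiffOn ℝ ∞ (timeForm ε X N) U :=
  (((etaL ε).contDiff.comp_contDiffOn hN).clm_comp (smoothOn_fderiv hU hX)).neg

lemma eq_zero_of_fderiv_eq_smul_of_segment_subset {E : Type*} [NormedAddCommGroup E]
    [NormedSpace ℝ E] {U : Set E} (hU : IsOpen U) {f : E → ℝ} {L : E → E →L[ℝ] ℝ}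
    (hf : DifferentiableOn ℝ f U) (hL : ContinuousOn L U)
    (hfL : ∀ x ∈ U, fderiv ℝ f x = f x • L x) {x y : E} (hxy : segment ℝ x y ⊆ U)
    (hx : f x = 0) : f y = 0 := by
  let γ : ℝ → E := AffineMap.lineMap x y
  have hγ : ∀ s ∈ Set.Icc (0 : ℝ) 1, γ s ∈ U := fun s hs =>
    hxy (segment_eq_image_lineMap ℝ x y ▸ Set.mem_image_of_mem _ hs)
  obtain ⟨K, hK⟩ := isCompact_Icc.exists_bound_of_continuousOn
    ((hL.comp AffineMap.lineMap_continuous.continuousOn hγ).clm_apply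
      (continuousOn_const (c := y - x)))
  have hderiv : ∀ s ∈ Set.Icc (0 : ℝ) 1, HasDerivAt (f ∘ γ) (f (γ s) * L (γ s) (y - x)) s := by
    intro s hs
    have hfs := (hf.differentiableAt (hU.mem_nhds (hγ s hs))).hasFDerivAt
    rw [hfL _ (hγ s hs)] at hfs
    exact hfs.comp_hasDerivAt s AffineMap.hasDerivAt_lineMap
  have hzero := eq_zero_of_abs_deriv_le_mul_abs_self_of_eq_zero_right (K := K) (a := 0) (b := 1)
    (fun s hs => (hderiv s hs).continuousAt.continuousWithinAt)
    (fun s hs => (hderiv s ⟨hs.1, hs.2.le⟩).hasDerivWithinAt) (by simpa [γ] using hx)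
    (fun s hs => by
      rw [norm_mul, mul_comm]
      exact mul_le_mul_of_nonneg_right (hK s ⟨hs.1, hs.2.le⟩) (norm_nonneg _))
  simpa [γ] using hzero 1 (by simp)

lemma eq_zero_or_ne_zero_of_fderiv_eq_smul {E : Type*} [NormedAddCommGroup E] [NormedSpace ℝ E]
    {U : Set E} (hU : IsOpen U) (hUc : IsPreconnected U) {f : E → ℝ} {L : E → E →L[ℝ] ℝ}
    (hf : DifferentiableOn ℝ f U) (hL : ContinuousOn L U)
    (hfL : ∀ x ∈ U, fderiv ℝ f x = f x • L x) :
    (∀ x ∈ U, f x = 0) ∨ ∀ x ∈ U, f x ≠ 0 := by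
  have hzero : IsOpen (U ∩ {x | f x = 0}) := by
    rw [isOpen_iff_mem_nhds]
    rintro x ⟨hx, hx0⟩
    obtain ⟨δ, hδ, hball⟩ := Metric.isOpen_iff.1 hU x hx
    filter_upwards [Metric.ball_mem_nhds x hδ] with y hy
    refine ⟨hball hy, eq_zero_of_fderiv_eq_smul_of_segment_subset hU hf hL hfL ?_ hx0⟩
    exact ((convex_ball x δ).segment_subset (Metric.mem_ball_self hδ) hy).trans hball
  have hne : IsOpen (U ∩ {x | f x ≠ 0}) :=
    hf.continuousOn.isOpen_inter_preimage hU isOpen_compl_singleton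
  have hdisj : Disjoint (U ∩ {x | f x = 0}) (U ∩ {x | f x ≠ 0}) :=
    Set.disjoint_left.2 fun x hx hx' => hx'.2 hx.2
  have hcover : U ⊆ U ∩ {x | f x = 0} ∪ U ∩ {x | f x ≠ 0} := fun x hx =>
    (eq_or_ne (f x) 0).imp (⟨hx, ·⟩) (⟨hx, ·⟩)
  exact (hUc.subset_or_subset hzero hne hdisj hcover).imp
    (fun h x hx => (h hx).2) (fun h x hx => (h hx).2)

/-- A principal frame whose principal curvatures are `l, l, l` on the spacelike vectors and `3l` on
the timelike vector: the case `μ = 3λ`, `ν = σ = λ` of the ideal tetrads. -/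
structure QuasiUmbilicFrame (ε : ℝ) (U : Set Coord) (X ξ : Coord → Ambient)
    (e : Fin 4 → Coord → Coord) (κ : Fin 4 → Coord → ℝ) : Prop
    extends PrincipalFrame ε U X ξ e κ where
  spatial_curvature : ∀ x ∈ U, ∀ a, a ≠ 3 → κ a x = κ 0 x
  time_curvature : ∀ x ∈ U, κ 3 x = 3 * κ 0 x

/-- The coefficient `η(D_w (dX(u)), dX(w))` of a tetrad `w, v, q, u`. In a Robertson–Walker metric
with `u = ∂_t` it is the Hubble rate `a' / a`. -/
def hubbleRate (ε : ℝ) (X : Coord → Ambient) (e : Fin 4 → Coord → Coord) : Coord → ℝ :=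
  connCoeff ε X e 0 3 0

namespace QuasiUmbilicFrame

variable {ε : ℝ} {U : Set Coord} {X ξ : Coord → Ambient} {e : Fin 4 → Coord → Coord}
  {κ : Fin 4 → Coord → ℝ} (h : QuasiUmbilicFrame ε U X ξ e κ)
include h

section Pointwise

variable {x : Coord} (hx : x ∈ U)
include hx

lemma fderiv_curvature_spatial {i : Fin 4} (hi : i ≠ 3) : fderiv ℝ (κ 0) x (e i x) = 0 := by
  obtain ⟨j, hj, hij⟩ : ∃ j : Fin 4, j ≠ 3 ∧ i ≠ j := by
    rcases eq_or_ne i 0 with rfl | h0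
    exacts [⟨1, by decide, by decide⟩, ⟨0, by decide, h0⟩]
  have hc := h.codazzi_self hx hij
  rw [h.spatial_curvature x hx i hi, h.spatial_curvature x hx j hj, sub_self, zero_mul,
    fderiv_eq_of_eqOn h.isOpen (fun y hy => h.spatial_curvature y hy j hj) hx, eq_comm,
    neg_eq_zero] at hc
  exact (mul_eq_zero.1 hc).resolve_right (tetradSign_ne_zero j)

lemma fderiv_curvature_time {i : Fin 4} (hi : i ≠ 3) :
    fderiv ℝ (κ 0) x (e 3 x) = 2 * κ 0 x * connCoeff ε X e i 3 i x := by
  have hc := h.codazzi_self hx hi.symm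
  rw [h.spatial_curvature x hx i hi, h.time_curvature x hx, tetradSign_of_ne_three hi,
    fderiv_eq_of_eqOn h.isOpen (fun y hy => h.spatial_curvature y hy i hi) hx] at hc
  linarith

lemma eq_smul_timeForm {L : Coord →L[ℝ] ℝ} (hL : ∀ i, i ≠ 3 → L (e i x) = 0) :
    L = L (e 3 x) • timeForm ε X (pushFrame X e 3) x := by
  ext V
  have hV := h.map_eq_sum hx (L : Coord →ₗ[ℝ] ℝ) V
  rw [Fin.sum_univ_castSucc, Finset.sum_eq_zero, zero_add] at hV
  · simp only [ContinuousLinearMap.coe_coe, Fin.reduceLast, tetradSign_three, smul_eq_mul] at hV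
    rw [hV, smul_apply, timeForm_apply, smul_eq_mul]
    ring
  · intro i _
    simp [hL i.castSucc (Fin.castSucc_lt_last i).ne]

lemma fderiv_curvature :
    fderiv ℝ (κ 0) x = κ 0 x •
      ((2 * hubbleRate ε X e x) • timeForm ε X (pushFrame X e 3) x) := by
  rw [h.eq_smul_timeForm hx fun _ hi => h.fderiv_curvature_spatial hx hi,
    h.fderiv_curvature_time hx (i := 0) (by decide), hubbleRate]
  module

lemma fderiv_normal (V : Coord) :
    fderiv ℝ ξ x V = -(κ 0 x • fderiv ℝ X x V)
      - (2 * κ 0 x * timeForm ε X (pushFrame X e 3) x V) • pushFrame X e 3 x := by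
  have hξ := h.map_eq_sum hx (fderiv ℝ ξ x : Coord →ₗ[ℝ] Ambient) V
  have hX := h.map_eq_sum hx (fderiv ℝ X x : Coord →ₗ[ℝ] Ambient) V
  simp only [ContinuousLinearMap.coe_coe, h.fderiv_normal_frame hx, Fin.sum_univ_four,
    h.time_curvature x hx, h.spatial_curvature x hx 1 (by decide),
    h.spatial_curvature x hx 2 (by decide), tetradSign_three] at hξ hX
  rw [hξ, timeForm_apply, ← sub_eq_zero]
  conv_lhs => enter [2, 1, 1, 2]; rw [hX]
  simp only [pushFrame]
  module

end Pointwise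

lemma curvature_eq_zero_or_ne_zero (hUc : IsPreconnected U) :
    (∀ x ∈ U, κ 0 x = 0) ∨ ∀ x ∈ U, κ 0 x ≠ 0 :=
  eq_zero_or_ne_zero_of_fderiv_eq_smul h.isOpen hUc
    ((h.smooth_curvature 0).differentiableOn (by simp))
    (((contDiffOn_const.mul (h.smooth_connCoeff 0 3 0)).smul
      (smoothOn_timeForm h.isOpen h.smooth_X (h.smooth_pushFrame 3))).continuousOn)
    (fun _ hx => h.fderiv_curvature hx)

variable (hne : ∀ x ∈ U, κ 0 x ≠ 0) {x : Coord} (hx : x ∈ U)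
include hne hx

lemma connCoeff_time_time (a : Fin 4) : connCoeff ε X e 3 3 a x = 0 := by
  rcases eq_or_ne a 3 with rfl | ha
  · exact h.connCoeff_self hx 3 3
  have hc := h.codazzi_self hx ha
  rw [fderiv_eq_of_eqOn h.isOpen h.time_curvature hx, fderiv_const_mul_field, smul_apply,
    h.fderiv_curvature_spatial hx ha, smul_zero, zero_mul, neg_zero, h.time_curvature x hx,
    h.spatial_curvature x hx a ha] at hc
  rw [h.connCoeff_antisymm hx, neg_eq_zero]
  exact (mul_eq_zero.1 hc).resolve_left fun h0 => hne x hx (by linarith)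

lemma connCoeff_time (a b : Fin 4) :
    connCoeff ε X e a 3 b x = if a = b ∧ a ≠ 3 then hubbleRate ε X e x else 0 := by
  rcases eq_or_ne a 3 with rfl | ha
  · simp [h.connCoeff_time_time hne hx]
  rcases eq_or_ne b 3 with rfl | hb
  · simp [h.connCoeff_self hx, ha]
  rcases eq_or_ne a b with rfl | hab
  · rw [if_pos ⟨rfl, ha⟩]
    have htime := (h.fderiv_curvature_time hx ha).symm.trans
      (h.fderiv_curvature_time hx (i := 0) (by decide))
    exact mul_left_cancel₀ (mul_ne_zero two_ne_zero (hne x hx)) htime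
  · rw [if_neg fun h0 => hab h0.1]
    have hc := h.codazzi_distinct hx hab hb.symm
    rw [h.spatial_curvature x hx a ha, h.spatial_curvature x hx b hb, h.time_curvature x hx,
      sub_self, zero_mul] at hc
    exact (mul_eq_zero.1 hc).resolve_left fun h0 => hne x hx (by linarith)

lemma fderiv_connCoeff_time (a b : Fin 4) :
    fderiv ℝ (connCoeff ε X e a 3 b) x =
      if a = b ∧ a ≠ 3 then fderiv ℝ (hubbleRate ε X e) x else 0 := by
  rw [fderiv_eq_of_eqOn h.isOpen (fun y hy => h.connCoeff_time hne hy a b) hx]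
  split_ifs <;> simp

lemma fderiv_hubbleRate_spatial {i : Fin 4} (hi : i ≠ 3) :
    fderiv ℝ (hubbleRate ε X e) x (e i x) = 0 := by
  have g0131 := h.gauss hx 0 1 3 1
  have g1030 := h.gauss hx 1 0 3 0
  have g2030 := h.gauss hx 2 0 3 0
  have s0 : tetradSign 0 = 1 := tetradSign_of_ne_three (by decide)
  have s1 : tetradSign 1 = 1 := tetradSign_of_ne_three (by decide)
  have s2 : tetradSign 2 = 1 := tetradSign_of_ne_three (by decide)
  simp only [Fin.sum_univ_four, h.fderiv_connCoeff_time hne hx, h.connCoeff_time hne hx,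
    h.connCoeff_self hx, s0, s1, s2, Fin.reduceEq, ne_eq, not_true_eq_false, not_false_eq_true,
    and_true, and_false, if_true, if_false, zero_apply] at g0131 g1030 g2030
  have h0 : fderiv ℝ (hubbleRate ε X e) x (e 0 x) = 0 := by
    linear_combination g0131 - hubbleRate ε X e x * h.connCoeff_antisymm hx 1 0 1
  have h1 : fderiv ℝ (hubbleRate ε X e) x (e 1 x) = 0 := by
    linear_combination g1030 - hubbleRate ε X e x * h.connCoeff_antisymm hx 0 1 0
  have h2 : fderiv ℝ (hubbleRate ε X e) x (e 2 x) = 0 := by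
    linear_combination g2030 - hubbleRate ε X e x * h.connCoeff_antisymm hx 0 2 0
  fin_cases i
  exacts [h0, h1, h2, absurd rfl hi]

lemma fderiv_hubbleRate_time :
    fderiv ℝ (hubbleRate ε X e) x (e 3 x) =
      3 * ε * κ 0 x ^ 2 - hubbleRate ε X e x ^ 2 := by
  have hgauss := h.gauss hx 3 0 3 0
  simp only [Fin.sum_univ_four, h.fderiv_connCoeff_time hne hx, h.connCoeff_time hne hx,
    h.connCoeff_self hx, h.time_curvature x hx, tetradSign_three, Fin.reduceEq, ne_eq,
    not_true_eq_false, not_false_eq_true, and_true, and_false,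
    if_true, if_false, zero_apply, tetradSign_of_ne_three (show (0 : Fin 4) ≠ 3 by decide)]
    at hgauss
  linear_combination hgauss

lemma fderiv_hubbleRate :
    fderiv ℝ (hubbleRate ε X e) x =
      (3 * ε * κ 0 x ^ 2 - hubbleRate ε X e x ^ 2) • timeForm ε X (pushFrame X e 3) x := by
  rw [h.eq_smul_timeForm hx fun _ hi => h.fderiv_hubbleRate_spatial hne hx hi,
    h.fderiv_hubbleRate_time hne hx]

lemma fderiv_time_frame (a : Fin 4) :
    fderiv ℝ (pushFrame X e 3) x (e a x) =
      if a = 3 then -((3 * ε * κ 0 x) • ξ x)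
      else hubbleRate ε X e x • pushFrame X e a x := by
  refine h.ambient_ext hx (fun b => ?_) ?_
  · change connCoeff ε X e a 3 b x = _
    rw [h.connCoeff_time hne hx]
    rcases eq_or_ne a 3 with rfl | ha
    · simp [eta_neg_left, eta_smul_left, pushFrame, h.eta_normal_left hx]
    · rcases eq_or_ne a b with rfl | hab
      · simp [ha, eta_smul_left, h.eta_pushFrame hx, tetradSign_of_ne_three ha]
      · simp [ha, hab, eta_smul_left, h.eta_pushFrame hx]
  · rw [h.eta_fderiv_pushFrame_normal hx]
    rcases eq_or_ne a 3 with rfl | ha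
    · rw [if_pos rfl, if_pos rfl, eta_neg_left, eta_smul_left, h.unit_normal x hx,
        h.time_curvature x hx, tetradSign_three]
      linear_combination (3 * κ 0 x) * h.sq_sign
    · rw [if_neg ha, if_neg ha, eta_smul_left, h.eta_pushFrame_normal hx, mul_zero]

lemma fderiv_time (V : Coord) :
    fderiv ℝ (pushFrame X e 3) x V = hubbleRate ε X e x •
      (fderiv ℝ X x V - timeForm ε X (pushFrame X e 3) x V • pushFrame X e 3 x)
      - (3 * ε * κ 0 x * timeForm ε X (pushFrame X e 3) x V) • ξ x := by
  have hN := h.map_eq_sum hx (fderiv ℝ (pushFrame X e 3) x : Coord →ₗ[ℝ] Ambient) V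
  have hX := h.map_eq_sum hx (fderiv ℝ X x : Coord →ₗ[ℝ] Ambient) V
  simp only [ContinuousLinearMap.coe_coe, h.fderiv_time_frame hne hx, Fin.sum_univ_four,
    tetradSign_three, Fin.reduceEq, if_true, if_false] at hN hX
  rw [hN, timeForm_apply, ← sub_eq_zero]
  conv_lhs => enter [2, 1, 2, 1]; rw [hX]
  simp only [pushFrame]
  module

end QuasiUmbilicFrame

/-! ### Local coordinates -/

lemma exists_restr_target_eq_ball {Y Z : Type*} [TopologicalSpace Y] [PseudoMetricSpace Z]
    (Φ : OpenPartialHomeomorph Y Z) {N : Set Y} (hN : IsOpen N) {x₀ : Y} (hx₀ : x₀ ∈ Φ.source)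
    (hx₀N : x₀ ∈ N) :
    ∃ (Ψ : OpenPartialHomeomorph Y Z) (δ : ℝ), ⇑Ψ = Φ ∧ x₀ ∈ Ψ.source ∧ Ψ.source ⊆ N ∧
      Ψ.target = Metric.ball (Φ x₀) δ := by
  let Φ₁ := Φ.restrOpen N hN
  have hx₁ : x₀ ∈ Φ₁.source := ⟨hx₀, hx₀N⟩
  obtain ⟨δ, hδ, hball⟩ := Metric.isOpen_iff.1 Φ₁.open_target (Φ x₀) (Φ₁.map_source hx₁)
  let Ψ := (Φ₁.symm.restrOpen (Metric.ball (Φ x₀) δ) Metric.isOpen_ball).symm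
  have htarget : Ψ.target = Metric.ball (Φ x₀) δ := Set.inter_eq_right.2 hball
  have hinv : Ψ.symm (Φ x₀) = x₀ := Φ₁.left_inv hx₁
  refine ⟨Ψ, δ, rfl, ?_, fun x hx => ?_, htarget⟩
  · have hmem := Ψ.map_target (htarget ▸ Metric.mem_ball_self hδ)
    rwa [hinv] at hmem
  · have hmem : Φ₁.symm (Ψ x) ∈ Φ₁.source :=
      Φ₁.map_target (hball (htarget ▸ Ψ.map_source hx))
    rw [show Φ₁.symm (Ψ x) = x from Ψ.left_inv hx] at hmem
    exact hmem.2

lemma exists_chart_of_injective_fderiv {E : Type*} [NormedAddCommGroup E] [NormedSpace ℝ E]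
    [FiniteDimensional ℝ E] {N : Set E} (hN : IsOpen N) {F : E → E} (hF : ContDiffOn ℝ ∞ F N)
    (hinj : ∀ x ∈ N, Function.Injective (fderiv ℝ F x)) {x₀ : E} (hx₀ : x₀ ∈ N) :
    ∃ (Φ : OpenPartialHomeomorph E E) (δ : ℝ), ⇑Φ = F ∧ x₀ ∈ Φ.source ∧
      Φ.source ⊆ N ∧ Φ.target = Metric.ball (F x₀) δ ∧ ContDiffOn ℝ ∞ Φ.symm Φ.target := by
  have : CompleteSpace E := FiniteDimensional.complete ℝ E
  have hequiv : ∀ x ∈ N, ∃ L : E ≃L[ℝ] E, HasFDerivAt F (L : E →L[ℝ] E) x := fun x hx =>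
    ⟨(LinearEquiv.ofInjectiveEndo (fderiv ℝ F x : E →ₗ[ℝ] E)
      (hinj x hx)).toContinuousLinearEquiv, (differentiableAt_of_smoothOn hN hF hx).hasFDerivAt⟩
  obtain ⟨L, hL⟩ := hequiv x₀ hx₀
  have hF₀ := hF.contDiffAt (hN.mem_nhds hx₀)
  obtain ⟨Φ, δ, hΦF, hx₀Φ, hΦN, htarget⟩ :=
    exists_restr_target_eq_ball (hF₀.toOpenPartialHomeomorph F hL (by simp)) hN
      (hF₀.mem_toOpenPartialHomeomorph_source hL (by simp)) hx₀
  have hΦF : ⇑Φ = F := hΦF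
  refine ⟨Φ, δ, hΦF, hx₀Φ, hΦN, htarget, fun z hz => ?_⟩
  have hzN := hΦN (Φ.map_target hz)
  obtain ⟨L', hL'⟩ := hequiv _ hzN
  rw [← hΦF] at hL' hF
  exact (Φ.contDiffAt_symm hz hL' (hF.contDiffAt (hN.mem_nhds hzN))).contDiffWithinAt

section LevelSets

lemma eq_of_apply_eq_of_fderiv_eq_smul_proj {ι : Type*} [Finite ι] {i : ι}
    {G b : (ι → ℝ) → ℝ} {s : Set (ι → ℝ)} (hs : Convex ℝ s)
    (hG : ∀ z ∈ s, HasFDerivAt G (b z • (ContinuousLinearMap.proj i : (ι → ℝ) →L[ℝ] ℝ)) z)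
    {z z' : ι → ℝ} (hz : z ∈ s) (hz' : z' ∈ s) (hzz : z i = z' i) : G z = G z' := by
  have := Fintype.ofFinite ι
  obtain ⟨p, -, hp⟩ := domain_mvt (fun y hy => (hG y hy).hasFDerivWithinAt) hs hz' hz
  rw [smul_apply, ContinuousLinearMap.proj_apply, Pi.sub_apply, hzz, sub_self, smul_zero] at hp
  exact sub_eq_zero.1 hp

variable {ι : Type*} [Fintype ι] {i : ι} {z₀ : ι → ℝ} {δ : ℝ}

lemma exists_eq_comp_proj {G b : (ι → ℝ) → ℝ}
    (hG : ContDiffOn ℝ ∞ G (Metric.ball z₀ δ))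
    (hGb : ∀ z ∈ Metric.ball z₀ δ, fderiv ℝ G z = b z • ContinuousLinearMap.proj i) :
    ∃ a : ℝ → ℝ, ∀ z ∈ Metric.ball z₀ δ,
      ContDiffAt ℝ ∞ a (z i) ∧ a (z i) = G z ∧ deriv a (z i) = b z := by
  classical
  have hmem {z} (hz : z ∈ Metric.ball z₀ δ) :
      Function.update z₀ i (z i) ∈ Metric.ball z₀ δ := by
    have hδ := Metric.pos_of_mem_ball hz
    rw [Metric.mem_ball, dist_pi_lt_iff hδ] at hz ⊢
    intro j
    rcases eq_or_ne j i with rfl | hj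
    · simpa using hz j
    · simpa [hj] using hδ
  have hGd {z} (hz : z ∈ Metric.ball z₀ δ) : HasFDerivAt G (b z • ContinuousLinearMap.proj i) z :=
    hGb z hz ▸ (differentiableAt_of_smoothOn Metric.isOpen_ball hG hz).hasFDerivAt
  let a : ℝ → ℝ := fun t => G (Function.update z₀ i t)
  have haG {z} (hz : z ∈ Metric.ball z₀ δ) : a (z i) = G z :=
    eq_of_apply_eq_of_fderiv_eq_smul_proj (convex_ball z₀ δ) (fun _ => hGd) (hmem hz) hz (by simp)
  have ha {z} (hz : z ∈ Metric.ball z₀ δ) : ContDiffAt ℝ ∞ a (z i) :=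
    ContDiffAt.comp (g := G) (z i) (hG.contDiffAt (Metric.isOpen_ball.mem_nhds (hmem hz)))
      (contDiff_update _ _ _).contDiffAt
  refine ⟨a, fun z hz => ⟨ha hz, haG hz, ?_⟩⟩
  have hcomp := ((ha hz).differentiableAt (by simp)).hasDerivAt.comp_hasFDerivAt z
    (ContinuousLinearMap.proj (R := ℝ) (φ := fun _ => ℝ) i).hasFDerivAt
  have heq : G =ᶠ[nhds z] a ∘ ContinuousLinearMap.proj (R := ℝ) (φ := fun _ => ℝ) i :=
    Filter.eventually_of_mem (Metric.isOpen_ball.mem_nhds hz) fun y hy => (haG hy).symm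
  simpa using DFunLike.congr_fun (hcomp.unique ((hGd hz).congr_of_eventuallyEq heq.symm))
    (Pi.single i 1)

lemma exists_eq_comp_coord {Φ : OpenPartialHomeomorph (ι → ℝ) (ι → ℝ)}
    (hΦ : ContDiffOn ℝ ∞ Φ Φ.source) (hsymm : ContDiffOn ℝ ∞ Φ.symm Φ.target)
    (hball : Φ.target = Metric.ball z₀ δ) {A b : (ι → ℝ) → ℝ} (hA : ContDiffOn ℝ ∞ A Φ.source)
    (hAb : ∀ x ∈ Φ.source, ∀ V, fderiv ℝ A x V = b x * fderiv ℝ Φ x V i) :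
    ∃ a : ℝ → ℝ, ∀ x ∈ Φ.source,
      ContDiffAt ℝ ∞ a (Φ x i) ∧ a (Φ x i) = A x ∧ deriv a (Φ x i) = b x := by
  have hG : ContDiffOn ℝ ∞ (A ∘ Φ.symm) Φ.target := hA.comp hsymm fun z => Φ.map_target
  have hGd : ∀ z ∈ Φ.target,
      fderiv ℝ (A ∘ Φ.symm) z = b (Φ.symm z) • ContinuousLinearMap.proj i := by
    intro z hz
    have hx := Φ.map_target hz
    have hdA := differentiableAt_of_smoothOn Φ.open_source hA hx
    have hdΦ := differentiableAt_of_smoothOn Φ.open_source hΦ hx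
    have hdsymm := differentiableAt_of_smoothOn Φ.open_target hsymm hz
    have hinv : fderiv ℝ Φ (Φ.symm z) ∘L fderiv ℝ Φ.symm z = ContinuousLinearMap.id ℝ _ :=
      (hdΦ.hasFDerivAt.comp z hdsymm.hasFDerivAt).unique <|
        (hasFDerivAt_id z).congr_of_eventuallyEq (Φ.eventually_right_inverse hz)
    ext V
    rw [fderiv_comp z hdA hdsymm, ContinuousLinearMap.comp_apply, hAb _ hx,
      ← ContinuousLinearMap.comp_apply, hinv]
    rfl
  obtain ⟨a, ha⟩ := exists_eq_comp_proj (i := i) (b := b ∘ Φ.symm) (hball ▸ hG) (hball ▸ hGd)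
  refine ⟨a, fun x hx => ?_⟩
  simpa [Φ.left_inv hx] using ha (Φ x) (hball ▸ Φ.map_source hx)

end LevelSets

/-! ### Polar coordinates on the spaces of constant curvature -/

/-- The derivative of `Σ(·, k)`: `cos r`, `1`, `cosh r` for `k = 1, 0, -1`. -/
def rwCos (k : ℤ) (r : ℝ) : ℝ :=
  if k = 1 then Real.cos r else if k = 0 then 1 else Real.cosh r

/-- The primitive of `Σ(·, k)` that vanishes at `0`. In the model
`y₀² + y₁² + y₂² + k T² = 2 T` of the space of constant curvature `k`, with pole `y = 0, T = 0`,
it is the coordinate `T` of the points at distance `r` from the pole. -/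
def rwHeight (k : ℤ) (r : ℝ) : ℝ :=
  if k = 1 then 1 - Real.cos r else if k = 0 then r ^ 2 / 2 else Real.cosh r - 1

section Radius

variable (k : ℤ)

lemma hasDerivAt_rwSigma (r : ℝ) : HasDerivAt (rwSigma k) (rwCos k r) r := by
  unfold rwSigma rwCos
  split_ifs
  · exact Real.hasDerivAt_sin r
  · exact hasDerivAt_id r
  · exact Real.hasDerivAt_sinh r

lemma hasDerivAt_rwHeight (r : ℝ) : HasDerivAt (rwHeight k) (rwSigma k r) r := by
  unfold rwSigma rwHeight
  split_ifs
  · simpa using (Real.hasDerivAt_cos r).const_sub 1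
  · exact ((hasDerivAt_pow 2 r).div_const 2).congr_deriv (by norm_num)
  · simpa using (Real.hasDerivAt_cosh r).sub_const 1

lemma contDiff_rwSigma : ContDiff ℝ ∞ (rwSigma k) := by
  unfold rwSigma
  split_ifs
  · exact Real.contDiff_sin
  · exact contDiff_id
  · exact Real.contDiff_sinh

lemma contDiff_rwHeight : ContDiff ℝ ∞ (rwHeight k) := by
  unfold rwHeight
  split_ifs
  · exact contDiff_const.sub Real.contDiff_cos
  · exact (contDiff_id.pow 2).div_const 2
  · exact Real.contDiff_cosh.sub contDiff_const

lemma rwSigma_one_pos : 0 < rwSigma k 1 := by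
  unfold rwSigma
  split_ifs
  · exact Real.sin_pos_of_pos_of_lt_pi one_pos (by linarith [Real.pi_gt_three])
  · exact one_pos
  · exact Real.sinh_pos_iff.2 one_pos

lemma exists_smooth_inverse_rwHeight : ∃ (ρ : ℝ → ℝ) (D : Set ℝ), IsOpen D ∧
    rwHeight k 1 ∈ D ∧ ContDiffOn ℝ ∞ ρ D ∧ ∀ s ∈ D, rwHeight k (ρ s) = s ∧
      0 < rwSigma k (ρ s) ∧ 0 < ρ s ∧ ρ s < Real.pi := by
  have hne := (rwSigma_one_pos k).ne'
  have hstrict : HasStrictDerivAt (rwHeight k) (rwSigma k 1) 1 :=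
    (contDiff_rwHeight k).contDiffAt.hasStrictDerivAt' (hasDerivAt_rwHeight k 1) (by simp)
  have hequiv := hstrict.hasStrictFDerivAt_equiv hne
  let Ψ := hequiv.toOpenPartialHomeomorph (rwHeight k)
  have h1 : (1 : ℝ) ∈ Ψ.source := hequiv.mem_toOpenPartialHomeomorph_source
  have hinv : Ψ.symm (rwHeight k 1) = 1 := Ψ.left_inv h1
  have hW : IsOpen {r : ℝ | 0 < rwSigma k r ∧ 0 < r ∧ r < Real.pi} :=
    (isOpen_lt continuous_const (contDiff_rwSigma k).continuous).inter
      ((isOpen_lt continuous_const continuous_id).inter (isOpen_lt continuous_id continuous_const))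
  refine ⟨Ψ.symm, Ψ.target ∩ Ψ.symm ⁻¹' {r : ℝ | 0 < rwSigma k r ∧ 0 < r ∧ r < Real.pi},
    Ψ.isOpen_inter_preimage_symm hW, ⟨Ψ.map_source h1, ?_⟩, ?_, ?_⟩
  · rw [Set.mem_preimage, hinv]
    exact ⟨rwSigma_one_pos k, one_pos, by linarith [Real.pi_gt_three]⟩
  · rintro s ⟨hs, hpos, -⟩
    exact (Ψ.contDiffAt_symm_deriv hpos.ne' hs (hasDerivAt_rwHeight k _)
      (contDiff_rwHeight k).contDiffAt).contDiffWithinAt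
  · rintro s ⟨hs, hpos⟩
    exact ⟨Ψ.right_inv hs, hpos⟩

variable {k : ℤ} (hk : k = 1 ∨ k = 0 ∨ k = -1) (r : ℝ)
include hk

lemma rwCos_sq_add : rwCos k r ^ 2 + k * rwSigma k r ^ 2 = 1 := by
  rcases hk with rfl | rfl | rfl <;> simp [rwCos, rwSigma]
  linarith [Real.cosh_sq_sub_sinh_sq r]

lemma rwCos_eq_one_sub : rwCos k r = 1 - k * rwHeight k r := by
  rcases hk with rfl | rfl | rfl <;> simp [rwCos, rwHeight]

lemma rwSigma_sq_add : rwSigma k r ^ 2 + k * rwHeight k r ^ 2 = 2 * rwHeight k r := by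
  rcases hk with rfl | rfl | rfl <;> simp [rwSigma, rwHeight]
  · linarith [Real.sin_sq_add_cos_sq r]
  · ring
  · linarith [Real.cosh_sq_sub_sinh_sq r]

end Radius

section Angles

variable {E : Type*} [NormedAddCommGroup E] [NormedSpace ℝ E] {N : Set E}

lemma exists_eq_mul_cos {y S : E → ℝ} (hy : ContDiffOn ℝ ∞ y N) (hS : ContDiffOn ℝ ∞ S N)
    (hlt : ∀ x ∈ N, |y x| < S x) :
    ∃ φ : E → ℝ, ContDiffOn ℝ ∞ φ N ∧
      ∀ x ∈ N, (0 < φ x ∧ φ x < Real.pi) ∧ y x = S x * Real.cos (φ x) := by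
  have hpos : ∀ x ∈ N, 0 < S x := fun x hx => (abs_nonneg _).trans_lt (hlt x hx)
  have hdiv : ∀ x ∈ N, -1 < y x / S x ∧ y x / S x < 1 := fun x hx => by
    rw [← abs_lt, abs_div, abs_of_pos (hpos x hx), div_lt_one (hpos x hx)]
    exact hlt x hx
  refine ⟨fun x => Real.arccos (y x / S x), fun x hx => ?_, fun x hx => ?_⟩
  · exact ContDiffAt.comp_contDiffWithinAt (g := Real.arccos) x
      (Real.contDiffAt_arccos (hdiv x hx).1.ne' (hdiv x hx).2.ne)
      (hy.div hS (fun x hx => (hpos x hx).ne') x hx)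
  · refine ⟨⟨Real.arccos_pos.2 (hdiv x hx).2, Real.arccos_lt_pi.2 (hdiv x hx).1⟩, ?_⟩
    rw [Real.cos_arccos (hdiv x hx).1.le (hdiv x hx).2.le, mul_div_cancel₀ _ (hpos x hx).ne']

lemma exists_spherical_angles {y : Fin 3 → E → ℝ} {S : E → ℝ}
    (hy : ∀ i, ContDiffOn ℝ ∞ (y i) N) (hS : ContDiffOn ℝ ∞ S N) (hSpos : ∀ x ∈ N, 0 < S x)
    (hyS : ∀ x ∈ N, y 0 x ^ 2 + y 1 x ^ 2 + y 2 x ^ 2 = S x ^ 2) (hy₁ : ∀ x ∈ N, 0 < y 1 x) :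
    ∃ φ ψ : E → ℝ, ContDiffOn ℝ ∞ φ N ∧ ContDiffOn ℝ ∞ ψ N ∧ ∀ x ∈ N, (0 < φ x ∧ φ x < Real.pi) ∧
      y 0 x = S x * Real.cos (φ x) ∧ y 1 x = S x * (Real.sin (φ x) * Real.cos (ψ x)) ∧
      y 2 x = S x * (Real.sin (φ x) * Real.sin (ψ x)) := by
  obtain ⟨φ, hφ, hφN⟩ := exists_eq_mul_cos (hy 0) hS fun x hx =>
    abs_lt_of_sq_lt_sq (by nlinarith [hyS x hx, hy₁ x hx, sq_nonneg (y 2 x)]) (hSpos x hx).le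
  have hsin : ∀ x ∈ N, 0 < S x * Real.sin (φ x) := fun x hx =>
    mul_pos (hSpos x hx) (Real.sin_pos_of_pos_of_lt_pi (hφN x hx).1.1 (hφN x hx).1.2)
  have hsq : ∀ x ∈ N, y 1 x ^ 2 + y 2 x ^ 2 = (S x * Real.sin (φ x)) ^ 2 := fun x hx => by
    have hq := hyS x hx
    rw [(hφN x hx).2] at hq
    linear_combination hq - S x ^ 2 * Real.sin_sq_add_cos_sq (φ x)
  have hR : ContDiffOn ℝ ∞ (fun x => S x * Real.sin (φ x)) N :=
    hS.mul (Real.contDiff_sin.comp_contDiffOn hφ)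
  obtain ⟨θ, hθ, hθN⟩ := exists_eq_mul_cos (hy 2) hR fun x hx =>
    abs_lt_of_sq_lt_sq (by nlinarith [hsq x hx, hy₁ x hx]) (hsin x hx).le
  refine ⟨φ, fun x => Real.pi / 2 - θ x, hφ, contDiffOn_const.sub hθ, fun x hx => ?_⟩
  obtain ⟨⟨hθ0, hθπ⟩, hy₂⟩ := hθN x hx
  have hθsin := Real.sin_pos_of_pos_of_lt_pi hθ0 hθπ
  rw [Real.cos_pi_div_two_sub, Real.sin_pi_div_two_sub, ← mul_assoc, ← mul_assoc]
  refine ⟨(hφN x hx).1, (hφN x hx).2, ?_, hy₂⟩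
  refine (sq_eq_sq₀ (hy₁ x hx).le (mul_pos (hsin x hx) hθsin).le).1 ?_
  have hq := hsq x hx
  rw [hy₂] at hq
  linear_combination hq - (S x * Real.sin (φ x)) ^ 2 * Real.sin_sq_add_cos_sq (θ x)

end Angles

/-- Polar coordinates `r, φ, ψ` on `N` of a map `(y, T)` into the model
`y₀² + y₁² + y₂² + k T² = 2 T` of the space of constant curvature `k`. -/
structure IsPolarCoordinates {E : Type*} [NormedAddCommGroup E] [NormedSpace ℝ E] (k : ℤ)
    (N : Set E) (y : Fin 3 → E → ℝ) (T r φ ψ : E → ℝ) : Prop where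
  isOpen : IsOpen N
  smooth_r : ContDiffOn ℝ ∞ r N
  smooth_φ : ContDiffOn ℝ ∞ φ N
  smooth_ψ : ContDiffOn ℝ ∞ ψ N
  sigma_pos : ∀ x ∈ N, 0 < rwSigma k (r x)
  r_range : ∀ x ∈ N, 0 < r x ∧ r x < Real.pi
  φ_range : ∀ x ∈ N, 0 < φ x ∧ φ x < Real.pi
  height_eq : ∀ x ∈ N, T x = rwHeight k (r x)
  y₀_eq : ∀ x ∈ N, y 0 x = rwSigma k (r x) * Real.cos (φ x)
  y₁_eq : ∀ x ∈ N, y 1 x = rwSigma k (r x) * (Real.sin (φ x) * Real.cos (ψ x))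
  y₂_eq : ∀ x ∈ N, y 2 x = rwSigma k (r x) * (Real.sin (φ x) * Real.sin (ψ x))

lemma exists_isPolarCoordinates {E : Type*} [NormedAddCommGroup E] [NormedSpace ℝ E] {k : ℤ}
    (hk : k = 1 ∨ k = 0 ∨ k = -1) {B : Set E} (hB : IsOpen B) {y : Fin 3 → E → ℝ} {T : E → ℝ}
    (hy : ∀ i, ContDiffOn ℝ ∞ (y i) B) (hT : ContDiffOn ℝ ∞ T B)
    (hyT : ∀ x ∈ B, y 0 x ^ 2 + y 1 x ^ 2 + y 2 x ^ 2 + k * T x ^ 2 = 2 * T x) {x₀ : E}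
    (hx₀ : x₀ ∈ B) (hy₁ : 0 < y 1 x₀) (hT₀ : T x₀ = rwHeight k 1) :
    ∃ (N : Set E) (r φ ψ : E → ℝ), x₀ ∈ N ∧ N ⊆ B ∧ IsPolarCoordinates k N y T r φ ψ := by
  obtain ⟨ρ, D, hD, hD1, hρ, hρD⟩ := exists_smooth_inverse_rwHeight k
  let N : Set E := (B ∩ T ⁻¹' D) ∩ (B ∩ y 1 ⁻¹' Set.Ioi 0)
  have hN : IsOpen N := (hT.continuousOn.isOpen_inter_preimage hB hD).inter
    ((hy 1).continuousOn.isOpen_inter_preimage hB isOpen_Ioi)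
  have hNB : N ⊆ B := fun x hx => hx.1.1
  have hr : ContDiffOn ℝ ∞ (ρ ∘ T) N := hρ.comp (hT.mono hNB) fun x hx => hx.1.2
  have hyr : ∀ x ∈ N, y 0 x ^ 2 + y 1 x ^ 2 + y 2 x ^ 2 = rwSigma k (ρ (T x)) ^ 2 := fun x hx => by
    have hsq := rwSigma_sq_add hk (ρ (T x))
    rw [(hρD _ hx.1.2).1] at hsq
    linarith [hyT x hx.1.1]
  obtain ⟨φ, ψ, hφ, hψ, hφψ⟩ := exists_spherical_angles (fun i => (hy i).mono hNB)
    ((contDiff_rwSigma k).comp_contDiffOn hr) (fun x hx => (hρD _ hx.1.2).2.1) hyr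
    (fun x hx => hx.2.2)
  exact ⟨N, ρ ∘ T, φ, ψ, ⟨⟨hx₀, show T x₀ ∈ D from hT₀ ▸ hD1⟩, hx₀, hy₁⟩, hNB,
    { isOpen := hN
      smooth_r := hr
      smooth_φ := hφ
      smooth_ψ := hψ
      sigma_pos := fun x hx => (hρD _ hx.1.2).2.1
      r_range := fun x hx => (hρD _ hx.1.2).2.2
      φ_range := fun x hx => (hφψ x hx).1
      height_eq := fun x hx => (hρD _ hx.1.2).1.symm
      y₀_eq := fun x hx => (hφψ x hx).2.1
      y₁_eq := fun x hx => (hφψ x hx).2.2.1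
      y₂_eq := fun x hx => (hφψ x hx).2.2.2 }⟩

namespace IsPolarCoordinates

variable {E : Type*} [NormedAddCommGroup E] [NormedSpace ℝ E] {k : ℤ} {N : Set E}
  {y : Fin 3 → E → ℝ} {T r φ ψ : E → ℝ} (h : IsPolarCoordinates k N y T r φ ψ) {x : E}
  (hx : x ∈ N)
include h hx

lemma hasFDerivAt_r : HasFDerivAt r (fderiv ℝ r x) x :=
  (differentiableAt_of_smoothOn h.isOpen h.smooth_r hx).hasFDerivAt

lemma hasFDerivAt_φ : HasFDerivAt φ (fderiv ℝ φ x) x :=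
  (differentiableAt_of_smoothOn h.isOpen h.smooth_φ hx).hasFDerivAt

lemma hasFDerivAt_ψ : HasFDerivAt ψ (fderiv ℝ ψ x) x :=
  (differentiableAt_of_smoothOn h.isOpen h.smooth_ψ hx).hasFDerivAt

lemma hasFDerivAt_rwSigma :
    HasFDerivAt (fun z => rwSigma k (r z)) (rwCos k (r x) • fderiv ℝ r x) x :=
  (hasDerivAt_rwSigma k (r x)).comp_hasFDerivAt x (h.hasFDerivAt_r hx)

lemma fderiv_height (V : E) : fderiv ℝ T x V = rwSigma k (r x) * fderiv ℝ r x V := by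
  have hH : HasFDerivAt (fun z => rwHeight k (r z)) (rwSigma k (r x) • fderiv ℝ r x) x :=
    (hasDerivAt_rwHeight k (r x)).comp_hasFDerivAt x (h.hasFDerivAt_r hx)
  rw [fderiv_eq_of_eqOn h.isOpen h.height_eq hx, hH.fderiv]
  rfl

lemma fderiv_y₀ (V : E) :
    fderiv ℝ (y 0) x V = rwCos k (r x) * Real.cos (φ x) * fderiv ℝ r x V
      - rwSigma k (r x) * Real.sin (φ x) * fderiv ℝ φ x V := by
  rw [fderiv_eq_of_eqOn h.isOpen h.y₀_eq hx,
    ((h.hasFDerivAt_rwSigma hx).fun_mul (h.hasFDerivAt_φ hx).cos).fderiv]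
  simp
  ring

lemma fderiv_y₁ (V : E) :
    fderiv ℝ (y 1) x V = rwCos k (r x) * Real.sin (φ x) * Real.cos (ψ x) * fderiv ℝ r x V
      + rwSigma k (r x) * Real.cos (φ x) * Real.cos (ψ x) * fderiv ℝ φ x V
      - rwSigma k (r x) * Real.sin (φ x) * Real.sin (ψ x) * fderiv ℝ ψ x V := by
  rw [fderiv_eq_of_eqOn h.isOpen h.y₁_eq hx, ((h.hasFDerivAt_rwSigma hx).fun_mul
    ((h.hasFDerivAt_φ hx).sin.fun_mul (h.hasFDerivAt_ψ hx).cos)).fderiv]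
  simp
  ring

lemma fderiv_y₂ (V : E) :
    fderiv ℝ (y 2) x V = rwCos k (r x) * Real.sin (φ x) * Real.sin (ψ x) * fderiv ℝ r x V
      + rwSigma k (r x) * Real.cos (φ x) * Real.sin (ψ x) * fderiv ℝ φ x V
      + rwSigma k (r x) * Real.sin (φ x) * Real.cos (ψ x) * fderiv ℝ ψ x V := by
  rw [fderiv_eq_of_eqOn h.isOpen h.y₂_eq hx, ((h.hasFDerivAt_rwSigma hx).fun_mul
    ((h.hasFDerivAt_φ hx).sin.fun_mul (h.hasFDerivAt_ψ hx).sin)).fderiv]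
  simp
  ring

lemma model_metric_eq (hk : k = 1 ∨ k = 0 ∨ k = -1) (V W : E) :
    ∑ i, fderiv ℝ (y i) x V * fderiv ℝ (y i) x W + k * (fderiv ℝ T x V * fderiv ℝ T x W) =
      fderiv ℝ r x V * fderiv ℝ r x W + rwSigma k (r x) ^ 2 * (fderiv ℝ φ x V * fderiv ℝ φ x W +
        Real.sin (φ x) ^ 2 * (fderiv ℝ ψ x V * fderiv ℝ ψ x W)) := by
  have hr : rwCos k (r x) ^ 2 = 1 - k * rwSigma k (r x) ^ 2 := by linarith [rwCos_sq_add hk (r x)]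
  rw [Fin.sum_univ_three, h.fderiv_height hx, h.fderiv_height hx, h.fderiv_y₀ hx, h.fderiv_y₀ hx,
    h.fderiv_y₁ hx, h.fderiv_y₁ hx, h.fderiv_y₂ hx, h.fderiv_y₂ hx]
  ring_nf
  simp only [hr, Real.cos_sq']
  ring

end IsPolarCoordinates

/-! ### Robertson–Walker charts -/

/-- The metric `g` is `A² (dy₀² + dy₁² + dy₂² + k dT²) - dt²` on `B`, where `(y, T)` maps into the
model `y₀² + y₁² + y₂² + k T² = 2 T` of the space of constant curvature `k`, where `b = dA / dt`,
and where `u` is a unit timelike vector field with `dt(u) = 1`. -/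
structure IsCartesianRobertsonWalker (g : MetricField) (k : ℤ) (B : Set Coord)
    (y : Fin 3 → Coord → ℝ) (T t A b : Coord → ℝ) (u : Coord → Coord) : Prop where
  curvature_sign : k = 1 ∨ k = 0 ∨ k = -1
  isOpen : IsOpen B
  smooth_y : ∀ i, ContDiffOn ℝ ∞ (y i) B
  smooth_T : ContDiffOn ℝ ∞ T B
  smooth_t : ContDiffOn ℝ ∞ t B
  smooth_A : ContDiffOn ℝ ∞ A B
  A_pos : ∀ x ∈ B, 0 < A x
  model : ∀ x ∈ B, y 0 x ^ 2 + y 1 x ^ 2 + y 2 x ^ 2 + k * T x ^ 2 = 2 * T x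
  metric : ∀ x ∈ B, ∀ V W, g.inner x V W = A x ^ 2 *
    (∑ i, fderiv ℝ (y i) x V * fderiv ℝ (y i) x W + k * (fderiv ℝ T x V * fderiv ℝ T x W))
      - fderiv ℝ t x V * fderiv ℝ t x W
  nondegenerate : ∀ x ∈ B, ∀ V, (∀ W, g.inner x V W = 0) → V = 0
  fderiv_A : ∀ x ∈ B, ∀ V, fderiv ℝ A x V = b x * fderiv ℝ t x V
  unit_timelike : ∀ x ∈ B, g.inner x (u x) (u x) = -1
  fderiv_t : ∀ x ∈ B, fderiv ℝ t x (u x) = 1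

/-- The map `(r, φ, ψ, t)` from the patch to coordinate space. -/
def polarMap (r φ ψ t : Coord → ℝ) (x : Coord) : Coord := ![r x, φ x, ψ x, t x]

namespace IsCartesianRobertsonWalker

variable {g : MetricField} {k : ℤ} {B : Set Coord} {y : Fin 3 → Coord → ℝ} {T t A b : Coord → ℝ}
  {u : Coord → Coord} (h : IsCartesianRobertsonWalker g k B y T t A b u)
include h

section Polar

variable {N : Set Coord} {r φ ψ : Coord → ℝ} (hp : IsPolarCoordinates k N y T r φ ψ)
  (hNB : N ⊆ B)
include hp hNB

lemma smooth_polarMap : ContDiffOn ℝ ∞ (polarMap r φ ψ t) N := by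
  refine contDiffOn_pi.2 fun i => ?_
  fin_cases i
  exacts [hp.smooth_r, hp.smooth_φ, hp.smooth_ψ, h.smooth_t.mono hNB]

variable {x : Coord} (hx : x ∈ N)
include hx

lemma fderiv_polarMap (V : Coord) : fderiv ℝ (polarMap r φ ψ t) x V =
    ![fderiv ℝ r x V, fderiv ℝ φ x V, fderiv ℝ ψ x V, fderiv ℝ t x V] := by
  have hd := (differentiableAt_of_smoothOn hp.isOpen (h.smooth_polarMap hp hNB) hx).hasFDerivAt
  have hi (i) : fderiv ℝ (polarMap r φ ψ t) x V i = fderiv ℝ (fun z => polarMap r φ ψ t z i) x V :=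
    DFunLike.congr_fun (hasFDerivAt_pi'.1 hd i).fderiv.symm V
  funext i
  rw [hi]
  fin_cases i <;> rfl

lemma inner_eq_polar (V W : Coord) : g.inner x V W =
    A x ^ 2 * (fderiv ℝ r x V * fderiv ℝ r x W + rwSigma k (r x) ^ 2 *
      (fderiv ℝ φ x V * fderiv ℝ φ x W + Real.sin (φ x) ^ 2 *
        (fderiv ℝ ψ x V * fderiv ℝ ψ x W))) - fderiv ℝ t x V * fderiv ℝ t x W := by
  rw [h.metric x (hNB hx), hp.model_metric_eq hx h.curvature_sign]

lemma injective_fderiv_polarMap : Function.Injective (fderiv ℝ (polarMap r φ ψ t) x) := by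
  refine (injective_iff_map_eq_zero _).2 fun V hV => h.nondegenerate x (hNB hx) V fun W => ?_
  rw [h.fderiv_polarMap hp hNB hx] at hV
  have hi (i) := congrFun hV i
  rw [h.inner_eq_polar hp hNB hx, show fderiv ℝ r x V = 0 from hi 0,
    show fderiv ℝ φ x V = 0 from hi 1, show fderiv ℝ ψ x V = 0 from hi 2,
    show fderiv ℝ t x V = 0 from hi 3]
  ring

lemma fderiv_polarMap_time : fderiv ℝ (polarMap r φ ψ t) x (u x) = Pi.single 3 1 := by
  have hunit := h.unit_timelike x (hNB hx)
  have hA := (h.A_pos x (hNB hx)).ne'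
  have hS := (hp.sigma_pos x hx).ne'
  have hsin := (Real.sin_pos_of_pos_of_lt_pi (hp.φ_range x hx).1 (hp.φ_range x hx).2).ne'
  -- The spatial part of the metric is positive definite, so `g(u, u) = -dt(u)²` leaves no room
  -- for a spatial component of `u`.
  have hsq : (A x * fderiv ℝ r x (u x)) ^ 2 + (A x * rwSigma k (r x) * fderiv ℝ φ x (u x)) ^ 2
      + (A x * rwSigma k (r x) * Real.sin (φ x) * fderiv ℝ ψ x (u x)) ^ 2 = 0 := by
    rw [h.inner_eq_polar hp hNB hx, h.fderiv_t x (hNB hx)] at hunit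
    linear_combination hunit
  have hr : fderiv ℝ r x (u x) = 0 := by
    have h0 : A x * fderiv ℝ r x (u x) = 0 := by nlinarith
    simpa [hA] using h0
  have hφ : fderiv ℝ φ x (u x) = 0 := by
    have h0 : A x * rwSigma k (r x) * fderiv ℝ φ x (u x) = 0 := by nlinarith
    simpa [hA, hS] using h0
  have hψ : fderiv ℝ ψ x (u x) = 0 := by
    have h0 : A x * rwSigma k (r x) * Real.sin (φ x) * fderiv ℝ ψ x (u x) = 0 := by nlinarith
    simpa [hA, hS, hsin] using h0
  rw [h.fderiv_polarMap hp hNB hx, hr, hφ, hψ, h.fderiv_t x (hNB hx)]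
  funext i
  fin_cases i <;> rfl

end Polar

lemma exists_chart_of_height_eq {x₀ : Coord} (hx₀ : x₀ ∈ B) (hy₁ : 0 < y 1 x₀)
    (hT₀ : T x₀ = rwHeight k 1) :
    ∃ (Φ : OpenPartialHomeomorph Coord Coord) (a : ℝ → ℝ), x₀ ∈ Φ.source ∧ Φ.source ⊆ B ∧
      IsRobertsonWalkerChart g k a Φ ∧ ∀ x ∈ Φ.source, fderiv ℝ Φ x (u x) = Pi.single 3 1 ∧
        a (Φ x 3) = A x ∧ deriv a (Φ x 3) = b x := by
  obtain ⟨N, r, φ, ψ, hxN, hNB, hp⟩ := exists_isPolarCoordinates h.curvature_sign h.isOpen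
    h.smooth_y h.smooth_T h.model hx₀ hy₁ hT₀
  have hF := h.smooth_polarMap hp hNB
  obtain ⟨Φ, δ, hΦ, hxΦ, hΦN, hball, hsymm⟩ := exists_chart_of_injective_fderiv hp.isOpen hF
    (fun x hx => h.injective_fderiv_polarMap hp hNB hx) hxN
  have hΦB := hΦN.trans hNB
  have hsmooth : ContDiffOn ℝ ∞ Φ Φ.source := hΦ ▸ hF.mono hΦN
  have hfderiv (x) (hx : x ∈ Φ.source) := hΦ ▸ h.fderiv_polarMap hp hNB (hΦN hx)
  obtain ⟨a, ha⟩ := exists_eq_comp_coord (i := 3) hsmooth hsymm hball (h.smooth_A.mono hΦB)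
    (b := b) fun x hx V => by rw [hfderiv x hx]; exact h.fderiv_A x (hΦB hx) V
  refine ⟨Φ, a, hxΦ, hΦB, ?_, fun x hx =>
    ⟨hΦ ▸ h.fderiv_polarMap_time hp hNB (hΦN hx), (ha x hx).2⟩⟩
  have htarget {P : Coord → Prop} (hP : ∀ x ∈ Φ.source, P (Φ x)) : ∀ z ∈ Φ.target, P z :=
    fun z hz => Φ.right_inv hz ▸ hP _ (Φ.map_target hz)
  exact
    { smooth := hsmooth
      smooth_symm := hsymm
      smooth_a := htarget fun x hx => (ha x hx).1
      a_pos := htarget fun x hx => (ha x hx).2.1 ▸ h.A_pos x (hΦB hx)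
      r_range := htarget fun x hx =>
        hΦ ▸ ⟨(hp.r_range x (hΦN hx)).1, fun _ => (hp.r_range x (hΦN hx)).2⟩
      φ_range := htarget fun x hx => hΦ ▸ hp.φ_range x (hΦN hx)
      isometry := fun x hx V W => by
        rw [rwInner, (ha x hx).2.1, hfderiv x hx, hfderiv x hx, hΦ]
        exact h.inner_eq_polar hp hNB (hΦN hx) V W }

lemma translate : IsCartesianRobertsonWalker g k B
    ![y 0, fun x => rwSigma k 1 * (1 - k * T x) + rwCos k 1 * y 1 x, y 2]
    (fun x => rwHeight k 1 + rwCos k 1 * T x + rwSigma k 1 * y 1 x) t A b u := by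
  have hcos := rwCos_sq_add h.curvature_sign 1
  have hT {x} (hx : x ∈ B) := (differentiableAt_of_smoothOn h.isOpen h.smooth_T hx).hasFDerivAt
  have hy {x} (hx : x ∈ B) :=
    (differentiableAt_of_smoothOn h.isOpen (h.smooth_y 1) hx).hasFDerivAt
  refine { h with smooth_y := ?_, smooth_T := ?_, model := fun x hx => ?_, metric := ?_ }
  · intro i
    fin_cases i
    exacts [h.smooth_y 0, (contDiffOn_const.mul (contDiffOn_const.sub
      (contDiffOn_const.mul h.smooth_T))).add (contDiffOn_const.mul (h.smooth_y 1)), h.smooth_y 2]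
  · exact (contDiffOn_const.add (contDiffOn_const.mul h.smooth_T)).add
      (contDiffOn_const.mul (h.smooth_y 1))
  · simp only [Matrix.cons_val]
    linear_combination h.model x hx + (y 1 x ^ 2 + k * T x ^ 2 - 2 * T x) * hcos
      + rwSigma_sq_add h.curvature_sign 1
      + (2 * rwSigma k 1 * y 1 x + 2 * rwCos k 1 * T x) * rwCos_eq_one_sub h.curvature_sign 1
  · intro x hx V W
    rw [h.metric x hx, Fin.sum_univ_three, Fin.sum_univ_three]
    simp only [Matrix.cons_val]
    rw [((((((hT hx).const_mul (k : ℝ)).const_sub 1).const_mul _).fun_add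
        ((hy hx).const_mul _))).fderiv,
      ((((hT hx).const_mul _).const_add _).fun_add ((hy hx).const_mul _)).fderiv]
    simp only [add_apply, smul_apply, neg_apply, smul_eq_mul]
    linear_combination (-A x ^ 2 * (fderiv ℝ (y 1) x V * fderiv ℝ (y 1) x W
      + k * fderiv ℝ T x V * fderiv ℝ T x W)) * hcos

lemma exists_isRobertsonWalkerChart {x₀ : Coord} (hx₀ : x₀ ∈ B) (hy₀ : y 1 x₀ = 0)
    (hT₀ : T x₀ = 0) :
    ∃ (Φ : OpenPartialHomeomorph Coord Coord) (a : ℝ → ℝ), x₀ ∈ Φ.source ∧ Φ.source ⊆ B ∧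
      IsRobertsonWalkerChart g k a Φ ∧ ∀ x ∈ Φ.source, fderiv ℝ Φ x (u x) = Pi.single 3 1 ∧
        a (Φ x 3) = A x ∧ deriv a (Φ x 3) = b x :=
  h.translate.exists_chart_of_height_eq hx₀ (by simpa [hy₀, hT₀] using rwSigma_one_pos k)
    (by simp [hy₀, hT₀])

end IsCartesianRobertsonWalker

/-! ### Robertson–Walker coordinates from the time axis -/

section Calculus

variable {E : Type*} [NormedAddCommGroup E] [NormedSpace ℝ E]

lemma fderiv_smul_add_smul {F : Type*} [NormedAddCommGroup F] [NormedSpace ℝ F] {f g : E → ℝ}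
    {G H : E → F} {x : E} (hf : DifferentiableAt ℝ f x) (hG : DifferentiableAt ℝ G x)
    (hg : DifferentiableAt ℝ g x) (hH : DifferentiableAt ℝ H x) (V : E) :
    fderiv ℝ (fun z => f z • G z + g z • H z) x V =
      f x • fderiv ℝ G x V + fderiv ℝ f x V • G x
        + (g x • fderiv ℝ H x V + fderiv ℝ g x V • H x) := by
  rw [((hf.hasFDerivAt.fun_smul hG.hasFDerivAt).fun_add
    (hg.hasFDerivAt.fun_smul hH.hasFDerivAt)).fderiv]
  simp

lemma exists_contDiffOn_fderiv_eq {B : Set E} (hB : IsOpen B) (hBc : Convex ℝ B)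
    {L : E → E →L[ℝ] ℝ} (hL : ContDiffOn ℝ ∞ L B)
    (hsymm : ∀ x ∈ B, ∀ V W, fderiv ℝ L x V W = fderiv ℝ L x W V) :
    ∃ t : E → ℝ, ContDiffOn ℝ ∞ t B ∧ ∀ x ∈ B, fderiv ℝ t x = L x := by
  obtain ⟨t, ht⟩ := hBc.exists_forall_hasFDerivAt_of_fderiv_symmetric hB
    (hL.differentiableOn (by simp)) hsymm
  have hfderiv (x) (hx : x ∈ B) : fderiv ℝ t x = L x := (ht x hx).fderiv
  refine ⟨t, (contDiffOn_infty_iff_fderiv_of_isOpen hB).2 ⟨fun x hx => ?_, hL.congr hfderiv⟩,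
    hfderiv⟩
  exact (ht x hx).differentiableAt.differentiableWithinAt

-- The height is `k - s` on the quadric for `k ≠ 0` and `|y|² / 2` on the paraboloid for `k = 0`.
lemma exists_height {ε : ℝ} {k : ℤ} (hε : ε * ε = 1) (hk : k = 1 ∨ k = 0 ∨ k = -1) {B : Set E}
    {y : Fin 3 → E → ℝ} {s : E → ℝ} (hy : ∀ i, ContDiffOn ℝ ∞ (y i) B)
    (hs : ContDiffOn ℝ ∞ s B) {x₀ : E} (hy₀ : ∀ i, y i x₀ = 0) (hs₀ : s x₀ = k)
    {σ : E → E → ℝ} (hds : ∀ x ∈ B, ∀ V, fderiv ℝ s x V = -(ε * k) * σ x V)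
    (hquadric : ∀ x ∈ B, k ^ 2 * (y 0 x ^ 2 + y 1 x ^ 2 + y 2 x ^ 2) + k * s x ^ 2 = k) :
    ∃ T : E → ℝ, ContDiffOn ℝ ∞ T B ∧ T x₀ = 0 ∧
      (∀ x ∈ B, ∀ V W, k * (fderiv ℝ T x V * fderiv ℝ T x W) = k * (σ x V * σ x W)) ∧
      ∀ x ∈ B, y 0 x ^ 2 + y 1 x ^ 2 + y 2 x ^ 2 + k * T x ^ 2 = 2 * T x := by
  rcases eq_or_ne k 0 with rfl | hk0
  · refine ⟨fun x => (y 0 x ^ 2 + y 1 x ^ 2 + y 2 x ^ 2) * 2⁻¹, ?_, by simp [hy₀], by simp,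
      fun x _ => by push_cast; ring⟩
    exact ((((hy 0).pow 2).add ((hy 1).pow 2)).add ((hy 2).pow 2)).mul contDiffOn_const
  have hkk : (k : ℝ) ^ 2 = 1 := by
    rcases hk with rfl | rfl | rfl
    exacts [by norm_num, absurd rfl hk0, by norm_num]
  refine ⟨fun x => k - s x, contDiffOn_const.sub hs, by simp [hs₀], fun x hx V W => ?_,
    fun x hx => ?_⟩
  · simp only [fderiv_const_sub, neg_apply, hds x hx]
    linear_combination (k ^ 3 * (σ x V * σ x W)) * hε + (k * (σ x V * σ x W)) * hkk
  · linear_combination hquadric x hx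
      + (k - 2 * s x - (y 0 x ^ 2 + y 1 x ^ 2 + y 2 x ^ 2)) * hkk

end Calculus

/-- The structure equations of a hypersurface `X` of principal curvatures `cA²` on the orthogonal
complement of a unit timelike field with ambient image `N` and `3cA²` along it, in terms of a scale
factor `A` with time derivative `b`. -/
structure CosmologicalFrame (ε : ℝ) (k : ℤ) (c : ℝ) (B : Set Coord) (X N ξ : Coord → Ambient)
    (A b : Coord → ℝ) : Prop where
  sq_sign : ε * ε = 1
  curvature_sign : k = 1 ∨ k = 0 ∨ k = -1
  scale_ne_zero : c ≠ 0
  isOpen : IsOpen B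
  smooth_X : ContDiffOn ℝ ∞ X B
  smooth_N : ContDiffOn ℝ ∞ N B
  smooth_ξ : ContDiffOn ℝ ∞ ξ B
  smooth_A : ContDiffOn ℝ ∞ A B
  smooth_b : ContDiffOn ℝ ∞ b B
  A_pos : ∀ x ∈ B, 0 < A x
  unit_time : ∀ x ∈ B, eta ε (N x) (N x) = -1
  unit_normal : ∀ x ∈ B, eta ε (ξ x) (ξ x) = ε
  time_normal : ∀ x ∈ B, eta ε (N x) (ξ x) = 0
  normal : ∀ x ∈ B, ∀ V, eta ε (fderiv ℝ X x V) (ξ x) = 0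
  fderiv_N : ∀ x ∈ B, ∀ V, fderiv ℝ N x V =
    (b x * (A x)⁻¹) • (fderiv ℝ X x V - timeForm ε X N x V • N x)
      - (3 * ε * c * A x ^ 2 * timeForm ε X N x V) • ξ x
  fderiv_ξ : ∀ x ∈ B, ∀ V, fderiv ℝ ξ x V =
    -((c * A x ^ 2) • fderiv ℝ X x V) - (2 * c * A x ^ 2 * timeForm ε X N x V) • N x
  fderiv_A : ∀ x ∈ B, ∀ V, fderiv ℝ A x V = b x * timeForm ε X N x V
  fderiv_b : ∀ x ∈ B, ∀ V, fderiv ℝ b x V = 3 * ε * c ^ 2 * A x ^ 5 * timeForm ε X N x V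
  friedmann : ∀ x ∈ B, b x ^ 2 = ε * c ^ 2 * A x ^ 6 - k

/-- The spatial part of `dX`, rescaled by the scale factor. -/
def spatialForm (ε : ℝ) (X N : Coord → Ambient) (A : Coord → ℝ) (x V : Coord) : Ambient :=
  (A x)⁻¹ • (fderiv ℝ X x V - timeForm ε X N x V • N x)

/-- A constant vector of `E₅`: the time slices lie in the hyperplanes orthogonal to it. -/
def axis (c : ℝ) (N ξ : Coord → Ambient) (A b : Coord → ℝ) (x : Coord) : Ambient :=
  (c * A x ^ 3) • N x + b x • ξ x

/-- The projection of the normal to the orthogonal complement of the axis: for `k ≠ 0` it maps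
each time slice homothetically to the unit quadric `η(Y, Y) = k`. -/
def sliceNormal (ε c : ℝ) (N ξ : Coord → Ambient) (A b : Coord → ℝ) (x : Coord) : Ambient :=
  (ε * b x) • N x + (c * A x ^ 3) • ξ x

/-- The normal rescaled so that its differential is the spatial form modulo the axis; unlike the
slice normal it gives spatial coordinates for every `k`. -/
def scaledNormal (c : ℝ) (ξ : Coord → Ambient) (A : Coord → ℝ) (x : Coord) : Ambient :=
  (-(c * A x ^ 3)⁻¹) • ξ x

namespace CosmologicalFrame

variable {ε : ℝ} {k : ℤ} {c : ℝ} {B : Set Coord} {X N ξ : Coord → Ambient} {A b : Coord → ℝ}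
  (h : CosmologicalFrame ε k c B X N ξ A b)
include h

lemma mono {B' : Set Coord} (hB' : IsOpen B') (hBB' : B' ⊆ B) :
    CosmologicalFrame ε k c B' X N ξ A b where
  sq_sign := h.sq_sign
  curvature_sign := h.curvature_sign
  scale_ne_zero := h.scale_ne_zero
  isOpen := hB'
  smooth_X := h.smooth_X.mono hBB'
  smooth_N := h.smooth_N.mono hBB'
  smooth_ξ := h.smooth_ξ.mono hBB'
  smooth_A := h.smooth_A.mono hBB'
  smooth_b := h.smooth_b.mono hBB'
  A_pos x hx := h.A_pos x (hBB' hx)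
  unit_time x hx := h.unit_time x (hBB' hx)
  unit_normal x hx := h.unit_normal x (hBB' hx)
  time_normal x hx := h.time_normal x (hBB' hx)
  normal x hx := h.normal x (hBB' hx)
  fderiv_N x hx := h.fderiv_N x (hBB' hx)
  fderiv_ξ x hx := h.fderiv_ξ x (hBB' hx)
  fderiv_A x hx := h.fderiv_A x (hBB' hx)
  fderiv_b x hx := h.fderiv_b x (hBB' hx)
  friedmann x hx := h.friedmann x (hBB' hx)

lemma smooth_axisCoeff : ContDiffOn ℝ ∞ (fun x => c * A x ^ 3) B :=
  contDiffOn_const.mul (h.smooth_A.pow 3)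

lemma smooth_axis : ContDiffOn ℝ ∞ (axis c N ξ A b) B :=
  (h.smooth_axisCoeff.smul h.smooth_N).add (h.smooth_b.smul h.smooth_ξ)

lemma smooth_sliceNormal : ContDiffOn ℝ ∞ (sliceNormal ε c N ξ A b) B :=
  ((contDiffOn_const.mul h.smooth_b).smul h.smooth_N).add (h.smooth_axisCoeff.smul h.smooth_ξ)

section Pointwise

variable {x : Coord} (hx : x ∈ B)
include hx

lemma axisCoeff_ne_zero : c * A x ^ 3 ≠ 0 :=
  mul_ne_zero h.scale_ne_zero (pow_ne_zero 3 (h.A_pos x hx).ne')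

lemma fderiv_axisCoeff (V : Coord) :
    fderiv ℝ (fun z => c * A z ^ 3) x V = 3 * c * A x ^ 2 * b x * timeForm ε X N x V := by
  have hA := (differentiableAt_of_smoothOn h.isOpen h.smooth_A hx).hasFDerivAt
  have hA3 := ((hA.pow 3).const_mul c).fderiv
  refine (DFunLike.congr_fun hA3 V).trans ?_
  simp only [smul_apply, smul_eq_mul, nsmul_eq_mul, h.fderiv_A x hx]
  push_cast
  ring

lemma fderiv_N_eq (V : Coord) : fderiv ℝ N x V =
    b x • spatialForm ε X N A x V - (3 * ε * c * A x ^ 2 * timeForm ε X N x V) • ξ x := by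
  rw [h.fderiv_N x hx, spatialForm, smul_smul]

lemma fderiv_ξ_eq (V : Coord) : fderiv ℝ ξ x V =
    -((c * A x ^ 3) • spatialForm ε X N A x V)
      - (3 * c * A x ^ 2 * timeForm ε X N x V) • N x := by
  have hA : c * A x ^ 3 * (A x)⁻¹ = c * A x ^ 2 := by
    have := (h.A_pos x hx).ne'
    field_simp
  rw [h.fderiv_ξ x hx, spatialForm, smul_smul, hA]
  module

lemma fderiv_axis (V : Coord) : fderiv ℝ (axis c N ξ A b) x V = 0 := by
  have hd {F : Type} [NormedAddCommGroup F] [NormedSpace ℝ F] {f : Coord → F}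
    (hf : ContDiffOn ℝ ∞ f B) := differentiableAt_of_smoothOn h.isOpen hf hx
  have haxis := fderiv_smul_add_smul (hd h.smooth_axisCoeff) (hd h.smooth_N) (hd h.smooth_b)
    (hd h.smooth_ξ) V
  rw [h.fderiv_axisCoeff hx, h.fderiv_b x hx, h.fderiv_N_eq hx, h.fderiv_ξ_eq hx] at haxis
  refine haxis.trans ?_
  module

lemma fderiv_sliceNormal (V : Coord) :
    fderiv ℝ (sliceNormal ε c N ξ A b) x V = (-(ε * k)) • spatialForm ε X N A x V := by
  have hd {F : Type} [NormedAddCommGroup F] [NormedSpace ℝ F] {f : Coord → F}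
    (hf : ContDiffOn ℝ ∞ f B) := differentiableAt_of_smoothOn h.isOpen hf hx
  have hslice := fderiv_smul_add_smul (hd (contDiffOn_const (c := ε) |>.mul h.smooth_b))
    (hd h.smooth_N) (hd h.smooth_axisCoeff) (hd h.smooth_ξ) V
  rw [h.fderiv_axisCoeff hx, fderiv_const_mul_field, smul_apply, h.fderiv_b x hx,
    h.fderiv_N_eq hx, h.fderiv_ξ_eq hx] at hslice
  refine hslice.trans ?_
  match_scalars
  · linear_combination ε * h.friedmann x hx + (c ^ 2 * A x ^ 6) * h.sq_sign
  · linear_combination (-3 * c * A x ^ 2 * b x * timeForm ε X N x V) * h.sq_sign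
  · linear_combination (3 * c ^ 2 * A x ^ 5 * timeForm ε X N x V) * h.sq_sign

lemma fderiv_scaledNormal (V : Coord) :
    fderiv ℝ (scaledNormal c ξ A) x V = spatialForm ε X N A x V
      + (3 * timeForm ε X N x V * (c * A x ^ 4)⁻¹) • axis c N ξ A b x := by
  have hc := h.scale_ne_zero
  have hA := (h.A_pos x hx).ne'
  have hcA := h.axisCoeff_ne_zero hx
  have hm := (differentiableAt_of_smoothOn h.isOpen h.smooth_axisCoeff hx).hasFDerivAt
  have hξ := (differentiableAt_of_smoothOn h.isOpen h.smooth_ξ hx).hasFDerivAt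
  have hscaled := (((hasDerivAt_inv hcA).comp_hasFDerivAt x hm).neg.fun_smul hξ).fderiv
  refine (DFunLike.congr_fun hscaled V).trans ?_
  simp only [add_apply, smul_apply, neg_apply, ContinuousLinearMap.smulRight_apply, smul_eq_mul,
    Function.comp_apply, Pi.neg_apply, h.fderiv_axisCoeff hx, h.fderiv_ξ_eq hx, axis]
  match_scalars <;> field_simp

lemma eta_normal_time : eta ε (ξ x) (N x) = 0 := by
  rw [eta_comm, h.time_normal x hx]

lemma eta_spatialForm_axis (V : Coord) :
    eta ε (spatialForm ε X N A x V) (axis c N ξ A b x) = 0 := by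
  simp only [spatialForm, axis, eta_smul_left, eta_sub_left, eta_add_right, eta_smul_right,
    h.unit_time x hx, h.time_normal x hx, h.normal x hx, timeForm_apply]
  ring

lemma eta_spatialForm (V W : Coord) :
    A x ^ 2 * eta ε (spatialForm ε X N A x V) (spatialForm ε X N A x W) =
      (inducedMetric ε X).inner x V W + timeForm ε X N x V * timeForm ε X N x W := by
  have hA := (h.A_pos x hx).ne'
  simp only [spatialForm, eta_smul_left, eta_sub_left, eta_sub_right, eta_smul_right,
    h.unit_time x hx, inducedMetric_inner, timeForm_apply, eta_comm ε (N x) (fderiv ℝ X x W)]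
  field_simp
  ring

lemma eta_sliceNormal_axis : eta ε (sliceNormal ε c N ξ A b x) (axis c N ξ A b x) = 0 := by
  simp only [sliceNormal, axis, eta_smul_left, eta_add_left, eta_add_right, eta_smul_right,
    h.unit_time x hx, h.time_normal x hx, h.eta_normal_time hx, h.unit_normal x hx]
  ring

lemma eta_sliceNormal_self :
    eta ε (sliceNormal ε c N ξ A b x) (sliceNormal ε c N ξ A b x) = k := by
  simp only [sliceNormal, eta_smul_left, eta_add_left, eta_add_right, eta_smul_right,
    h.unit_time x hx, h.time_normal x hx, h.eta_normal_time hx, h.unit_normal x hx]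
  linear_combination (-b x ^ 2) * h.sq_sign - h.friedmann x hx

lemma sliceNormal_eq : sliceNormal ε c N ξ A b x =
    (ε * b x * (c * A x ^ 3)⁻¹) • axis c N ξ A b x - (ε * k) • scaledNormal c ξ A x := by
  obtain ⟨m, hm⟩ : ∃ m, m = c * A x ^ 3 := ⟨_, rfl⟩
  have hm0 : m ≠ 0 := hm ▸ h.axisCoeff_ne_zero hx
  have hfriedmann : m ^ 2 = ε * b x ^ 2 + ε * k := by
    linear_combination (m + c * A x ^ 3) * hm - ε * h.friedmann x hx
      - (c ^ 2 * A x ^ 6) * h.sq_sign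
  rw [sliceNormal, axis, scaledNormal, ← hm]
  match_scalars
  · field_simp
  · field_simp
    linear_combination hfriedmann

lemma timeForm_symm (V W : Coord) :
    fderiv ℝ (timeForm ε X N) x V W = fderiv ℝ (timeForm ε X N) x W V := by
  have hX := contDiffAt_of_smoothOn h.isOpen h.smooth_X hx 2
  have hτ := differentiableAt_of_smoothOn h.isOpen
    (smoothOn_timeForm h.isOpen h.smooth_X h.smooth_N (ε := ε)) hx
  have happly (V W : Coord) : fderiv ℝ (timeForm ε X N) x V W =
      -(eta ε (fderiv ℝ (fun y => fderiv ℝ X y W) x V) (N x)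
        + eta ε (fderiv ℝ X x W) (fderiv ℝ N x V)) := by
    rw [← fderiv_eta (differentiableAt_of_smoothOn h.isOpen
        (smoothOn_fderiv_apply h.isOpen h.smooth_X contDiffOn_const) hx)
      (differentiableAt_of_smoothOn h.isOpen h.smooth_N hx), ← neg_apply, ← fderiv_fun_neg]
    simp only [← timeForm_apply]
    rw [fderiv_clm_apply hτ (differentiableAt_const W)]
    simp
  rw [happly, happly, fderiv_fderiv_comm hX, h.fderiv_N x hx, h.fderiv_N x hx]
  simp only [eta_sub_right, eta_smul_right, timeForm_apply, h.normal x hx]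
  rw [eta_comm ε (fderiv ℝ X x W) (fderiv ℝ X x V)]
  ring

end Pointwise

lemma exists_time (hBc : Convex ℝ B) :
    ∃ t : Coord → ℝ, ContDiffOn ℝ ∞ t B ∧ ∀ x ∈ B, fderiv ℝ t x = timeForm ε X N x :=
  exists_contDiffOn_fderiv_eq h.isOpen hBc
    (smoothOn_timeForm h.isOpen h.smooth_X h.smooth_N) fun _ hx => h.timeForm_symm hx

lemma axis_eq (hBc : IsPreconnected B) {x x₀ : Coord} (hx : x ∈ B) (hx₀ : x₀ ∈ B) :
    axis c N ξ A b x = axis c N ξ A b x₀ :=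
  h.isOpen.is_const_of_fderiv_eq_zero hBc (h.smooth_axis.differentiableOn (by simp))
    (fun _ hz => ContinuousLinearMap.ext fun V => h.fderiv_axis hz V) hx hx₀

end CosmologicalFrame

/-- The spacelike vectors `f` complete the unit timelike vector `n` and the unit vector `m` to an
orthonormal basis of `E₅`, with completeness expressed through the scalar product. -/
structure IsSpatialComplement (ε : ℝ) (n m : Ambient) (f : Fin 3 → Ambient) : Prop where
  eta_time : ∀ i, eta ε n (f i) = 0
  eta_normal : ∀ i, eta ε m (f i) = 0
  eta_eq : ∀ C D, eta ε C D =
    ∑ i, eta ε C (f i) * eta ε D (f i) - eta ε C n * eta ε D n + ε * (eta ε C m * eta ε D m)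

lemma IsSpatialComplement.eta_axis {ε c : ℝ} {N ξ : Coord → Ambient} {A b : Coord → ℝ} {x : Coord}
    {f : Fin 3 → Ambient} (hf : IsSpatialComplement ε (N x) (ξ x) f) (i : Fin 3) :
    eta ε (axis c N ξ A b x) (f i) = 0 := by
  rw [axis, eta_add_left, eta_smul_left, eta_smul_left, hf.eta_time, hf.eta_normal]
  ring

namespace CosmologicalFrame

variable {ε : ℝ} {k : ℤ} {c : ℝ} {B : Set Coord} {X N ξ : Coord → Ambient} {A b : Coord → ℝ}
  (h : CosmologicalFrame ε k c B X N ξ A b)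
include h

lemma smooth_scaledNormal : ContDiffOn ℝ ∞ (scaledNormal c ξ A) B :=
  (h.smooth_axisCoeff.inv fun _ hx => h.axisCoeff_ne_zero hx).neg.smul h.smooth_ξ

lemma eta_time_normal_eq {x : Coord} (hx : x ∈ B) {C D : Ambient}
    (hC : eta ε C (axis c N ξ A b x) = 0) (hD : eta ε D (axis c N ξ A b x) = 0) :
    -(eta ε C (N x) * eta ε D (N x)) + ε * (eta ε C (ξ x) * eta ε D (ξ x)) =
      k * (eta ε C (sliceNormal ε c N ξ A b x) * eta ε D (sliceNormal ε c N ξ A b x)) := by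
  have hk : (k : ℝ) ^ 3 = k := by rcases h.curvature_sign with h0 | h0 | h0 <;> rw [h0] <;> norm_num
  have hm := h.axisCoeff_ne_zero hx
  -- Orthogonality to the axis leaves one parameter for the components along `N` and `ξ`.
  have hparam {C : Ambient} (hC : eta ε C (axis c N ξ A b x) = 0) :
      ∃ s, eta ε C (N x) = -(b x * s) ∧ eta ε C (ξ x) = c * A x ^ 3 * s ∧
        eta ε C (sliceNormal ε c N ξ A b x) = ε * k * s := by
    simp only [axis, eta_add_right, eta_smul_right] at hC
    obtain ⟨s, hs⟩ : ∃ s, eta ε C (ξ x) = c * A x ^ 3 * s :=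
      ⟨(c * A x ^ 3)⁻¹ * eta ε C (ξ x), (mul_inv_cancel_left₀ hm _).symm⟩
    have hN : eta ε C (N x) = -(b x * s) := mul_left_cancel₀ hm (by rw [hs] at hC; linarith)
    refine ⟨s, hN, hs, ?_⟩
    simp only [sliceNormal, eta_add_right, eta_smul_right, hN, hs]
    linear_combination (-ε * s) * h.friedmann x hx - (s * c ^ 2 * A x ^ 6) * h.sq_sign
  obtain ⟨s, hCN, hCξ, hCY⟩ := hparam hC
  obtain ⟨s', hDN, hDξ, hDY⟩ := hparam hD
  rw [hCN, hCξ, hCY, hDN, hDξ, hDY]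
  linear_combination (-s * s') * h.friedmann x hx - (k ^ 3 * s * s') * h.sq_sign - s * s' * hk

section Coordinates

variable {x₀ : Coord} (hx₀ : x₀ ∈ B) {f : Fin 3 → Ambient}
  (hf : IsSpatialComplement ε (N x₀) (ξ x₀) f)
include hx₀ hf

lemma eta_eq_sum_of_axis {C D : Ambient} (hC : eta ε C (axis c N ξ A b x₀) = 0)
    (hD : eta ε D (axis c N ξ A b x₀) = 0) :
    eta ε C D = ∑ i, eta ε C (f i) * eta ε D (f i)
      + k * (eta ε C (sliceNormal ε c N ξ A b x₀) * eta ε D (sliceNormal ε c N ξ A b x₀)) := by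
  rw [← h.eta_time_normal_eq hx₀ hC hD, hf.eta_eq]
  ring

variable (hBc : Convex ℝ B)
include hBc

lemma fderiv_spatialCoord {x : Coord} (hx : x ∈ B) (i : Fin 3) (V : Coord) :
    fderiv ℝ (fun z => eta ε (scaledNormal c ξ A z) (f i)) x V =
      eta ε (spatialForm ε X N A x V) (f i) := by
  rw [fderiv_eta_const (differentiableAt_of_smoothOn h.isOpen h.smooth_scaledNormal hx),
    h.fderiv_scaledNormal hx, h.axis_eq hBc.isPreconnected hx hx₀, eta_add_left, eta_smul_left,
    hf.eta_axis, mul_zero, add_zero]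

lemma eta_sliceNormal_spatial {x : Coord} (hx : x ∈ B) (i : Fin 3) :
    eta ε (sliceNormal ε c N ξ A b x) (f i) = -(ε * k * eta ε (scaledNormal c ξ A x) (f i)) := by
  rw [h.sliceNormal_eq hx, h.axis_eq hBc.isPreconnected hx hx₀, eta_sub_left, eta_smul_left,
    eta_smul_left, hf.eta_axis]
  ring

lemma exists_slice_height :
    ∃ T : Coord → ℝ, ContDiffOn ℝ ∞ T B ∧ T x₀ = 0 ∧
      (∀ x ∈ B, ∀ V W, k * (fderiv ℝ T x V * fderiv ℝ T x W) =
        k * (eta ε (spatialForm ε X N A x V) (sliceNormal ε c N ξ A b x₀) *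
          eta ε (spatialForm ε X N A x W) (sliceNormal ε c N ξ A b x₀))) ∧
      ∀ x ∈ B, eta ε (scaledNormal c ξ A x) (f 0) ^ 2 + eta ε (scaledNormal c ξ A x) (f 1) ^ 2
        + eta ε (scaledNormal c ξ A x) (f 2) ^ 2 + k * T x ^ 2 = 2 * T x := by
  refine exists_height (y := fun i z => eta ε (scaledNormal c ξ A z) (f i))
    (s := fun z => eta ε (sliceNormal ε c N ξ A b z) (sliceNormal ε c N ξ A b x₀))
    (σ := fun x V => eta ε (spatialForm ε X N A x V) (sliceNormal ε c N ξ A b x₀))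
    h.sq_sign h.curvature_sign (fun i => contDiffOn_eta h.smooth_scaledNormal contDiffOn_const ε)
    (contDiffOn_eta h.smooth_sliceNormal contDiffOn_const ε) (fun i => ?_)
    (h.eta_sliceNormal_self hx₀) (fun x hx V => ?_) (fun x hx => ?_)
  · rw [scaledNormal, eta_smul_left, hf.eta_normal, mul_zero]
  · rw [fderiv_eta_const (differentiableAt_of_smoothOn h.isOpen h.smooth_sliceNormal hx),
      h.fderiv_sliceNormal hx, eta_smul_left]
  · have hY := h.axis_eq hBc.isPreconnected hx hx₀ ▸ h.eta_sliceNormal_axis hx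
    have hquadric := h.eta_eq_sum_of_axis hx₀ hf hY hY
    rw [h.eta_sliceNormal_self hx, Fin.sum_univ_three] at hquadric
    simp only [h.eta_sliceNormal_spatial hx₀ hf hBc hx] at hquadric
    linear_combination -hquadric - (k ^ 2 * (eta ε (scaledNormal c ξ A x) (f 0) ^ 2
      + eta ε (scaledNormal c ξ A x) (f 1) ^ 2
      + eta ε (scaledNormal c ξ A x) (f 2) ^ 2)) * h.sq_sign

lemma exists_isCartesianRobertsonWalker {u : Coord → Coord}
    (hu : ∀ x ∈ B, fderiv ℝ X x (u x) = N x)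
    (hnd : ∀ x ∈ B, ∀ V, (∀ W, (inducedMetric ε X).inner x V W = 0) → V = 0) :
    ∃ (y : Fin 3 → Coord → ℝ) (T t : Coord → ℝ),
      IsCartesianRobertsonWalker (inducedMetric ε X) k B y T t A b u ∧
        y 1 x₀ = 0 ∧ T x₀ = 0 := by
  obtain ⟨t, ht, hdt⟩ := h.exists_time hBc
  obtain ⟨T, hT, hT₀, hdT, hmodel⟩ := h.exists_slice_height hx₀ hf hBc
  refine ⟨fun i z => eta ε (scaledNormal c ξ A z) (f i), T, t, ?_,
    by simp only [scaledNormal, eta_smul_left, hf.eta_normal, mul_zero], hT₀⟩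
  exact
    { curvature_sign := h.curvature_sign
      isOpen := h.isOpen
      smooth_y := fun i => contDiffOn_eta h.smooth_scaledNormal contDiffOn_const ε
      smooth_T := hT
      smooth_t := ht
      smooth_A := h.smooth_A
      A_pos := h.A_pos
      model := hmodel
      metric := fun x hx V W => by
        have hβ (V) := h.axis_eq hBc.isPreconnected hx hx₀ ▸ h.eta_spatialForm_axis hx V
        simp only [h.fderiv_spatialCoord hx₀ hf hBc hx, hdT x hx, hdt x hx]
        rw [← h.eta_eq_sum_of_axis hx₀ hf (hβ V) (hβ W), h.eta_spatialForm hx]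
        ring
      nondegenerate := hnd
      fderiv_A := fun x hx V => by rw [h.fderiv_A x hx, hdt x hx]
      unit_timelike := fun x hx => by rw [inducedMetric_inner, hu x hx, h.unit_time x hx]
      fderiv_t := fun x hx => by rw [hdt x hx, timeForm_apply, hu x hx, h.unit_time x hx, neg_neg] }

end Coordinates

end CosmologicalFrame

namespace PrincipalFrame

variable {ε : ℝ} {U : Set Coord} {X ξ : Coord → Ambient} {e : Fin 4 → Coord → Coord}
  {κ : Fin 4 → Coord → ℝ} (h : PrincipalFrame ε U X ξ e κ) {x : Coord} (hx : x ∈ U)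
include h hx

lemma inducedMetric_nondegenerate {V : Coord}
    (hV : ∀ W, (inducedMetric ε X).inner x V W = 0) : V = 0 := by
  simp only [inducedMetric_inner] at hV
  rw [h.tangent_eq_sum hx V]
  simp [pushFrame, hV]

lemma isSpatialComplement : IsSpatialComplement ε (pushFrame X e 3 x) (ξ x)
    (fun i => pushFrame X e i.castSucc x) where
  eta_time i := by exact (h.eta_pushFrame hx 3 _).trans (if_neg (Fin.castSucc_lt_last i).ne')
  eta_normal i := h.eta_normal_left hx _
  eta_eq C D := by
    rw [h.eta_eq_sum hx C D, Fin.sum_univ_castSucc]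
    simp only [Fin.reduceLast, tetradSign_three, one_mul,
      tetradSign_of_ne_three (Fin.castSucc_lt_last _).ne]
    ring

end PrincipalFrame

lemma mul_pos_of_forall_ne_zero {E : Type*} [TopologicalSpace E] {U : Set E} {f : E → ℝ}
    (hU : IsPreconnected U) (hf : ContinuousOn f U) (hne : ∀ x ∈ U, f x ≠ 0) {x y : E}
    (hx : x ∈ U) (hy : y ∈ U) : 0 < f x * f y := by
  by_contra! hneg
  obtain ⟨z, hz, hz0⟩ := hU.intermediate_value hx hy (hf.mul (continuousOn_const (c := f y)))
    ⟨hneg, mul_self_nonneg _⟩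
  exact mul_ne_zero (hne z hz) (hne y hy) hz0

lemma exists_sign_eq_div (J : ℝ) {l : ℝ} (hl : l ≠ 0) :
    ∃ k : ℤ, (k = 1 ∨ k = 0 ∨ k = -1) ∧ ∃ c : ℝ, c ≠ 0 ∧ 0 < c * l ∧ J / c = k := by
  rcases lt_trichotomy 0 (J * l) with hs | hs | hs
  · have hJ : J ≠ 0 := left_ne_zero_of_mul hs.ne'
    exact ⟨1, by simp, J, hJ, hs, by simp [hJ]⟩
  · have hJ : J = 0 := (mul_eq_zero.1 hs.symm).resolve_right hl
    exact ⟨0, by simp, l, hl, mul_self_pos.2 hl, by simp [hJ]⟩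
  · have hJ : J ≠ 0 := left_ne_zero_of_mul hs.ne
    exact ⟨-1, by simp, -J, neg_ne_zero.2 hJ, by linarith, by simp [hJ]⟩

/-- The scale factor `√(l / c)` of a Robertson–Walker metric, in terms of the principal curvature
`l = c a²`. -/
def scaleFactor (c : ℝ) (l : Coord → ℝ) (x : Coord) : ℝ := √(l x / c)

lemma scaleFactor_sq {c : ℝ} {l : Coord → ℝ} {x : Coord} (hl : 0 ≤ l x / c) :
    scaleFactor c l x ^ 2 = l x / c :=
  Real.sq_sqrt hl

lemma curvature_eq_scaleFactor {c : ℝ} (hc : c ≠ 0) {l : Coord → ℝ} {x : Coord}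
    (hl : 0 ≤ l x / c) : l x = c * scaleFactor c l x ^ 2 := by
  rw [scaleFactor_sq hl, mul_div_cancel₀ _ hc]

namespace QuasiUmbilicFrame

variable {ε : ℝ} {U : Set Coord} {X ξ : Coord → Ambient} {e : Fin 4 → Coord → Coord}
  {κ : Fin 4 → Coord → ℝ} (h : QuasiUmbilicFrame ε U X ξ e κ) (hne : ∀ x ∈ U, κ 0 x ≠ 0)
include h hne

lemma friedmann_invariant (hUc : IsPreconnected U) {x y : Coord} (hx : x ∈ U) (hy : y ∈ U) :
    (ε * κ 0 x ^ 2 - hubbleRate ε X e x ^ 2) * κ 0 x =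
      (ε * κ 0 y ^ 2 - hubbleRate ε X e y ^ 2) * κ 0 y := by
  have hθ := h.smooth_connCoeff 0 3 0
  have hκ := h.smooth_curvature 0
  refine h.isOpen.is_const_of_fderiv_eq_zero hUc
    (f := fun z => (ε * κ 0 z ^ 2 - hubbleRate ε X e z ^ 2) * κ 0 z)
    ((((contDiffOn_const.mul (hκ.pow 2)).sub (hθ.pow 2)).mul hκ).differentiableOn (by simp))
    (fun z hz => ?_) hx hy
  have dκ := (differentiableAt_of_smoothOn h.isOpen hκ hz).hasFDerivAt
  have dθ := (differentiableAt_of_smoothOn h.isOpen hθ hz).hasFDerivAt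
  change HasFDerivAt (hubbleRate ε X e) (fderiv ℝ (hubbleRate ε X e) z) z at dθ
  rw [h.fderiv_curvature hz] at dκ
  rw [h.fderiv_hubbleRate hne hz] at dθ
  refine ((((dκ.pow 2).const_mul ε).sub (dθ.pow 2)).mul dκ).fderiv.trans ?_
  ext V
  simp only [smul_apply, add_apply, sub_apply, smul_eq_mul, nsmul_eq_mul]
  norm_num
  ring

/-- The constant `c` is normalised so that the spatial curvature `k` of the slices becomes a
sign. -/
lemma exists_curvature_constants (hUc : IsPreconnected U) :
    ∃ k : ℤ, (k = 1 ∨ k = 0 ∨ k = -1) ∧ ∃ c : ℝ, c ≠ 0 ∧ ∀ x ∈ U, 0 < κ 0 x / c ∧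
      (ε * κ 0 x ^ 2 - hubbleRate ε X e x ^ 2) * (κ 0 x / c) = k := by
  rcases U.eq_empty_or_nonempty with rfl | ⟨y, hy⟩
  · exact ⟨0, by simp, 1, one_ne_zero, by simp⟩
  obtain ⟨k, hk, c, hc, hcl, hJ⟩ := exists_sign_eq_div
    ((ε * κ 0 y ^ 2 - hubbleRate ε X e y ^ 2) * κ 0 y) (hne y hy)
  refine ⟨k, hk, c, hc, fun x hx => ⟨?_, ?_⟩⟩
  · have hsame := mul_pos_of_forall_ne_zero hUc (h.smooth_curvature 0).continuousOn hne hx hy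
    rw [div_pos_iff]
    rcases mul_pos_iff.1 hsame with hs | hs <;> rcases mul_pos_iff.1 hcl with ht | ht
    · exact Or.inl ⟨hs.1, ht.1⟩
    · exact absurd hs.2 ht.2.not_gt
    · exact absurd ht.2 hs.2.not_gt
    · exact Or.inr ⟨hs.1, ht.1⟩
  · rw [← mul_div_assoc, h.friedmann_invariant hne hUc hx hy, hJ]

omit hne
variable {k : ℤ} {c : ℝ} (hpos : ∀ x ∈ U, 0 < κ 0 x / c)
include hpos

lemma fderiv_scaleFactor {x : Coord} (hx : x ∈ U) :
    fderiv ℝ (scaleFactor c (κ 0)) x =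
      (hubbleRate ε X e x * scaleFactor c (κ 0) x) • timeForm ε X (pushFrame X e 3) x := by
  have dκ := (differentiableAt_of_smoothOn h.isOpen (h.smooth_curvature 0) hx).hasFDerivAt
  rw [h.fderiv_curvature hx] at dκ
  have dA := ((dκ.mul_const c⁻¹).sqrt (by simpa [div_eq_mul_inv] using (hpos x hx).ne')).fderiv
  simp only [← div_eq_mul_inv] at dA
  refine dA.trans ?_
  rw [smul_smul, smul_smul, smul_smul]
  congr 1
  have hA : √(κ 0 x / c) ≠ 0 := (Real.sqrt_pos.2 (hpos x hx)).ne'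
  have hsq := Real.sq_sqrt (hpos x hx).le
  rw [scaleFactor]
  field_simp
  rw [hsq]
  ring

variable (hc : c ≠ 0) (hk : k = 1 ∨ k = 0 ∨ k = -1)
  (hkc : ∀ x ∈ U, (ε * κ 0 x ^ 2 - hubbleRate ε X e x ^ 2) * (κ 0 x / c) = k)
include hne hc hk hkc

lemma cosmologicalFrame : CosmologicalFrame ε k c U X (pushFrame X e 3) ξ (scaleFactor c (κ 0))
    (fun x => hubbleRate ε X e x * scaleFactor c (κ 0) x) := by
  have hA : ContDiffOn ℝ ∞ (scaleFactor c (κ 0)) U :=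
    ((h.smooth_curvature 0).div_const c).sqrt fun x hx => (hpos x hx).ne'
  have hθ : ContDiffOn ℝ ∞ (hubbleRate ε X e) U := h.smooth_connCoeff 0 3 0
  have hA0 (x) (hx : x ∈ U) : 0 < scaleFactor c (κ 0) x := Real.sqrt_pos.2 (hpos x hx)
  have hκ (x) (hx : x ∈ U) := curvature_eq_scaleFactor hc (hpos x hx).le
  exact
    { sq_sign := h.sq_sign
      curvature_sign := hk
      scale_ne_zero := hc
      isOpen := h.isOpen
      smooth_X := h.smooth_X
      smooth_N := h.smooth_pushFrame 3
      smooth_ξ := h.smooth_ξ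
      smooth_A := hA
      smooth_b := hθ.mul hA
      A_pos := hA0
      unit_time := fun x hx => h.eta_pushFrame hx 3 3
      unit_normal := h.unit_normal
      time_normal := fun x hx => h.eta_pushFrame_normal hx 3
      normal := h.normal
      fderiv_N := fun x hx V => by
        rw [h.fderiv_time hne hx, mul_inv_cancel_right₀ (hA0 x hx).ne', hκ x hx]
        module
      fderiv_ξ := fun x hx V => by
        rw [h.fderiv_normal hx, hκ x hx, mul_assoc 2 c]
      fderiv_A := fun x hx V => by
        rw [h.fderiv_scaleFactor hpos hx]
        rfl
      fderiv_b := fun x hx V => by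
        rw [fderiv_fun_mul (differentiableAt_of_smoothOn h.isOpen hθ hx)
          (differentiableAt_of_smoothOn h.isOpen hA hx), h.fderiv_scaleFactor hpos hx,
          h.fderiv_hubbleRate hne hx, hκ x hx]
        simp only [add_apply, smul_apply, smul_eq_mul]
        ring
      friedmann := fun x hx => by
        rw [← hkc x hx, ← scaleFactor_sq (hpos x hx).le, hκ x hx]
        ring }

lemma exists_isRobertsonWalkerChart {x₀ : Coord} (hx₀ : x₀ ∈ U) :
    ∃ (Φ : OpenPartialHomeomorph Coord Coord) (a : ℝ → ℝ), x₀ ∈ Φ.source ∧ Φ.source ⊆ U ∧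
      IsRobertsonWalkerChart (inducedMetric ε X) k a Φ ∧ ∀ y ∈ Φ.source,
        fderiv ℝ Φ y (e 3 y) = Pi.single 3 1 ∧
        deriv a (Φ y 3) ^ 2 = ε * c ^ 2 * a (Φ y 3) ^ 6 - k ∧ κ 0 y = c * a (Φ y 3) ^ 2 := by
  obtain ⟨δ, hδ, hBU⟩ := Metric.isOpen_iff.1 h.isOpen x₀ hx₀
  have hC := (h.cosmologicalFrame hne hpos hc hk hkc).mono Metric.isOpen_ball hBU
  obtain ⟨y, T, t, hRW, hy₀, hT₀⟩ := hC.exists_isCartesianRobertsonWalker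
    (Metric.mem_ball_self hδ) (h.isSpatialComplement hx₀) (convex_ball x₀ δ) (u := e 3)
    (fun _ _ => rfl) fun x hx _ => h.inducedMetric_nondegenerate (hBU hx)
  obtain ⟨Φ, a, hx₀Φ, hΦB, hΦ, hΦa⟩ :=
    hRW.exists_isRobertsonWalkerChart (Metric.mem_ball_self hδ) hy₀ hT₀
  refine ⟨Φ, a, hx₀Φ, hΦB.trans hBU, hΦ, fun x hx => ?_⟩
  obtain ⟨hu, ha, hb⟩ := hΦa x hx
  refine ⟨hu, ?_, ?_⟩
  · rw [ha, hb, hC.friedmann x (hΦB hx)]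
  · rw [ha, ← curvature_eq_scaleFactor hc (hpos x (hBU (hΦB hx))).le]

end QuasiUmbilicFrame

lemma QuasiUmbilicFrame.isPerfectFluidAt_iff {ε : ℝ} {U : Set Coord} {X ξ : Coord → Ambient}
    {e : Fin 4 → Coord → Coord} {κ : Fin 4 → Coord → ℝ} (h : QuasiUmbilicFrame ε U X ξ e κ)
    {x : Coord} (hx : x ∈ U) (hne : κ 0 x ≠ 0) (K ρ p : ℝ) (V : Coord) :
    IsPerfectFluidAt (inducedMetric ε X) K ρ p V x ↔
      (K * ρ = 3 * ε * κ 0 x ^ 2 ∧ K * p = -7 * ε * κ 0 x ^ 2 ∧ (V = e 3 x ∨ V = -e 3 x)) :=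
  h.toPrincipalFrame.isPerfectFluidAt_iff hx rfl (h.spatial_curvature x hx 1 (by decide))
    (h.spatial_curvature x hx 2 (by decide)) (h.time_curvature x hx) hne K ρ p V

namespace IsIdealTetrad

variable {ε : ℝ} {U : Set Coord} {X ξ : Coord → Ambient} {w v q u : Coord → Coord}
  {μ lam ν σ : Coord → ℝ} (h : IsIdealTetrad ε U X ξ w v q u μ lam ν σ) (hε : ε = 1 ∨ ε = -1)
  (hU : IsOpen U)
include h hε hU

lemma quasiUmbilicFrame (hr : ∀ x ∈ U, μ x = 3 * lam x ∧ ν x = lam x) :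
    QuasiUmbilicFrame ε U X ξ ![w, v, q, u] ![lam, lam, lam, fun x => 3 * lam x] :=
  { h.principalFrame hε hU with
    principal := fun x hx a V => by
      rw [(h.principalFrame hε hU).principal x hx a V]
      congr 1
      fin_cases a
      · simp [h.sigma_eq hε hU hx, hr x hx]
        ring
      · rfl
      · exact (hr x hx).2
      · exact (hr x hx).1
    spatial_curvature := fun x _ a ha => by
      fin_cases a
      exacts [rfl, rfl, rfl, absurd rfl ha]
    time_curvature := fun _ _ => rfl }

end IsIdealTetrad

end IdealEmbedding

end

theorem mainTheorem4 (ε : ℝ) (hε : ε = 1 ∨ ε = -1)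
    (U : Set Coord) (hU : IsOpen U) (hUc : IsPreconnected U)
    (X ξ : Coord → Ambient) (w v q u : Coord → Coord) (μ lam ν σ : Coord → ℝ)
    (h : IsIdealTetrad ε U X ξ w v q u μ lam ν σ) :
    (((∀ x ∈ U, μ x = -lam x ∧ ν x = lam x) ∨
        (∀ x ∈ U, μ x = -ν x ∧ lam x = -3 * ν x) ∨
        (∀ x ∈ U, μ x = -lam x ∧ ν x = -3 * lam x)) →
      ∀ x ∈ U, μ x = 0 ∧ lam x = 0 ∧ ν x = 0 ∧ IsFlatAt (inducedMetric ε X) x) ∧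
    ((∀ x ∈ U, μ x = 3 * lam x ∧ ν x = lam x) →
      (∀ x ∈ U, lam x = 0 ∧ IsFlatAt (inducedMetric ε X) x) ∨
      ∃ k : ℤ, (k = 1 ∨ k = 0 ∨ k = -1) ∧ ∃ c : ℝ, c ≠ 0 ∧
        ∀ x₀ ∈ U, ∃ (Φ : OpenPartialHomeomorph Coord Coord) (a : ℝ → ℝ),
          x₀ ∈ Φ.source ∧ Φ.source ⊆ U ∧
          IsRobertsonWalkerChart (inducedMetric ε X) k a Φ ∧
          ∀ y ∈ Φ.source,
            fderiv ℝ Φ y (u y) = Pi.single 3 1 ∧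
            (deriv a (Φ y 3)) ^ 2 = ε * c ^ 2 * a (Φ y 3) ^ 6 - k ∧
            lam y = c * a (Φ y 3) ^ 2 ∧
            ∀ (κ ρ p : ℝ) (V : Coord),
              IsPerfectFluidAt (inducedMetric ε X) κ ρ p V y ↔
                (κ * ρ = 3 * ε * c ^ 2 * a (Φ y 3) ^ 4 ∧
                  κ * p = -7 * ε * c ^ 2 * a (Φ y 3) ^ 4 ∧
                  (V = u y ∨ V = -u y))) := by
  refine ⟨fun hr x hx => ?_, fun hr => ?_⟩
  · have h0 := h.eq_zero_of_ratio hε hU hr hx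
    exact ⟨h0.1, h0.2.1, h0.2.2, h.isFlatAt hε hU hx h0⟩
  have hF := h.quasiUmbilicFrame hε hU hr
  refine (hF.curvature_eq_zero_or_ne_zero hUc).imp (fun h0 x hx => ?_) fun hne => ?_
  · have hlam : lam x = 0 := h0 x hx
    exact ⟨hlam, h.isFlatAt hε hU hx (by simp [hr x hx, hlam])⟩
  obtain ⟨k, hk, c, hc, hkc⟩ := hF.exists_curvature_constants hne hUc
  refine ⟨k, hk, c, hc, fun x₀ hx₀ => ?_⟩
  obtain ⟨Φ, a, hx₀Φ, hΦU, hΦ, hΦa⟩ := hF.exists_isRobertsonWalkerChart hne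
    (fun x hx => (hkc x hx).1) hc hk (fun x hx => (hkc x hx).2) hx₀
  refine ⟨Φ, a, hx₀Φ, hΦU, hΦ, fun y hy => ?_⟩
  obtain ⟨hu, ha, hlam⟩ := hΦa y hy
  refine ⟨hu, ha, hlam, fun κ ρ p V => ?_⟩
  have hfluid := hF.isPerfectFluidAt_iff (hΦU hy) (hne y (hΦU hy)) κ ρ p V
  rw [hlam, mul_pow, ← pow_mul, ← mul_assoc, ← mul_assoc] at hfluid
  exact hfluid
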